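/- **Conventions.** $d$ is the geodesic distance on the unit sphere $\mathbb S^2\subset\mathbb R^3$. A $C^1$ immersed curve $\gamma$ in $\mathbb S^2$ is considered up to orientation preserving $C^1$ reparametrization and is represented by its parametrization $\gamma:[0,1]\to\mathbb S^2$ of constant speed; $\mathbf t_\gamma$ is its unit tangent vector, $\mathbf n_\gamma=\gamma\times\mathbf t_\gamma$, and $\mathfrak F_\gamma(t)\in \mathrm{SO}_3(\mathbb R)$ is the Frenet frame, with columns $\gamma(t),\mathbf t_\gamma(t),\mathbf n_\gamma(t)$. Sets of immersed curves carry the topology of the metric $\bar d(\alpha,\beta)=\max_{t\in[0,1]}\big(d(\alpha(t),\beta(t))+d(\mathbf t_\alpha(t),\mathbf t_\beta(t))\big)$. A circle with center $a\in\mathbb S^2$ and radius $r\in(0,\pi)$, travelled anti-clockwise with respect to $a$, is *tangent to $\gamma$ at $\gamma(t)$ from the left* (resp. *right*) if it passes through $\gamma(t)$ with direction $\mathbf t_\gamma(t)$ and $d(\gamma(s),a)\ge r$ (resp. $\le r$) for all $s\in[0,1]$ close to $t$. Let $\kappa_\gamma^+(t)$ be the infimum of $\cot r$ over the circles tangent from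 the left, and $\kappa_\gamma^-(t)$ the supremum of $\cot r$ over the circles tangent from the right ($\inf\emptyset=+\infty$, $\sup\emptyset=-\infty$). For $Q\in \mathrm{SO}_3(\mathbb R)$ let $\mathcal I(I,Q)$ be the space of immersed curves with $\mathfrak F_\gamma(0)=I$ (the identity matrix) and $\mathfrak F_\gamma(1)=Q$. For $\rho_0\in(0,\pi/4)$ and $\kappa_0=\cot\rho_0$ let $\mathcal L_{\rho_0}(Q)\subset\mathcal I(I,Q)$ be the subspace of curves with $-\kappa_0<\kappa^-_\gamma(t)\le\kappa^+_\gamma(t)<\kappa_0$ for all $t\in[0,1]$. For an immersed curve $\gamma$, $t_0\in(0,1)$ and an integer $n\ge 1$, let $\gamma^{[t_0\#2n]}$ be the immersed curve that follows $\gamma$ (parametrized with constant speed) up to $\gamma(t_0)$, then runs $2n$ times around the great circle $\theta\mapsto\mathfrak F_\gamma(t_0)(\cos\theta,\sin\theta,0)^{\mathsf T}$, and then follows the rest of $\gamma$. For $f:K\to\mathcal L_{\rho_0}(Q)$ and $t_0:K\to(0,1)$ write $f^{[t_0\#2n]}(p)=f(p)^{[t_0(p)\#2n]}$. **Proposition.**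 Let $\rho_0\in(0,\pi/4)$, $Q\in \mathrm{SO}_3(\mathbb R)$, let $n$ be a positive integer, $K$ a compact space, and let $f:K\to\mathcal L_{\rho_0}(Q)$ and $t_0:K\to(0,1)$ be continuous. Then $f^{[t_0\#2n]}$ is a continuous map from $K$ to $\mathcal L_{\rho_0}(Q)$, and $f$ is homotopic to a constant map in $\mathcal I(I,Q)$ if and only if $f^{[t_0\#2n]}$ is homotopic to a constant map in $\mathcal L_{\rho_0}(Q)$. -/

import Mathlib

noncomputable section

/-- Euclidean three-space. -/
abbrev E3 : Type := EuclideanSpace ℝ (Fin 3)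

/-- The vector product of Euclidean three-space. -/
def E3.cross (x y : E3) : E3 := WithLp.toLp 2 (crossProduct x.ofLp y.ofLp)

/-- A `C¹` immersed curve in the unit sphere of `E3`, up to orientation preserving `C¹`
reparametrization. Every class has exactly one representative on `[0,1]` whose speed is constant,
and the class is recorded by that representative: `pos` is the curve, `tan` its (continuous) unit
tangent vector, `len` its length, and the derivative of the curve at time `t` is `len • tan t`. -/
structure ImmersedCurve where
  pos : C(unitInterval, E3)
  tan : C(unitInterval, E3)
  len : ℝ
  len_pos : 0 < len
  norm_pos : ∀ t, ‖pos t‖ = 1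
  norm_tan : ∀ t, ‖tan t‖ = 1
  hasDeriv : ∀ t : unitInterval,
    HasDerivWithinAt (Set.IccExtend zero_le_one pos) (len • tan t) (Set.Icc 0 1) (t : ℝ)

namespace ImmersedCurve

theorem ext_of_pos_tan {α β : ImmersedCurve} (hp : ∀ t, α.pos t = β.pos t)
    (ht : ∀ t, α.tan t = β.tan t) : α = β := by
  have hp' : α.pos = β.pos := ContinuousMap.ext hp
  have ht' : α.tan = β.tan := ContinuousMap.ext ht
  have hl : α.len = β.len := by
    have h1 := α.hasDeriv 0
    have h2 := β.hasDeriv 0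
    rw [hp', ht'] at h1
    have hu : UniqueDiffWithinAt ℝ (Set.Icc (0 : ℝ) 1) ((0 : unitInterval) : ℝ) :=
      uniqueDiffOn_Icc zero_lt_one _ (0 : unitInterval).2
    have h3 := hu.eq_deriv _ h1 h2
    have hne : β.tan 0 ≠ 0 := by
      intro h
      have := β.norm_tan 0
      rw [h, norm_zero] at this
      exact zero_ne_one this
    exact smul_left_injective ℝ hne h3
  cases α
  cases β
  simp only at hp' ht' hl
  subst hp' ht' hl
  rfl

/-- The distance `max_t (d(α(t), β(t)) + d(t_α(t), t_β(t)))` of two immersed curves, `d` being the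
distance measured on the sphere (the angle between unit vectors). -/
instance : Dist ImmersedCurve where
  dist α β := ⨆ t : unitInterval,
    (InnerProductGeometry.angle (α.pos t) (β.pos t)
      + InnerProductGeometry.angle (α.tan t) (β.tan t))

theorem dist_def (α β : ImmersedCurve) :
    dist α β = ⨆ t : unitInterval,
      (InnerProductGeometry.angle (α.pos t) (β.pos t)
        + InnerProductGeometry.angle (α.tan t) (β.tan t)) := rfl

theorem bddAbove_angles (α β : ImmersedCurve) :
    BddAbove (Set.range fun t : unitInterval =>
      (InnerProductGeometry.angle (α.pos t) (β.pos t)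
        + InnerProductGeometry.angle (α.tan t) (β.tan t))) := by
  refine ⟨Real.pi + Real.pi, ?_⟩
  rintro _ ⟨t, rfl⟩
  exact add_le_add (InnerProductGeometry.angle_le_pi _ _) (InnerProductGeometry.angle_le_pi _ _)

theorem eq_of_angle_eq_zero {x y : E3} (hx : ‖x‖ = 1) (hy : ‖y‖ = 1)
    (h : InnerProductGeometry.angle x y = 0) : x = y := by
  obtain ⟨-, r, hr, rfl⟩ := InnerProductGeometry.angle_eq_zero_iff.1 h
  rw [norm_smul, hx, mul_one, Real.norm_eq_abs, abs_of_pos hr] at hy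
  rw [hy, one_smul]

theorem ne_zero_of_norm {x : E3} (hx : ‖x‖ = 1) : x ≠ 0 := by
  rintro rfl
  simp at hx

instance : MetricSpace ImmersedCurve where
  dist_self α := by
    simp [dist_def, InnerProductGeometry.angle_self (ne_zero_of_norm (α.norm_pos _)),
      InnerProductGeometry.angle_self (ne_zero_of_norm (α.norm_tan _))]
  dist_comm α β := by
    simp only [dist_def, InnerProductGeometry.angle_comm]
  dist_triangle α β γ := by
    refine ciSup_le fun t => ?_
    have h1 := le_ciSup (bddAbove_angles α β) t
    have h2 := le_ciSup (bddAbove_angles β γ) t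
    have h3 := InnerProductGeometry.angle_le_angle_add_angle (α.pos t) (β.pos t) (γ.pos t)
    have h4 := InnerProductGeometry.angle_le_angle_add_angle (α.tan t) (β.tan t) (γ.tan t)
    rw [← dist_def] at h1 h2
    linarith
  eq_of_dist_eq_zero {α β} h := by
    have key : ∀ t, InnerProductGeometry.angle (α.pos t) (β.pos t)
        + InnerProductGeometry.angle (α.tan t) (β.tan t) ≤ 0 := fun t => by
      have h1 := le_ciSup (bddAbove_angles α β) t
      rw [← dist_def, h] at h1
      exact h1
    refine ext_of_pos_tan (fun t => ?_) (fun t => ?_)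
    · refine eq_of_angle_eq_zero (α.norm_pos t) (β.norm_pos t) ?_
      linarith [key t, InnerProductGeometry.angle_nonneg (α.pos t) (β.pos t),
        InnerProductGeometry.angle_nonneg (α.tan t) (β.tan t)]
    · refine eq_of_angle_eq_zero (α.norm_tan t) (β.norm_tan t) ?_
      linarith [key t, InnerProductGeometry.angle_nonneg (α.pos t) (β.pos t),
        InnerProductGeometry.angle_nonneg (α.tan t) (β.tan t)]

/-- The unit normal vector `n(t) = γ(t) × t_γ(t)`. -/
def normal (γ : ImmersedCurve) (t : unitInterval) : E3 := E3.cross (γ.pos t) (γ.tan t)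

/-- The Frenet frame: the matrix with columns `γ(t)`, `t_γ(t)`, `n_γ(t)`. -/
def frame (γ : ImmersedCurve) (t : unitInterval) : Matrix (Fin 3) (Fin 3) ℝ :=
  Matrix.of fun i j => ![γ.pos t i, γ.tan t i, γ.normal t i] j

/-- The circle with center `a` and radius `r ∈ (0, π)` on the sphere, travelled anti-clockwise with
respect to `a`, passes through `γ(t)` with the direction of `γ` at `t`. (At a point `x` of that
circle its anti-clockwise unit tangent vector `v` satisfies `a × x = sin r • v`.) -/
def IsTangentCircle (γ : ImmersedCurve) (t : unitInterval) (a : E3) (r : ℝ) : Prop :=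
  ‖a‖ = 1 ∧ r ∈ Set.Ioo 0 Real.pi ∧ InnerProductGeometry.angle a (γ.pos t) = r ∧
    E3.cross a (γ.pos t) = Real.sin r • γ.tan t

/-- The circle with center `a` and radius `r` is tangent to `γ` at `γ(t)` from the left. -/
def IsLeftTangentCircle (γ : ImmersedCurve) (t : unitInterval) (a : E3) (r : ℝ) : Prop :=
  γ.IsTangentCircle t a r ∧ ∀ᶠ s in nhds t, r ≤ InnerProductGeometry.angle (γ.pos s) a

/-- The circle with center `a` and radius `r` is tangent to `γ` at `γ(t)` from the right. -/
def IsRightTangentCircle (γ : ImmersedCurve) (t : unitInterval) (a : E3) (r : ℝ) : Prop :=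
  γ.IsTangentCircle t a r ∧ ∀ᶠ s in nhds t, InnerProductGeometry.angle (γ.pos s) a ≤ r

/-- The left curvature `κ⁺` (equal to `+∞` if there is no tangent circle from the left). -/
def leftCurvature (γ : ImmersedCurve) (t : unitInterval) : EReal :=
  sInf {c : EReal | ∃ a r, γ.IsLeftTangentCircle t a r ∧ c = ((Real.cot r : ℝ) : EReal)}

/-- The right curvature `κ⁻` (equal to `-∞` if there is no tangent circle from the right). -/
def rightCurvature (γ : ImmersedCurve) (t : unitInterval) : EReal :=
  sSup {c : EReal | ∃ a r, γ.IsRightTangentCircle t a r ∧ c = ((Real.cot r : ℝ) : EReal)}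

/-- The space `𝓘(P, Q)` of immersed curves with initial frame `P` and final frame `Q`. -/
def immersed (P Q : Matrix.specialOrthogonalGroup (Fin 3) ℝ) : Set ImmersedCurve :=
  {γ | γ.frame 0 = (P : Matrix (Fin 3) (Fin 3) ℝ) ∧ γ.frame 1 = (Q : Matrix (Fin 3) (Fin 3) ℝ)}

/-- The space `𝓛_{κ₁}^{κ₂}(P, Q)` of curves in `𝓘(P, Q)` with curvature in `(κ₁, κ₂)`. -/
def constrained (κ₁ κ₂ : EReal) (P Q : Matrix.specialOrthogonalGroup (Fin 3) ℝ) :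
    Set ImmersedCurve :=
  {γ | γ ∈ immersed P Q ∧ ∀ t, κ₁ < γ.rightCurvature t ∧
    γ.rightCurvature t ≤ γ.leftCurvature t ∧ γ.leftCurvature t < κ₂}

/-- The space `𝓛_{ρ₀}(Q) = 𝓛_{-κ₀}^{κ₀}(I, Q)`, where `κ₀ = cot ρ₀` (for `0 < ρ₀ ≤ π / 2`). -/
def curvesL (ρ₀ : ℝ) (Q : Matrix.specialOrthogonalGroup (Fin 3) ℝ) : Set ImmersedCurve :=
  constrained ((-Real.cot ρ₀ : ℝ) : EReal) ((Real.cot ρ₀ : ℝ) : EReal) 1 Q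

theorem curvesL_subset_immersed (ρ₀ : ℝ) (Q : Matrix.specialOrthogonalGroup (Fin 3) ℝ) :
    curvesL ρ₀ Q ⊆ immersed 1 Q := fun _ h => h.1

/-! ### Adding loops -/

theorem hasDerivWithinAt_mem (γ : ImmersedCurve) {x : ℝ} (hx : x ∈ Set.Icc (0 : ℝ) 1) :
    HasDerivWithinAt (Set.IccExtend zero_le_one γ.pos)
      (γ.len • Set.IccExtend zero_le_one γ.tan x) (Set.Icc 0 1) x := by
  rw [Set.IccExtend_of_mem _ _ hx]
  exact γ.hasDeriv ⟨x, hx⟩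

theorem inner_pos_tan (γ : ImmersedCurve) (t : unitInterval) :
    inner ℝ (γ.pos t) (γ.tan t) = 0 := by
  have h := (γ.hasDeriv t).norm_sq
  have hu : UniqueDiffWithinAt ℝ (Set.Icc (0 : ℝ) 1) (t : ℝ) :=
    uniqueDiffOn_Icc zero_lt_one _ t.2
  have hc : HasDerivWithinAt (fun x => ‖Set.IccExtend zero_le_one γ.pos x‖ ^ 2) 0
      (Set.Icc (0 : ℝ) 1) (t : ℝ) := by
    have : (fun x => ‖Set.IccExtend (zero_le_one (α := ℝ)) γ.pos x‖ ^ 2) = fun _ => (1 : ℝ) := by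
      funext x
      simp [Set.IccExtend, γ.norm_pos]
    rw [this]
    exact hasDerivWithinAt_const _ _ _
  have h2 := hu.eq_deriv _ h hc
  rw [Set.IccExtend_val, inner_smul_right] at h2
  have := γ.len_pos.ne'
  simpa [this] using h2

theorem norm_circle {p v : E3} (hp : ‖p‖ = 1) (hv : ‖v‖ = 1) (h : inner ℝ p v = 0) (c s : ℝ)
    (hcs : c ^ 2 + s ^ 2 = 1) : ‖c • p + s • v‖ = 1 := by
  have : ‖c • p + s • v‖ ^ 2 = 1 := by
    rw [norm_add_sq_real, norm_smul, norm_smul, inner_smul_left, inner_smul_right, h, hp, hv]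
    simp [hcs]
  exact (pow_eq_one_iff_of_nonneg (norm_nonneg _) two_ne_zero).1 this

/-- The curve `γ`, followed at unit speed up to `γ(t₀)`, then `k` times along the great circle
`𝔉_γ(t₀) (cos θ, sin θ, 0)` which is tangent to `γ` at `γ(t₀)`, then along the rest of `γ`;
`σ ∈ [0, len γ + 2πk]` is the arc length. -/
def graftPos (γ : ImmersedCurve) (t₀ : unitInterval) (k : ℕ) (σ : ℝ) : E3 :=
  if σ ≤ t₀ * γ.len then Set.IccExtend zero_le_one γ.pos (σ / γ.len)
  else if σ ≤ t₀ * γ.len + 2 * Real.pi * k then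
    Real.cos (σ - t₀ * γ.len) • γ.pos t₀ + Real.sin (σ - t₀ * γ.len) • γ.tan t₀
  else Set.IccExtend zero_le_one γ.pos ((σ - 2 * Real.pi * k) / γ.len)

/-- The unit tangent vector of the curve `graftPos`. -/
def graftTan (γ : ImmersedCurve) (t₀ : unitInterval) (k : ℕ) (σ : ℝ) : E3 :=
  if σ ≤ t₀ * γ.len then Set.IccExtend zero_le_one γ.tan (σ / γ.len)
  else if σ ≤ t₀ * γ.len + 2 * Real.pi * k then
    (-Real.sin (σ - t₀ * γ.len)) • γ.pos t₀ + Real.cos (σ - t₀ * γ.len) • γ.tan t₀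
  else Set.IccExtend zero_le_one γ.tan ((σ - 2 * Real.pi * k) / γ.len)

theorem sin_loops (k : ℕ) : Real.sin (k * (2 * Real.pi)) = 0 := by
  have h := Real.sin_nat_mul_pi (k * 2)
  push_cast at h
  rwa [mul_assoc] at h

theorem loops_nonneg (k : ℕ) : 0 ≤ 2 * Real.pi * k := by positivity

theorem continuous_graftPos (γ : ImmersedCurve) (t₀ : unitInterval) (k : ℕ) :
    Continuous (γ.graftPos t₀ k) := by
  have hL := γ.len_pos.ne'
  have hP : Continuous (Set.IccExtend (zero_le_one (α := ℝ)) γ.pos) := γ.pos.continuous.Icc_extend'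
  refine Continuous.if_le (by fun_prop) (Continuous.if_le (by fun_prop) (by fun_prop)
    (by fun_prop) (by fun_prop) ?_) (by fun_prop) (by fun_prop) ?_
  · rintro σ rfl
    have h1 : ((t₀ : ℝ) * γ.len + 2 * Real.pi * k - 2 * Real.pi * k) / γ.len = t₀ := by
      field_simp
      ring
    have h2 : (t₀ : ℝ) * γ.len + 2 * Real.pi * k - t₀ * γ.len = k * (2 * Real.pi) := by ring
    rw [h1, h2, Set.IccExtend_val, Real.cos_nat_mul_two_pi, sin_loops]
    simp
  · rintro σ rfl
    have h1 : (t₀ : ℝ) * γ.len / γ.len = t₀ := by field_simp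
    rw [if_pos (le_add_of_nonneg_right (loops_nonneg k)), h1, Set.IccExtend_val]
    simp

theorem continuous_graftTan (γ : ImmersedCurve) (t₀ : unitInterval) (k : ℕ) :
    Continuous (γ.graftTan t₀ k) := by
  have hL := γ.len_pos.ne'
  have hP : Continuous (Set.IccExtend (zero_le_one (α := ℝ)) γ.tan) := γ.tan.continuous.Icc_extend'
  refine Continuous.if_le (by fun_prop) (Continuous.if_le (by fun_prop) (by fun_prop)
    (by fun_prop) (by fun_prop) ?_) (by fun_prop) (by fun_prop) ?_
  · rintro σ rfl
    have h1 : ((t₀ : ℝ) * γ.len + 2 * Real.pi * k - 2 * Real.pi * k) / γ.len = t₀ := by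
      field_simp
      ring
    have h2 : (t₀ : ℝ) * γ.len + 2 * Real.pi * k - t₀ * γ.len = k * (2 * Real.pi) := by ring
    rw [h1, h2, Set.IccExtend_val, Real.cos_nat_mul_two_pi, sin_loops]
    simp
  · rintro σ rfl
    have h1 : (t₀ : ℝ) * γ.len / γ.len = t₀ := by field_simp
    rw [if_pos (le_add_of_nonneg_right (loops_nonneg k)), h1, Set.IccExtend_val]
    simp

theorem norm_graftPos (γ : ImmersedCurve) (t₀ : unitInterval) (k : ℕ) (σ : ℝ) :
    ‖γ.graftPos t₀ k σ‖ = 1 := by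
  unfold graftPos
  split_ifs
  · exact γ.norm_pos _
  · exact norm_circle (γ.norm_pos _) (γ.norm_tan _) (γ.inner_pos_tan _) _ _
      (Real.cos_sq_add_sin_sq _)
  · exact γ.norm_pos _

theorem norm_graftTan (γ : ImmersedCurve) (t₀ : unitInterval) (k : ℕ) (σ : ℝ) :
    ‖γ.graftTan t₀ k σ‖ = 1 := by
  unfold graftTan
  split_ifs
  · exact γ.norm_tan _
  · exact norm_circle (γ.norm_pos _) (γ.norm_tan _) (γ.inner_pos_tan _) _ _
      (by rw [neg_sq]; exact Real.sin_sq_add_cos_sq _)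
  · exact γ.norm_tan _

/-- A derivative of a function on a closed interval, obtained from one of a function that agrees
with it there; off the closed interval there is nothing to prove. -/
theorem hasDerivWithinAt_piece {f g f' g' : ℝ → E3} {a b : ℝ}
    (hfg : Set.EqOn f g (Set.Icc a b)) (hfg' : Set.EqOn f' g' (Set.Icc a b))
    (hg : ∀ x ∈ Set.Icc a b, HasDerivWithinAt g (g' x) (Set.Icc a b) x) (x : ℝ) :
    HasDerivWithinAt f (f' x) (Set.Icc a b) x := by
  by_cases hx : x ∈ Set.Icc a b
  · rw [hfg' hx]
    exact (hg x hx).congr hfg (hfg hx)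
  · refine HasFDerivWithinAt.of_notMem_closure ?_
    rwa [isClosed_Icc.closure_eq]

theorem hasDerivWithinAt_rescale (γ : ImmersedCurve) (c : ℝ) {a b x : ℝ}
    (hab : ∀ y ∈ Set.Icc a b, (y - c) / γ.len ∈ Set.Icc (0 : ℝ) 1) (hx : x ∈ Set.Icc a b) :
    HasDerivWithinAt (fun y => Set.IccExtend zero_le_one γ.pos ((y - c) / γ.len))
      (Set.IccExtend zero_le_one γ.tan ((x - c) / γ.len)) (Set.Icc a b) x := by
  have h1 : HasDerivWithinAt (fun y : ℝ => (y - c) / γ.len) (1 / γ.len) (Set.Icc a b) x :=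
    ((hasDerivWithinAt_id x _).sub_const c).div_const _
  have h2 := (γ.hasDerivWithinAt_mem (hab x hx)).scomp x h1 hab
  rw [smul_smul, one_div, inv_mul_cancel₀ γ.len_pos.ne', one_smul] at h2
  exact h2

theorem hasDerivWithinAt_graftPos (γ : ImmersedCurve) (t₀ : unitInterval) (k : ℕ) (σ : ℝ) :
    HasDerivWithinAt (γ.graftPos t₀ k) (γ.graftTan t₀ k σ)
      (Set.Icc 0 (γ.len + 2 * Real.pi * k)) σ := by
  have hL := γ.len_pos
  have hk := loops_nonneg k
  set m : ℝ := 2 * Real.pi * k with hm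
  set a : ℝ := t₀ * γ.len with ha
  have ha0 : 0 ≤ a := mul_nonneg t₀.2.1 hL.le
  have ha1 : a ≤ γ.len := mul_le_of_le_one_left hL.le t₀.2.2
  have haL : a / γ.len = t₀ := by rw [ha]; field_simp
  have hcos : Real.cos m = 1 := by rw [hm, mul_comm]; exact Real.cos_nat_mul_two_pi k
  have hsin : Real.sin m = 0 := by rw [hm, mul_comm]; exact sin_loops k
  have d1 : HasDerivWithinAt (γ.graftPos t₀ k) (γ.graftTan t₀ k σ) (Set.Icc 0 a) σ := by
    refine hasDerivWithinAt_piece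
      (g := fun y => Set.IccExtend zero_le_one γ.pos ((y - 0) / γ.len))
      (g' := fun y => Set.IccExtend zero_le_one γ.tan ((y - 0) / γ.len))
      (fun y hy => ?_) (fun y hy => ?_) (fun y hy => γ.hasDerivWithinAt_rescale 0 ?_ hy) σ
    · rw [graftPos, if_pos hy.2]
      simp only [sub_zero]
    · rw [graftTan, if_pos hy.2]
      simp only [sub_zero]
    · rintro z ⟨hz0, hz1⟩
      rw [sub_zero]
      exact ⟨div_nonneg hz0 hL.le, (div_le_one hL).2 (hz1.trans ha1)⟩
  have d2 : HasDerivWithinAt (γ.graftPos t₀ k) (γ.graftTan t₀ k σ) (Set.Icc a (a + m)) σ := by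
    refine hasDerivWithinAt_piece
      (g := fun y => Real.cos (y - a) • γ.pos t₀ + Real.sin (y - a) • γ.tan t₀)
      (g' := fun y => (-Real.sin (y - a)) • γ.pos t₀ + Real.cos (y - a) • γ.tan t₀)
      (fun y hy => ?_) (fun y hy => ?_) (fun y hy => ?_) σ
    · rcases hy.1.eq_or_lt with rfl | hlt
      · simp [graftPos, ← ha, haL, Set.IccExtend_val]
      · rw [graftPos, if_neg (not_le.2 hlt), if_pos hy.2]
    · rcases hy.1.eq_or_lt with rfl | hlt
      · simp [graftTan, ← ha, haL, Set.IccExtend_val]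
      · rw [graftTan, if_neg (not_le.2 hlt), if_pos hy.2]
    · have hs : HasDerivAt (fun y : ℝ => y - a) 1 y := (hasDerivAt_id y).sub_const a
      have h1 := (hs.cos).smul_const (γ.pos t₀)
      have h2 := (hs.sin).smul_const (γ.tan t₀)
      have h3 := (h1.fun_add h2).hasDerivWithinAt (s := Set.Icc a (a + m))
      rw [mul_one, mul_one] at h3
      exact h3
  have d3 : HasDerivWithinAt (γ.graftPos t₀ k) (γ.graftTan t₀ k σ)
      (Set.Icc (a + m) (γ.len + m)) σ := by
    have hend : ∀ y, a + m ≤ y → y ≤ a → y = a ∧ m = 0 := fun y h1 h2 =>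
      ⟨by linarith, by linarith⟩
    refine hasDerivWithinAt_piece
      (g := fun y => Set.IccExtend zero_le_one γ.pos ((y - m) / γ.len))
      (g' := fun y => Set.IccExtend zero_le_one γ.tan ((y - m) / γ.len))
      (fun y hy => ?_) (fun y hy => ?_) (fun y hy => γ.hasDerivWithinAt_rescale m ?_ hy) σ
    · by_cases h1 : y ≤ a
      · obtain ⟨rfl, h0⟩ := hend y hy.1 h1
        rw [graftPos, if_pos h1, h0]
        simp only [sub_zero]
      · rcases hy.1.eq_or_lt with h2 | hlt
        · rw [graftPos, if_neg h1, if_pos h2.ge, ← h2]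
          simp [← ha, haL, hcos, hsin, Set.IccExtend_val]
        · rw [graftPos, if_neg h1, if_neg (not_le.2 hlt)]
    · by_cases h1 : y ≤ a
      · obtain ⟨rfl, h0⟩ := hend y hy.1 h1
        rw [graftTan, if_pos h1, h0]
        simp only [sub_zero]
      · rcases hy.1.eq_or_lt with h2 | hlt
        · rw [graftTan, if_neg h1, if_pos h2.ge, ← h2]
          simp [← ha, haL, hcos, hsin, Set.IccExtend_val]
        · rw [graftTan, if_neg h1, if_neg (not_le.2 hlt)]
    · rintro z ⟨hz0, hz1⟩
      exact ⟨div_nonneg (by linarith) hL.le, (div_le_one hL).2 (by linarith)⟩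
  have h := (d1.union d2).union d3
  rwa [Set.Icc_union_Icc_eq_Icc ha0 (by linarith),
    Set.Icc_union_Icc_eq_Icc (by linarith) (by linarith)] at h

/-- The curve `γ^{[t₀ # k]}`: the curve `γ`, parametrized by `[0,1]` with constant speed, with `k`
loops along the great circle tangent to `γ` at `γ(t₀)` inserted at `γ(t₀)`, again parametrized by
`[0,1]` with constant speed. -/
def graft (γ : ImmersedCurve) (t₀ : unitInterval) (k : ℕ) : ImmersedCurve where
  pos := ⟨fun t => γ.graftPos t₀ k ((γ.len + 2 * Real.pi * k) * t),
    (γ.continuous_graftPos t₀ k).comp (by fun_prop)⟩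
  tan := ⟨fun t => γ.graftTan t₀ k ((γ.len + 2 * Real.pi * k) * t),
    (γ.continuous_graftTan t₀ k).comp (by fun_prop)⟩
  len := γ.len + 2 * Real.pi * k
  len_pos := add_pos_of_pos_of_nonneg γ.len_pos (loops_nonneg k)
  norm_pos _ := γ.norm_graftPos _ _ _
  norm_tan _ := γ.norm_graftTan _ _ _
  hasDeriv t := by
    have hM : 0 < γ.len + 2 * Real.pi * k :=
      add_pos_of_pos_of_nonneg γ.len_pos (loops_nonneg k)
    set M : ℝ := γ.len + 2 * Real.pi * k with hMdef
    have h1 : HasDerivWithinAt (fun x : ℝ => M * x) M (Set.Icc 0 1) (t : ℝ) := by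
      simpa using (hasDerivWithinAt_id (t : ℝ) (Set.Icc 0 1)).const_mul M
    have hmaps : Set.MapsTo (fun x : ℝ => M * x) (Set.Icc 0 1) (Set.Icc 0 M) := fun x hx =>
      ⟨mul_nonneg hM.le hx.1, mul_le_of_le_one_right hM.le hx.2⟩
    have h2 := (γ.hasDerivWithinAt_graftPos t₀ k (M * t)).scomp (t : ℝ) h1 hmaps
    refine h2.congr (fun x hx => ?_) ?_
    · rw [Set.IccExtend_of_mem _ _ hx]
      rfl
    · rw [Set.IccExtend_val]
      rfl

end ImmersedCurve

end

/-!
A curve in the sphere with initial frame `1` is determined by its frame as a function of arc length.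
Such arcs form a topological monoid `Arc` under concatenation, in which the final frame `Arc.last`
is multiplicative, and the curves with final frame `Q` are the arcs of positive length with
`last = Q`. A bound of the curvature is a local condition on frames (`SO3.CurvLT`): compared with
its tangent great circle at any point, the curve nearby lies between the tangent circles of
curvature `±c` for some `c < cot ρ₀`. Since `ρ₀ < π / 4`, circles of curvature between `-1` and `1`
are allowed.

The number of inserted great circles can be changed by two within bounded curvature
(`Arc.deform_ins_add_two`): the circle arcs of curvatures `k, -k, k, -k` with `k = √(-cos a)`, along
each of which the frame turns by `a`, form a closed curve, which is one great circle for
`a = π / 2` and three great circles for `a = 3π / 2`.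

Suppose that the family `f` is contracted by a homotopy in the space of immersed curves. Every frame
near `1` is the final frame of a chain of four circle arcs of curvature at most `1`, two of them
half-turns, that depends continuously on the frame and consists of two great circles for the frame
`1` (`Arc.detour`). Add great circles until there are `2N` of them, with `N` large; move two of them
to each of `N` division points of the curve (`Arc.deform_spread`); and shrink each of the `N` pieces
of the curve to a point while the two great circles at its end become the detour for what is missing
(`Arc.deform_detours`). The resulting curve depends on the frames of the original curve at the
division points only, not on its curvature, so that the homotopy of immersed curves can be applied
to it.

Conversely, `f` is homotopic as a family of immersed curves to the family with two great circles
inserted (`Arc.deform_ins_two`): the curves are made geodesic near the given points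
(`Arc.exists_straightening`), the geodesic pieces are deformed to kinks which develop a small circle
at each end (`Arc.kink`), these circles are enlarged to great circles and moved to the given points,
and the straightening is undone. Hence `f` is nullhomotopic if the family with great circles is.
-/

noncomputable section

/-! ### Rotations -/

/-- The rotation group of three-space. -/
abbrev SO3 : Type := Matrix.specialOrthogonalGroup (Fin 3) ℝ

namespace SO3

theorem coe_inv (A : SO3) : ((A⁻¹ : SO3) : Matrix (Fin 3) (Fin 3) ℝ) = A.1.transpose := by
  rw [← Matrix.conjTranspose_eq_transpose_of_trivial]
  rfl

theorem inv_apply (A : SO3) (i j : Fin 3) : (A⁻¹).1 i j = A.1 j i := by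
  rw [coe_inv]; rfl

theorem mul_apply (A B : SO3) (i j : Fin 3) :
    (A * B).1 i j = A.1 i 0 * B.1 0 j + A.1 i 1 * B.1 1 j + A.1 i 2 * B.1 2 j := by
  change (A.1 * B.1) i j = _
  rw [Matrix.mul_apply, Fin.sum_univ_three]

theorem inv_mul_apply (A B : SO3) (i j : Fin 3) :
    (A⁻¹ * B).1 i j = A.1 0 i * B.1 0 j + A.1 1 i * B.1 1 j + A.1 2 i * B.1 2 j := by
  simp only [mul_apply, inv_apply]

theorem one_apply (i j : Fin 3) : (1 : SO3).1 i j = if i = j then 1 else 0 := by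
  change (1 : Matrix (Fin 3) (Fin 3) ℝ) i j = _
  rw [Matrix.one_apply]

theorem ext' {A B : SO3} (h : ∀ i j, A.1 i j = B.1 i j) : A = B :=
  Subtype.ext (Matrix.ext h)

theorem col_dot (A : SO3) (i j : Fin 3) :
    A.1 0 i * A.1 0 j + A.1 1 i * A.1 1 j + A.1 2 i * A.1 2 j = if i = j then 1 else 0 := by
  rw [← inv_mul_apply, inv_mul_cancel, one_apply]

theorem row_dot (A : SO3) (i j : Fin 3) :
    A.1 i 0 * A.1 j 0 + A.1 i 1 * A.1 j 1 + A.1 i 2 * A.1 j 2 = if i = j then 1 else 0 := by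
  have := mul_apply A A⁻¹ i j
  simp only [inv_apply] at this
  rw [← this, mul_inv_cancel, one_apply]

/-- A rotation matrix is its own matrix of cofactors. -/
theorem cofactor (A : SO3) (i j : Fin 3) : A.1 i j = A.1.adjugate j i := by
  have hd : A.1.det = 1 := (Matrix.mem_specialOrthogonalGroup_iff.1 A.2).2
  have h1 : A.1.adjugate = A.1.transpose := by
    have h2 : A.1.adjugate * A.1 = 1 := by rw [Matrix.adjugate_mul, hd, one_smul]
    have h3 : A.1 * A.1.transpose = 1 := by
      rw [← coe_inv]; exact congrArg Subtype.val (mul_inv_cancel A)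
    calc A.1.adjugate = A.1.adjugate * (A.1 * A.1.transpose) := by rw [h3, mul_one]
      _ = A.1.transpose := by rw [← mul_assoc, h2, one_mul]
  rw [h1]; rfl

/-- A rotation is determined by its first two columns: the third one is their vector product. -/
theorem third_col (A : SO3) :
    A.1 0 2 = A.1 1 0 * A.1 2 1 - A.1 2 0 * A.1 1 1 ∧
    A.1 1 2 = A.1 2 0 * A.1 0 1 - A.1 0 0 * A.1 2 1 ∧
    A.1 2 2 = A.1 0 0 * A.1 1 1 - A.1 1 0 * A.1 0 1 := by
  rw [cofactor A 0 2, cofactor A 1 2, cofactor A 2 2, Matrix.adjugate_fin_three]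
  simp
  refine ⟨?_, ?_, ?_⟩ <;> ring

theorem mem_of_cols {M : Matrix (Fin 3) (Fin 3) ℝ} (h : M.transpose * M = 1) (hd : M.det = 1) :
    M ∈ Matrix.specialOrthogonalGroup (Fin 3) ℝ :=
  Matrix.mem_specialOrthogonalGroup_iff.2 ⟨(Matrix.mem_orthogonalGroup_iff' _ _).2 h, hd⟩

theorem continuous_apply (i j : Fin 3) : Continuous fun A : SO3 => A.1 i j :=
  (continuous_apply_apply i j).comp continuous_subtype_val

theorem continuous_of_apply {X : Type*} [TopologicalSpace X] {F : X → SO3}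
    (h : ∀ i j, Continuous fun x => (F x).1 i j) : Continuous F :=
  Continuous.subtype_mk (continuous_pi fun i => continuous_pi fun j => h i j) _

instance : IsTopologicalGroup SO3 where
  continuous_inv := continuous_of_apply fun i j => by
    simp only [inv_apply]; exact continuous_apply j i

/-- The rotation matrix of the quaternion `w + x i + y j + z k` (homogeneous of degree two). -/
def quatMat (w x y z : ℝ) : Matrix (Fin 3) (Fin 3) ℝ :=
  !![w ^ 2 + x ^ 2 - y ^ 2 - z ^ 2, 2 * (x * y - w * z), 2 * (x * z + w * y);
     2 * (x * y + w * z), w ^ 2 - x ^ 2 + y ^ 2 - z ^ 2, 2 * (y * z - w * x);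
     2 * (x * z - w * y), 2 * (y * z + w * x), w ^ 2 - x ^ 2 - y ^ 2 + z ^ 2]

theorem quatMat_mul (w x y z w' x' y' z' : ℝ) :
    quatMat w x y z * quatMat w' x' y' z' =
      quatMat (w * w' - x * x' - y * y' - z * z') (w * x' + x * w' + y * z' - z * y')
        (w * y' - x * z' + y * w' + z * x') (w * z' + x * y' - y * x' + z * w') := by
  ext i j
  fin_cases i <;> fin_cases j <;>
    simp [quatMat, Matrix.mul_apply, Fin.sum_univ_three] <;> ring

theorem quatMat_one : quatMat 1 0 0 0 = 1 := by
  ext i j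
  fin_cases i <;> fin_cases j <;> simp [quatMat]

theorem quatMat_mem {w x y z : ℝ} (h : w ^ 2 + x ^ 2 + y ^ 2 + z ^ 2 = 1) :
    quatMat w x y z ∈ Matrix.specialOrthogonalGroup (Fin 3) ℝ := by
  have ht : (quatMat w x y z).transpose = quatMat w (-x) (-y) (-z) := by
    ext i j
    fin_cases i <;> fin_cases j <;> simp [quatMat] <;> ring
  refine mem_of_cols ?_ ?_
  · rw [ht, quatMat_mul, ← quatMat_one]
    congr 1
    · linear_combination h
    all_goals ring
  · have : (quatMat w x y z).det = (w ^ 2 + x ^ 2 + y ^ 2 + z ^ 2) ^ 3 := by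
      rw [Matrix.det_fin_three]
      simp [quatMat]
      ring
    rw [this, h, one_pow]

/-- The length of the vector `(k, 0, 1)`. -/
def slope (k : ℝ) : ℝ := √(1 + k ^ 2)

theorem slope_pos (k : ℝ) : 0 < slope k := Real.sqrt_pos.2 (by positivity)

theorem slope_sq (k : ℝ) : slope k ^ 2 = 1 + k ^ 2 := Real.sq_sqrt (by positivity)

@[simp] theorem slope_zero : slope 0 = 1 := by simp [slope]

theorem slope_neg (k : ℝ) : slope (-k) = slope k := by simp [slope]

@[fun_prop] theorem continuous_slope : Continuous slope := by unfold slope; fun_prop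

/-- The rotation by the angle `θ` about the axis `(k, 0, 1)`. A curve whose frame is the identity
follows a circle of geodesic curvature `k` when it is moved by these rotations. -/
def rot (k θ : ℝ) : SO3 :=
  ⟨quatMat (Real.cos (θ / 2)) (Real.sin (θ / 2) * (k / slope k)) 0
    (Real.sin (θ / 2) * (1 / slope k)), quatMat_mem (by
      have := slope_sq k
      have := (slope_pos k).ne'
      have h2 := Real.sin_sq_add_cos_sq (θ / 2)
      field_simp
      rw [slope_sq]
      linear_combination (1 + k ^ 2) * h2)⟩

theorem rot_apply (k θ : ℝ) : (rot k θ).1 =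
    !![(k ^ 2 + Real.cos θ) / (1 + k ^ 2), -(Real.sin θ / slope k),
        k * (1 - Real.cos θ) / (1 + k ^ 2);
       Real.sin θ / slope k, Real.cos θ, -(Real.sin θ * k / slope k);
       k * (1 - Real.cos θ) / (1 + k ^ 2), Real.sin θ * k / slope k,
        (1 + k ^ 2 * Real.cos θ) / (1 + k ^ 2)] := by
  have hs := slope_sq k
  have hs0 := (slope_pos k).ne'
  have h0 : (1 + k ^ 2) ≠ 0 := by positivity
  have h2 := Real.sin_sq_add_cos_sq (θ / 2)
  have e1 : Real.sin θ = 2 * Real.sin (θ / 2) * Real.cos (θ / 2) := by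
    rw [← Real.sin_two_mul]; ring_nf
  have e2 : Real.cos θ = 1 - 2 * Real.sin (θ / 2) ^ 2 := by
    have := Real.cos_two_mul' (θ / 2)
    rw [show 2 * (θ / 2) = θ by ring] at this
    linarith
  change quatMat (Real.cos (θ / 2)) (Real.sin (θ / 2) * (k / slope k)) 0
    (Real.sin (θ / 2) * (1 / slope k)) = _
  rw [e1, e2]
  generalize Real.sin (θ / 2) = s at *
  generalize Real.cos (θ / 2) = c at *
  have hc : c ^ 2 = 1 - s ^ 2 := by linarith
  rw [← hs] at h0 ⊢
  ext i j
  fin_cases i <;> fin_cases j <;> simp [quatMat, -mul_eq_mul_left_iff] <;>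
    field_simp <;> (try rw [hc]) <;> (try rw [hs]) <;> ring

theorem rot_angle_zero (k : ℝ) : rot k 0 = 1 := by
  refine Subtype.ext ?_
  rw [rot_apply]
  have : 1 + k ^ 2 ≠ 0 := by positivity
  ext i j
  fin_cases i <;> fin_cases j <;> simp [this, add_comm (k ^ 2)]

theorem rot_add (k a b : ℝ) : rot k (a + b) = rot k a * rot k b := by
  refine Subtype.ext ?_
  change quatMat _ _ _ _ = quatMat _ _ _ _ * quatMat _ _ _ _
  have hs := slope_sq k
  have hs0 := (slope_pos k).ne'
  rw [quatMat_mul, show (a + b) / 2 = a / 2 + b / 2 by ring, Real.cos_add, Real.sin_add]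
  congr 1
  · field_simp
    rw [hs]
    ring
  all_goals ring

theorem rot_two_pi (k : ℝ) : rot k (2 * Real.pi) = 1 := by
  rw [← rot_angle_zero k]
  refine Subtype.ext ?_
  rw [rot_apply, rot_apply]
  simp

theorem continuous_rot : Continuous fun p : ℝ × ℝ => rot p.1 p.2 := by
  refine continuous_of_apply fun i j => ?_
  have h1 : ∀ p : ℝ × ℝ, 1 + p.1 ^ 2 ≠ 0 := fun p => by positivity
  have h2 : ∀ p : ℝ × ℝ, slope p.1 ≠ 0 := fun p => (slope_pos _).ne'
  simp only [rot_apply]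
  fin_cases i <;> fin_cases j <;> simp <;> fun_prop (disch := simp [h1, h2])

@[fun_prop] theorem continuous_rot_comp {X : Type*} [TopologicalSpace X] {f g : X → ℝ}
    (hf : Continuous f) (hg : Continuous g) : Continuous fun x => rot (f x) (g x) := by
  have h := continuous_rot.comp (hf.prodMk hg)
  exact h

/-! ### Unit speed and bounds of the curvature -/

/-- A path of frames is the frame of a curve of unit speed if the derivative of its first column
(the position) is the second column (the direction). -/
def UnitSpeed (Φ : ℝ → SO3) : Prop :=
  ∀ σ i, HasDerivAt (fun s => (Φ s).1 i 0) ((Φ σ).1 i 1) σ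

theorem unitSpeed_rot (k : ℝ) : UnitSpeed fun σ => rot k (σ * slope k) := by
  intro σ i
  have hs := slope_sq k
  have hs0 := (slope_pos k).ne'
  have h0 : 1 + k ^ 2 ≠ 0 := by positivity
  have hl : HasDerivAt (fun s : ℝ => s * slope k) (slope k) σ := by
    simpa using (hasDerivAt_id σ).mul_const (slope k)
  fin_cases i
  · have := ((hl.cos).const_add (k ^ 2)).div_const (1 + k ^ 2)
    refine (this.congr_deriv ?_).congr_of_eventuallyEq (.of_forall fun s => ?_)
    · rw [rot_apply, ← hs]
      simp
      field_simp
    · simp [rot_apply]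
  · have := hl.sin.div_const (slope k)
    refine (this.congr_deriv ?_).congr_of_eventuallyEq (.of_forall fun s => ?_)
    · rw [rot_apply]
      simp
      field_simp
    · simp [rot_apply]
  · have := ((hl.cos.const_sub 1).const_mul k).div_const (1 + k ^ 2)
    refine (this.congr_deriv ?_).congr_of_eventuallyEq (.of_forall fun s => ?_)
    · rw [rot_apply, ← hs]
      simp
      field_simp
    · simp [rot_apply]

theorem UnitSpeed.mul_left {Φ : ℝ → SO3} (h : UnitSpeed Φ) (B : SO3) :
    UnitSpeed fun σ => B * Φ σ := by
  intro σ i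
  simp only [mul_apply]
  exact (((h σ 0).const_mul _).add ((h σ 1).const_mul _)).add ((h σ 2).const_mul _)

theorem UnitSpeed.comp_add {Φ : ℝ → SO3} (h : UnitSpeed Φ) (c : ℝ) :
    UnitSpeed fun σ => Φ (σ + c) := fun σ i => (h (σ + c) i).comp_add_const σ c

theorem UnitSpeed.comp_sub {Φ : ℝ → SO3} (h : UnitSpeed Φ) (c : ℝ) :
    UnitSpeed fun σ => Φ (σ - c) := fun σ i => (h (σ - c) i).comp_sub_const σ c

theorem UnitSpeed.glue {Φ Ψ Ω : ℝ → SO3} {a : ℝ} (hΦ : UnitSpeed Φ) (hΨ : UnitSpeed Ψ)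
    (h1 : ∀ σ ≤ a, Ω σ = Φ σ) (h2 : ∀ σ, a ≤ σ → Ω σ = Ψ σ) : UnitSpeed Ω := by
  intro σ i
  rcases lt_trichotomy σ a with h | rfl | h
  · rw [h1 σ h.le]
    refine (hΦ σ i).congr_of_eventuallyEq ?_
    filter_upwards [Iio_mem_nhds h] with s hs
    rw [h1 s (le_of_lt hs)]
  · have d1 : HasDerivWithinAt (fun s => (Ω s).1 i 0) ((Ω σ).1 i 1) (Set.Iic σ) σ := by
      rw [h1 σ le_rfl]
      exact (hΦ σ i).hasDerivWithinAt.congr (fun s hs => by rw [h1 s hs]) (by rw [h1 σ le_rfl])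
    have d2 : HasDerivWithinAt (fun s => (Ω s).1 i 0) ((Ω σ).1 i 1) (Set.Ici σ) σ := by
      rw [h2 σ le_rfl]
      exact (hΨ σ i).hasDerivWithinAt.congr (fun s hs => by rw [h2 s hs]) (by rw [h2 σ le_rfl])
    have := d1.union d2
    rwa [Set.Iic_union_Ici, hasDerivWithinAt_univ] at this
  · rw [h2 σ h.le]
    refine (hΨ σ i).congr_of_eventuallyEq ?_
    filter_upwards [Ioi_mem_nhds h] with s hs
    rw [h2 s (le_of_lt hs)]

/-- The geodesic curvature of the curve with frame `Φ` lies strictly between `-κ` and `κ` at every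
point, in the sense of tangent circles: near `Φ σ` the curve stays between two circles of curvature
`±c` tangent to it, where `c < κ`. -/
def CurvLT (κ : ℝ) (Φ : ℝ → SO3) : Prop :=
  ∀ σ, ∃ c < κ, ∀ᶠ s in nhds σ,
    |((Φ σ)⁻¹ * Φ s).1 2 0| ≤ c * (1 - ((Φ σ)⁻¹ * Φ s).1 0 0)

theorem apply_le_one (A : SO3) (i j : Fin 3) : A.1 i j ≤ 1 := by
  have h := col_dot A j j
  rw [if_pos rfl] at h
  fin_cases i <;> simp at h ⊢ <;>
    nlinarith [sq_nonneg (A.1 0 j), sq_nonneg (A.1 1 j), sq_nonneg (A.1 2 j)]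

theorem curvLT_rot {κ k : ℝ} (h : |k| < κ) : CurvLT κ fun σ => rot k (σ * slope k) := by
  intro σ
  refine ⟨|k|, h, Filter.Eventually.of_forall fun s => ?_⟩
  have : (rot k (σ * slope k))⁻¹ * rot k (s * slope k) = rot k ((s - σ) * slope k) := by
    rw [inv_mul_eq_iff_eq_mul, ← rot_add]
    congr 1
    ring
  rw [this]
  simp only [rot_apply]
  simp
  have h0 : 0 < 1 + k ^ 2 := by positivity
  set C := Real.cos ((s - σ) * slope k)
  have hC : 0 ≤ 1 - C := sub_nonneg.2 (Real.cos_le_one _)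
  rw [abs_div, abs_mul, abs_of_pos h0, abs_of_nonneg hC]
  apply le_of_eq
  field_simp
  ring

theorem CurvLT.mul_left {κ : ℝ} {Φ : ℝ → SO3} (h : CurvLT κ Φ) (B : SO3) :
    CurvLT κ fun σ => B * Φ σ := by
  intro σ
  obtain ⟨c, hc, hs⟩ := h σ
  refine ⟨c, hc, ?_⟩
  simpa [mul_assoc] using hs

theorem CurvLT.comp_add {κ : ℝ} {Φ : ℝ → SO3} (h : CurvLT κ Φ) (c : ℝ) :
    CurvLT κ fun σ => Φ (σ + c) := by
  intro σ
  obtain ⟨d, hd, hs⟩ := h (σ + c)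
  have ht : Filter.Tendsto (fun s => s + c) (nhds σ) (nhds (σ + c)) :=
    (continuous_add_const c).tendsto σ
  exact ⟨d, hd, ht.eventually hs⟩

theorem CurvLT.comp_sub {κ : ℝ} {Φ : ℝ → SO3} (h : CurvLT κ Φ) (c : ℝ) :
    CurvLT κ fun σ => Φ (σ - c) := by
  simpa [sub_eq_add_neg] using h.comp_add (-c)

theorem CurvLT.glue {κ : ℝ} {Φ Ψ Ω : ℝ → SO3} {a : ℝ} (hΦ : CurvLT κ Φ) (hΨ : CurvLT κ Ψ)
    (h1 : ∀ σ ≤ a, Ω σ = Φ σ) (h2 : ∀ σ, a ≤ σ → Ω σ = Ψ σ) : CurvLT κ Ω := by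
  intro σ
  rcases lt_trichotomy σ a with h | rfl | h
  · obtain ⟨c, hc, hs⟩ := hΦ σ
    refine ⟨c, hc, ?_⟩
    filter_upwards [Iio_mem_nhds h, hs] with s hs hs'
    rwa [h1 s (le_of_lt hs), h1 σ h.le]
  · obtain ⟨c, hc, hs⟩ := hΦ σ
    obtain ⟨d, hd, ht⟩ := hΨ σ
    refine ⟨max c d, max_lt hc hd, ?_⟩
    filter_upwards [hs, ht] with s hs ht
    rcases le_total s σ with h | h
    · rw [h1 s h, h1 σ le_rfl]
      exact hs.trans (mul_le_mul_of_nonneg_right (le_max_left _ _)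
        (sub_nonneg.2 (apply_le_one _ _ _)))
    · rw [h2 s h, h2 σ le_rfl]
      exact ht.trans (mul_le_mul_of_nonneg_right (le_max_right _ _)
        (sub_nonneg.2 (apply_le_one _ _ _)))
  · obtain ⟨c, hc, hs⟩ := hΨ σ
    refine ⟨c, hc, ?_⟩
    filter_upwards [Ioi_mem_nhds h, hs] with s hs hs'
    rwa [h2 s (le_of_lt hs), h2 σ h.le]

theorem rot_zero_eq : (fun σ => rot 0 (σ * slope 0)) = rot 0 := by
  funext σ; simp

theorem unitSpeed_rot_zero : UnitSpeed (rot 0) := rot_zero_eq ▸ unitSpeed_rot 0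

theorem curvLT_rot_zero {κ : ℝ} (h : 0 < κ) : CurvLT κ (rot 0) :=
  rot_zero_eq ▸ curvLT_rot (k := 0) (by simpa using h)

end SO3

/-! ### The monoid of arcs -/

/-- A `C¹` arc of length `len ≥ 0` that starts with the frame `1`. It is recorded by its frame as a
function of arc length, prolonged by great circles beyond both ends; the prolongation makes the
frame a function on `ℝ` that is determined by its restriction to `[0, len]`. -/
structure Arc where
  len : ℝ
  len_nonneg : 0 ≤ len
  frame : C(ℝ, SO3)
  unitSpeed : SO3.UnitSpeed frame
  frame_of_nonpos : ∀ σ ≤ 0, frame σ = SO3.rot 0 σ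
  frame_of_len_le : ∀ σ, len ≤ σ → frame σ = frame len * SO3.rot 0 (σ - len)

namespace Arc

open SO3

theorem ext' {A B : Arc} (hl : A.len = B.len)
    (h : ∀ σ, 0 ≤ σ → σ ≤ A.len → A.frame σ = B.frame σ) : A = B := by
  have hf : A.frame = B.frame := by
    refine ContinuousMap.ext fun σ => ?_
    rcases le_total σ 0 with h0 | h0
    · rw [A.frame_of_nonpos σ h0, B.frame_of_nonpos σ h0]
    rcases le_total σ A.len with h1 | h1
    · exact h σ h0 h1
    · rw [A.frame_of_len_le σ h1, B.frame_of_len_le σ (hl ▸ h1), ← hl,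
        h A.len A.len_nonneg le_rfl]
  cases A
  cases B
  simp only at hl hf
  subst hl hf
  rfl

theorem frame_zero (A : Arc) : A.frame 0 = 1 := by
  rw [A.frame_of_nonpos 0 le_rfl, rot_angle_zero]

/-- The final frame of an arc. -/
def last (A : Arc) : SO3 := A.frame A.len

/-- Lengths converge, and frames converge uniformly on compact sets. -/
instance : TopologicalSpace Arc :=
  TopologicalSpace.induced (fun A => (A.len, A.frame)) inferInstance

theorem continuous_len : Continuous Arc.len :=
  continuous_fst.comp (continuous_induced_dom (f := fun A : Arc => (A.len, A.frame)))

theorem continuous_frame : Continuous Arc.frame :=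
  continuous_snd.comp (continuous_induced_dom (f := fun A : Arc => (A.len, A.frame)))

theorem continuous_iff {X : Type*} [TopologicalSpace X] {F : X → Arc} :
    Continuous F ↔ Continuous (fun x => (F x).len) ∧
      Continuous fun p : X × ℝ => (F p.1).frame p.2 := by
  constructor
  · intro h
    exact ⟨continuous_len.comp h,
      (continuous_frame.comp (h.comp continuous_fst)).eval continuous_snd⟩
  · rintro ⟨h1, h2⟩
    exact continuous_induced_rng.2
      (h1.prodMk (ContinuousMap.continuous_of_continuous_uncurry _ h2))

@[fun_prop] theorem _root_.Continuous.arc_len {X : Type*} [TopologicalSpace X] {F : X → Arc}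
    (hF : Continuous F) : Continuous fun x => (F x).len := continuous_len.comp hF

@[fun_prop] theorem _root_.Continuous.arc_frame {X : Type*} [TopologicalSpace X] {F : X → Arc}
    {g : X → ℝ} (hF : Continuous F) (hg : Continuous g) :
    Continuous fun x => (F x).frame (g x) :=
  (continuous_iff.1 hF).2.comp (continuous_id.prodMk hg)

/-- The arc of length `ℓ` (of length `0`, if `ℓ < 0`) cut out of a path of frames on `ℝ`, moved so
that it starts with the frame `1`. -/
def ofPath (Φ : ℝ → SO3) (hc : Continuous Φ) (hΦ : UnitSpeed Φ) (ℓ : ℝ) : Arc where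
  len := max ℓ 0
  len_nonneg := le_max_right _ _
  frame := ⟨fun σ => (Φ 0)⁻¹ * Φ (max 0 (min σ (max ℓ 0))) *
    rot 0 (σ - max 0 (min σ (max ℓ 0))), by fun_prop⟩
  unitSpeed := by
    have hl : 0 ≤ max ℓ 0 := le_max_right _ _
    have h1 := (unitSpeed_rot_zero.comp_sub (max ℓ 0)).mul_left ((Φ 0)⁻¹ * Φ (max ℓ 0))
    have h2 : UnitSpeed fun σ => (Φ 0)⁻¹ * Φ (min σ (max ℓ 0)) * rot 0 (σ - min σ (max ℓ 0)) :=
      UnitSpeed.glue (a := max ℓ 0) (hΦ.mul_left (Φ 0)⁻¹) h1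
        (fun σ h => by simp [min_eq_left h, rot_angle_zero])
        (fun σ h => by simp [min_eq_right h])
    exact UnitSpeed.glue (a := 0) unitSpeed_rot_zero h2
      (fun σ h => by simp [min_eq_left (h.trans hl), max_eq_left h])
      (fun σ h => by simp [max_eq_right (le_min h hl)])
  frame_of_nonpos σ h := by
    have hl : 0 ≤ max ℓ 0 := le_max_right _ _
    simp [min_eq_left (h.trans hl), max_eq_left h]
  frame_of_len_le σ h := by
    have hl : 0 ≤ max ℓ 0 := le_max_right _ _
    simp [min_eq_right h, rot_angle_zero]

theorem ofPath_frame {Φ : ℝ → SO3} {hc : Continuous Φ} {hΦ : UnitSpeed Φ} {ℓ σ : ℝ}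
    (h0 : 0 ≤ σ) (h1 : σ ≤ ℓ) : (ofPath Φ hc hΦ ℓ).frame σ = (Φ 0)⁻¹ * Φ σ := by
  have h : max 0 (min σ (max ℓ 0)) = σ := by
    rw [max_eq_left (h0.trans h1), min_eq_left h1, max_eq_right h0]
  simp [ofPath, h, rot_angle_zero]

theorem ofPath_len {Φ : ℝ → SO3} {hc : Continuous Φ} {hΦ : UnitSpeed Φ} {ℓ : ℝ}
    (h : 0 ≤ ℓ) : (ofPath Φ hc hΦ ℓ).len = ℓ := max_eq_left h

theorem ofPath_last {Φ : ℝ → SO3} {hc : Continuous Φ} {hΦ : UnitSpeed Φ} {ℓ : ℝ}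
    (h : 0 ≤ ℓ) : (ofPath Φ hc hΦ ℓ).last = (Φ 0)⁻¹ * Φ ℓ := by
  rw [last, ofPath_len h, ofPath_frame h le_rfl]

theorem continuous_ofPath {X : Type*} [TopologicalSpace X] {Φ : X → ℝ → SO3} {ℓ : X → ℝ}
    (hc : ∀ x, Continuous (Φ x)) (hu : ∀ x, UnitSpeed (Φ x))
    (hΦ : Continuous fun p : X × ℝ => Φ p.1 p.2) (hℓ : Continuous ℓ) :
    Continuous fun x => ofPath (Φ x) (hc x) (hu x) (ℓ x) := by
  have key : ∀ g : X × ℝ → ℝ, Continuous g → Continuous fun p => Φ p.1 (g p) := fun g hg =>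
    hΦ.comp (continuous_fst.prodMk hg)
  refine continuous_iff.2 ⟨?_, ?_⟩
  · change Continuous fun x => max (ℓ x) 0
    fun_prop
  · refine ((key _ continuous_const).inv.mul (key _ ?_)).mul ?_ <;> fun_prop

theorem curvLT_ofPath {κ : ℝ} (hκ : 0 < κ) {Φ : ℝ → SO3} (hc : Continuous Φ) (hu : UnitSpeed Φ)
    {ℓ : ℝ} (h : CurvLT κ Φ) : CurvLT κ (ofPath Φ hc hu ℓ).frame := by
  have hl : 0 ≤ max ℓ 0 := le_max_right _ _
  have h1 := ((curvLT_rot_zero hκ).comp_sub (max ℓ 0)).mul_left ((Φ 0)⁻¹ * Φ (max ℓ 0))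
  have h2 : CurvLT κ fun σ => (Φ 0)⁻¹ * Φ (min σ (max ℓ 0)) * rot 0 (σ - min σ (max ℓ 0)) :=
    CurvLT.glue (a := max ℓ 0) (h.mul_left (Φ 0)⁻¹) h1
      (fun σ h => by simp [min_eq_left h, rot_angle_zero])
      (fun σ h => by simp [min_eq_right h])
  exact CurvLT.glue (a := 0) (curvLT_rot_zero hκ) h2
    (fun σ h => by simp [ofPath, min_eq_left (h.trans hl), max_eq_left h])
    (fun σ h => by simp [ofPath, max_eq_right (le_min h hl)])

/-- Concatenation of arcs: the second arc is moved so that its initial frame is the final frame of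
the first one. -/
def concat (A B : Arc) : Arc where
  len := A.len + B.len
  len_nonneg := add_nonneg A.len_nonneg B.len_nonneg
  frame := ⟨fun σ => A.frame (min σ A.len) * B.frame (max (σ - A.len) 0), by fun_prop⟩
  unitSpeed := UnitSpeed.glue (a := A.len) A.unitSpeed
    ((B.unitSpeed.comp_sub A.len).mul_left A.last)
    (fun σ h => by simp [h, frame_zero])
    (fun σ h => by simp [h, last])
  frame_of_nonpos σ h := by
    have h' := h.trans A.len_nonneg
    simp [h', frame_zero, A.frame_of_nonpos σ h]
  frame_of_len_le σ h := by
    have hB := B.len_nonneg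
    have h1 : A.len ≤ σ := by linarith
    have h2 : 0 ≤ σ - A.len := by linarith
    have h3 : B.len ≤ σ - A.len := by linarith
    have h4 : A.len ≤ A.len + B.len := by linarith
    simp only [ContinuousMap.coe_mk]
    rw [min_eq_right h1, max_eq_left h2, min_eq_right h4, add_sub_cancel_left, max_eq_left hB,
      B.frame_of_len_le _ h3, mul_assoc, sub_sub]

theorem concat_frame_of_le (A B : Arc) {σ : ℝ} (h : σ ≤ A.len) :
    (A.concat B).frame σ = A.frame σ := by
  simp [concat, h, frame_zero]

theorem concat_frame_of_ge (A B : Arc) {σ : ℝ} (h : A.len ≤ σ) :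
    (A.concat B).frame σ = A.last * B.frame (σ - A.len) := by
  simp [concat, h, last]

/-- Arcs form a monoid under concatenation; the neutral element has length `0`. -/
instance : Monoid Arc where
  mul := concat
  one :=
    { len := 0
      len_nonneg := le_rfl
      frame := ⟨rot 0, by fun_prop⟩
      unitSpeed := unitSpeed_rot_zero
      frame_of_nonpos := fun _ _ => rfl
      frame_of_len_le := fun σ _ => by simp [rot_angle_zero] }
  mul_assoc A B C := by
    have hA := A.len_nonneg
    have hB := B.len_nonneg
    refine ext' (add_assoc _ _ _) fun σ h0 _ => ?_
    have hl : (A.concat B).len = A.len + B.len := rfl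
    change ((A.concat B).concat C).frame σ = (A.concat (B.concat C)).frame σ
    rcases le_total σ A.len with h | h
    · rw [concat_frame_of_le _ _ (by rw [hl]; linarith), concat_frame_of_le _ _ h,
        concat_frame_of_le _ _ h]
    · rw [concat_frame_of_ge A _ h]
      rcases le_total (σ - A.len) B.len with h' | h'
      · rw [concat_frame_of_le _ _ (by rw [hl]; linarith), concat_frame_of_le _ _ h',
          concat_frame_of_ge A _ h]
      · rw [concat_frame_of_ge (A.concat B) _ (by rw [hl]; linarith), concat_frame_of_ge _ _ h',
          last, hl, concat_frame_of_ge A B (by linarith), add_sub_cancel_left, sub_sub, mul_assoc]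
        rfl
  one_mul A := by
    refine ext' (zero_add _) fun σ h0 _ => ?_
    refine (concat_frame_of_ge _ A h0).trans ?_
    change rot 0 0 * A.frame (σ - 0) = A.frame σ
    rw [rot_angle_zero, one_mul, sub_zero]
  mul_one A := by
    refine ext' (add_zero _) fun σ h0 h1 => ?_
    exact concat_frame_of_le _ _ (h1.trans_eq (add_zero _))

theorem mul_len (A B : Arc) : (A * B).len = A.len + B.len := rfl

theorem one_len : (1 : Arc).len = 0 := rfl

theorem mul_frame_of_le (A B : Arc) {σ : ℝ} (h : σ ≤ A.len) :
    (A * B).frame σ = A.frame σ := concat_frame_of_le A B h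

theorem mul_frame_of_ge (A B : Arc) {σ : ℝ} (h : A.len ≤ σ) :
    (A * B).frame σ = A.last * B.frame (σ - A.len) := concat_frame_of_ge A B h

@[simp] theorem mul_last (A B : Arc) : (A * B).last = A.last * B.last := by
  rw [last, mul_len, mul_frame_of_ge _ _ (by linarith [B.len_nonneg]), add_sub_cancel_left]
  rfl

@[simp] theorem one_last : (1 : Arc).last = 1 := rot_angle_zero 0

theorem eq_one_of_len {A : Arc} (h : A.len = 0) : A = 1 :=
  ext' h fun σ h0 h1 => by
    rw [le_antisymm (h1.trans_eq h) h0, frame_zero, frame_zero]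

instance : ContinuousMul Arc where
  continuous_mul := by
    refine continuous_iff.2 ⟨?_, ?_⟩
    · change Continuous fun p : Arc × Arc => p.1.len + p.2.len
      fun_prop
    · change Continuous fun p : (Arc × Arc) × ℝ =>
        p.1.1.frame (min p.2 p.1.1.len) * p.1.2.frame (max (p.2 - p.1.1.len) 0)
      fun_prop

/-- The curvature of an arc lies strictly between `-κ` and `κ`. -/
def Bounded (κ : ℝ) (A : Arc) : Prop := CurvLT κ A.frame

theorem Bounded.mul {κ : ℝ} {A B : Arc} (hA : A.Bounded κ) (hB : B.Bounded κ) :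
    (A * B).Bounded κ :=
  CurvLT.glue (a := A.len) hA ((CurvLT.comp_sub hB A.len).mul_left A.last)
    (fun _ h => mul_frame_of_le A B h) (fun _ h => mul_frame_of_ge A B h)

theorem bounded_one {κ : ℝ} (h : 0 < κ) : (1 : Arc).Bounded κ := curvLT_rot_zero h

theorem Bounded.pow {κ : ℝ} (hκ : 0 < κ) {A : Arc} (hA : A.Bounded κ) (n : ℕ) :
    (A ^ n).Bounded κ := by
  induction n with
  | zero => simpa using bounded_one hκ
  | succ n ih => rw [pow_succ]; exact ih.mul hA

theorem bounded_list_prod {κ : ℝ} (hκ : 0 < κ) {l : List Arc} (h : ∀ A ∈ l, A.Bounded κ) :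
    l.prod.Bounded κ := by
  induction l with
  | nil => simpa using bounded_one hκ
  | cons A l ih =>
    rw [List.prod_cons]
    exact (h A (by simp)).mul (ih fun B hB => h B (by simp [hB]))

/-- The arc of a circle of geodesic curvature `k` along which the frame turns by the angle `θ`. -/
def circ (k θ : ℝ) : Arc :=
  ofPath (fun σ => rot k (σ * slope k)) (by fun_prop) (unitSpeed_rot k) (θ / slope k)

theorem circ_len {k θ : ℝ} (h : 0 ≤ θ) : (circ k θ).len = θ / slope k :=
  ofPath_len (div_nonneg h (slope_pos k).le)

theorem circ_last {k θ : ℝ} (h : 0 ≤ θ) : (circ k θ).last = rot k θ := by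
  have := (slope_pos k).ne'
  rw [circ, ofPath_last (div_nonneg h (slope_pos k).le), zero_mul, rot_angle_zero, inv_one,
    one_mul, div_mul_cancel₀ _ this]

theorem circ_frame {k θ σ : ℝ} (h0 : 0 ≤ σ) (h1 : σ ≤ θ / slope k) :
    (circ k θ).frame σ = rot k (σ * slope k) := by
  rw [circ, ofPath_frame h0 h1, zero_mul, rot_angle_zero, inv_one, one_mul]

@[fun_prop] theorem continuous_circ {X : Type*} [TopologicalSpace X] {k θ : X → ℝ}
    (hk : Continuous k) (hθ : Continuous θ) : Continuous fun x => circ (k x) (θ x) := by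
  have h : ∀ x, slope (k x) ≠ 0 := fun x => (slope_pos _).ne'
  exact continuous_ofPath _ _ (by fun_prop) (by fun_prop (disch := simp [h]))

theorem bounded_circ {κ k θ : ℝ} (h : |k| < κ) : (circ k θ).Bounded κ :=
  curvLT_ofPath ((abs_nonneg k).trans_lt h) _ _ (curvLT_rot h)

theorem circ_zero_angle (k : ℝ) : circ k 0 = 1 :=
  eq_one_of_len (by rw [circ_len le_rfl, zero_div])

theorem circ_add {k a b : ℝ} (ha : 0 ≤ a) (hb : 0 ≤ b) : circ k (a + b) = circ k a * circ k b := by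
  have hs := slope_pos k
  have hd : (a + b) / slope k = a / slope k + b / slope k := add_div _ _ _
  refine ext' ?_ fun σ h0 h1 => ?_
  · rw [mul_len, circ_len ha, circ_len hb, circ_len (add_nonneg ha hb), hd]
  · rw [circ_len (add_nonneg ha hb)] at h1
    rw [circ_frame h0 h1]
    rcases le_total σ (a / slope k) with h | h
    · rw [mul_frame_of_le _ _ (by rwa [circ_len ha]), circ_frame h0 h]
    · rw [mul_frame_of_ge _ _ (by rwa [circ_len ha]), circ_last ha, circ_len ha,
        circ_frame (sub_nonneg.2 h) (by linarith), ← rot_add, sub_mul, div_mul_cancel₀ _ hs.ne']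
      congr 1
      ring

/-- A great circle, travelled once. -/
def loop : Arc := circ 0 (2 * Real.pi)

theorem loop_len : loop.len = 2 * Real.pi := by
  rw [loop, circ_len (by positivity), slope_zero, div_one]

@[simp] theorem loop_last : loop.last = 1 := by
  rw [loop, circ_last (by positivity), rot_two_pi]

theorem bounded_loop {κ : ℝ} (h : 0 < κ) : loop.Bounded κ := bounded_circ (by simpa using h)

@[simp] theorem loop_pow_last (n : ℕ) : (loop ^ n).last = 1 := by
  induction n with
  | zero => simp
  | succ n ih => rw [pow_succ, mul_last, ih, loop_last, one_mul]

theorem loop_pow_len (n : ℕ) : (loop ^ n).len = 2 * Real.pi * n := by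
  induction n with
  | zero => simp [one_len]
  | succ n ih => rw [pow_succ, mul_len, ih, loop_len]; push_cast; ring

/-- The part of an arc between the arc lengths `a` and `b`, for `0 ≤ a ≤ b ≤ len`. -/
def sub (A : Arc) (a b : ℝ) : Arc :=
  ofPath (fun σ => A.frame (σ + a)) (by fun_prop) (A.unitSpeed.comp_add a) (b - a)

theorem sub_len (A : Arc) {a b : ℝ} (h : a ≤ b) : (A.sub a b).len = b - a :=
  ofPath_len (sub_nonneg.2 h)

theorem sub_last (A : Arc) {a b : ℝ} (h : a ≤ b) :
    (A.sub a b).last = (A.frame a)⁻¹ * A.frame b := by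
  rw [sub, ofPath_last (sub_nonneg.2 h), zero_add, sub_add_cancel]

theorem sub_frame (A : Arc) {a b σ : ℝ} (h0 : 0 ≤ σ) (h1 : σ ≤ b - a) :
    (A.sub a b).frame σ = (A.frame a)⁻¹ * A.frame (σ + a) := by
  rw [sub, ofPath_frame h0 h1, zero_add]

@[simp] theorem sub_self (A : Arc) (a : ℝ) : A.sub a a = 1 :=
  eq_one_of_len (by rw [sub_len _ le_rfl, _root_.sub_self])

theorem sub_mul_sub (A : Arc) {a b c : ℝ} (hab : a ≤ b) (hbc : b ≤ c) :
    A.sub a b * A.sub b c = A.sub a c := by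
  refine ext' ?_ fun σ h0 h1 => ?_
  · rw [mul_len, sub_len _ hab, sub_len _ hbc, sub_len _ (hab.trans hbc)]; ring
  · rw [mul_len, sub_len _ hab, sub_len _ hbc] at h1
    rw [sub_frame _ h0 (by linarith)]
    rcases le_total σ (b - a) with h | h
    · rw [mul_frame_of_le _ _ (by rwa [sub_len _ hab]), sub_frame _ h0 h]
    · rw [mul_frame_of_ge _ _ (by rwa [sub_len _ hab]), sub_last _ hab, sub_len _ hab,
        sub_frame _ (sub_nonneg.2 h) (by linarith), mul_assoc, mul_inv_cancel_left,
        show σ - (b - a) + b = σ + a by ring]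

theorem sub_zero_len (A : Arc) : A.sub 0 A.len = A := by
  refine ext' ?_ fun σ h0 h1 => ?_
  · rw [sub_len _ A.len_nonneg, sub_zero]
  · rw [sub_len _ A.len_nonneg] at h1
    rw [sub_frame _ h0 h1, frame_zero, inv_one, one_mul, add_zero]

@[fun_prop] theorem _root_.Continuous.arc_sub {X : Type*} [TopologicalSpace X] {A : X → Arc}
    {a b : X → ℝ} (hA : Continuous A) (ha : Continuous a) (hb : Continuous b) :
    Continuous fun x => (A x).sub (a x) (b x) :=
  continuous_ofPath _ _ (by fun_prop) (by fun_prop)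

theorem Bounded.sub {κ : ℝ} (hκ : 0 < κ) {A : Arc} (h : A.Bounded κ) (a b : ℝ) :
    (A.sub a b).Bounded κ := curvLT_ofPath hκ _ _ (CurvLT.comp_add h a)

end Arc

/-! ### Frames and lengths of immersed curves -/

theorem E3.inner_eq (x y : E3) : inner ℝ x y = x 0 * y 0 + x 1 * y 1 + x 2 * y 2 := by
  rw [PiLp.inner_apply, Fin.sum_univ_three]
  simp only [RCLike.inner_apply, conj_trivial]
  ring

theorem E3.cross_apply (x y : E3) : E3.cross x y 0 = x 1 * y 2 - x 2 * y 1 ∧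
    E3.cross x y 1 = x 2 * y 0 - x 0 * y 2 ∧ E3.cross x y 2 = x 0 * y 1 - x 1 * y 0 := by
  simp [E3.cross, _root_.cross_apply]

theorem E3.ext {x y : E3} (h : ∀ i, x i = y i) : x = y := PiLp.ext h

theorem norm_sub_le_angle {x y : E3} (hx : ‖x‖ = 1) (hy : ‖y‖ = 1) :
    ‖x - y‖ ≤ InnerProductGeometry.angle x y := by
  have h := InnerProductGeometry.cos_angle x y
  rw [hx, hy, mul_one, div_one] at h
  have h2 := Real.one_sub_sq_div_two_le_cos (x := InnerProductGeometry.angle x y)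
  refine abs_le_of_sq_le_sq' ?_ (InnerProductGeometry.angle_nonneg _ _) |>.2
  rw [norm_sub_sq_real, hx, hy]
  linarith

theorem SO3.ofPair_mem {p t : Fin 3 → ℝ} (hp : p 0 ^ 2 + p 1 ^ 2 + p 2 ^ 2 = 1)
    (ht : t 0 ^ 2 + t 1 ^ 2 + t 2 ^ 2 = 1) (h : p 0 * t 0 + p 1 * t 1 + p 2 * t 2 = 0) :
    (Matrix.of fun i j => ![p i, t i, crossProduct p t i] j) ∈
      Matrix.specialOrthogonalGroup (Fin 3) ℝ := by
  have hn : (p 1 * t 2 - p 2 * t 1) ^ 2 + (p 2 * t 0 - p 0 * t 2) ^ 2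
      + (p 0 * t 1 - p 1 * t 0) ^ 2 = 1 := by
    linear_combination (t 0 ^ 2 + t 1 ^ 2 + t 2 ^ 2) * hp + ht
      - (p 0 * t 0 + p 1 * t 1 + p 2 * t 2) * h
  refine SO3.mem_of_cols ?_ ?_
  · ext i j
    fin_cases i <;> fin_cases j <;>
      simp [Matrix.mul_apply, Fin.sum_univ_three, _root_.cross_apply]
    · linear_combination hp
    · linear_combination h
    · ring
    · linear_combination h
    · linear_combination ht
    · ring
    · ring
    · ring
    · linear_combination hn
  · rw [Matrix.det_fin_three]
    simp [_root_.cross_apply]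
    linear_combination hn

namespace ImmersedCurve

open SO3

theorem frame_mem (γ : ImmersedCurve) (t : unitInterval) :
    γ.frame t ∈ Matrix.specialOrthogonalGroup (Fin 3) ℝ := by
  have h1 : inner ℝ (γ.pos t) (γ.pos t) = 1 := by
    rw [real_inner_self_eq_norm_sq, γ.norm_pos, one_pow]
  have h2 : inner ℝ (γ.tan t) (γ.tan t) = 1 := by
    rw [real_inner_self_eq_norm_sq, γ.norm_tan, one_pow]
  have h3 := γ.inner_pos_tan t
  rw [E3.inner_eq] at h1 h2 h3
  exact ofPair_mem (p := (γ.pos t).ofLp) (t := (γ.tan t).ofLp) (by linarith) (by linarith) h3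

/-- The frame of an immersed curve as a rotation. -/
def rotFrame (γ : ImmersedCurve) (t : unitInterval) : SO3 := ⟨γ.frame t, γ.frame_mem t⟩

theorem rotFrame_zero (γ : ImmersedCurve) (t : unitInterval) (i : Fin 3) :
    (γ.rotFrame t).1 i 0 = γ.pos t i := rfl

theorem rotFrame_one (γ : ImmersedCurve) (t : unitInterval) (i : Fin 3) :
    (γ.rotFrame t).1 i 1 = γ.tan t i := rfl

theorem rotFrame_two (γ : ImmersedCurve) (t : unitInterval) (i : Fin 3) :
    (γ.rotFrame t).1 i 2 = γ.normal t i := rfl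

/-- Compactness of `[0, 1]` turns joint continuity into continuity for the uniform distance. -/
theorem continuous_of_pos_tan {X : Type*} [TopologicalSpace X] {F : X → ImmersedCurve}
    (hp : Continuous fun p : X × unitInterval => (F p.1).pos p.2)
    (ht : Continuous fun p : X × unitInterval => (F p.1).tan p.2) : Continuous F := by
  rw [continuous_iff_continuousAt]
  intro x₀
  rw [ContinuousAt, Metric.tendsto_nhds]
  intro ε hε
  have key : ∀ᶠ x in nhds x₀, ∀ t ∈ (Set.univ : Set unitInterval),
      InnerProductGeometry.angle ((F x).pos t) ((F x₀).pos t)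
        + InnerProductGeometry.angle ((F x).tan t) ((F x₀).tan t) < ε / 2 := by
    refine isCompact_univ.eventually_forall_of_forall_eventually fun t _ => ?_
    have c : ∀ G : ImmersedCurve → unitInterval → E3, (∀ γ t, ‖G γ t‖ = 1) →
        Continuous (fun p : X × unitInterval => G (F p.1) p.2) →
        Filter.Tendsto (fun p : X × unitInterval =>
          InnerProductGeometry.angle (G (F p.1) p.2) (G (F x₀) p.2)) (nhds (x₀, t)) (nhds 0) := by
      intro G hG hc
      have h0 : InnerProductGeometry.angle (G (F x₀) t) (G (F x₀) t) = 0 :=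
        InnerProductGeometry.angle_self (ne_zero_of_norm (hG _ _))
      have h1 : Continuous fun p : X × unitInterval => (G (F p.1) p.2, G (F x₀) p.2) :=
        hc.prodMk (hc.comp (continuous_const.prodMk continuous_snd))
      have h2 : ContinuousAt (fun y : E3 × E3 => InnerProductGeometry.angle y.1 y.2)
          (G (F x₀) t, G (F x₀) t) := InnerProductGeometry.continuousAt_angle
            (ne_zero_of_norm (hG _ _)) (ne_zero_of_norm (hG _ _))
      have h3 := h2.tendsto.comp (h1.tendsto (x₀, t))
      rw [h0] at h3
      exact h3
    have h := (c (fun γ t => γ.pos t) (fun γ t => γ.norm_pos t) hp).add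
      (c (fun γ t => γ.tan t) (fun γ t => γ.norm_tan t) ht)
    rw [add_zero] at h
    exact h.eventually_lt_const (half_pos hε)
  filter_upwards [key] with x hx
  refine lt_of_le_of_lt ?_ (half_lt_self hε)
  rw [dist_def]
  exact ciSup_le fun t => (hx t trivial).le

theorem continuous_pos_tan :
    (Continuous fun p : ImmersedCurve × unitInterval => p.1.pos p.2) ∧
    Continuous fun p : ImmersedCurve × unitInterval => p.1.tan p.2 := by
  have key : ∀ G : ImmersedCurve → C(unitInterval, E3), (∀ α β t, ‖G α t - G β t‖ ≤ dist α β) →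
      Continuous fun p : ImmersedCurve × unitInterval => G p.1 p.2 := by
    intro G hG
    have : Continuous G := by
      refine LipschitzWith.continuous (K := 1) (LipschitzWith.of_dist_le_mul fun α β => ?_)
      rw [ContinuousMap.dist_le (by positivity)]
      intro t
      rw [dist_eq_norm]
      simpa using hG α β t
    exact (this.comp continuous_fst).eval continuous_snd
  have hle := fun α β t => le_ciSup (bddAbove_angles α β) t
  refine ⟨key (fun γ => γ.pos) fun α β t => ?_, key (fun γ => γ.tan) fun α β t => ?_⟩
  · have h1 := hle α β t
    rw [← dist_def] at h1
    have h2 := norm_sub_le_angle (α.norm_pos t) (β.norm_pos t)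
    have h3 := InnerProductGeometry.angle_nonneg (α.tan t) (β.tan t)
    linarith
  · have h1 := hle α β t
    rw [← dist_def] at h1
    have h2 := norm_sub_le_angle (α.norm_tan t) (β.norm_tan t)
    have h3 := InnerProductGeometry.angle_nonneg (α.pos t) (β.pos t)
    linarith

theorem continuous_rotFrame :
    Continuous fun p : ImmersedCurve × unitInterval => p.1.rotFrame p.2 := by
  obtain ⟨hp, ht⟩ := continuous_pos_tan
  have hp' : ∀ i, Continuous fun p : ImmersedCurve × unitInterval => p.1.pos p.2 i := fun i => by
    fun_prop
  have ht' : ∀ i, Continuous fun p : ImmersedCurve × unitInterval => p.1.tan p.2 i := fun i => by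
    fun_prop
  refine continuous_of_apply fun i j => ?_
  fin_cases j
  · exact hp' i
  · exact ht' i
  · have hc := fun p : ImmersedCurve × unitInterval => E3.cross_apply (p.1.pos p.2) (p.1.tan p.2)
    fin_cases i
    · exact Continuous.congr (by fun_prop) fun p => ((hc p).1).symm
    · exact Continuous.congr (by fun_prop) fun p => ((hc p).2.1).symm
    · exact Continuous.congr (by fun_prop) fun p => ((hc p).2.2).symm

/-- The length depends continuously on the curve because a chord from the initial point is `len`
times the integral of the direction, and some chord does not vanish. -/
theorem continuous_len : Continuous ImmersedCurve.len := by
  obtain ⟨hp, ht⟩ := continuous_pos_tan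
  have hI : ∀ (γ : ImmersedCurve) (t : unitInterval), γ.pos t - γ.pos 0 =
      γ.len • ∫ x in (0 : ℝ)..t, Set.IccExtend zero_le_one γ.tan x := by
    intro γ t
    have hc : Continuous (Set.IccExtend (zero_le_one (α := ℝ)) γ.tan) :=
      γ.tan.continuous.Icc_extend'
    have hd : ∀ x ∈ Set.uIcc (0 : ℝ) t, HasDerivWithinAt (Set.IccExtend zero_le_one γ.pos)
        (γ.len • Set.IccExtend zero_le_one γ.tan x) (Set.Icc 0 1) x := fun x hx => by
      rw [Set.uIcc_of_le t.2.1] at hx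
      exact γ.hasDerivWithinAt_mem ⟨hx.1, hx.2.trans t.2.2⟩
    have h := intervalIntegral.integral_eq_sub_of_hasDerivAt_of_le t.2.1
      (f := Set.IccExtend zero_le_one γ.pos)
      (f' := fun x => γ.len • Set.IccExtend zero_le_one γ.tan x)
      (γ.pos.continuous.Icc_extend').continuousOn
      (fun x hx => (hd x (by rw [Set.uIcc_of_le t.2.1]; exact ⟨hx.1.le, hx.2.le⟩)).hasDerivAt
        (Icc_mem_nhds hx.1 (hx.2.trans_le t.2.2)))
      ((hc.const_smul γ.len).intervalIntegrable 0 t)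
    rw [intervalIntegral.integral_smul, Set.IccExtend_val] at h
    rw [h]
    congr 2
    exact (Set.projIcc_left zero_le_one).symm
  rw [continuous_iff_continuousAt]
  intro γ
  obtain ⟨t, ht0⟩ : ∃ t, γ.pos t ≠ γ.pos 0 := by
    by_contra! hcon
    have h1 := γ.hasDeriv 0
    have h2 : HasDerivWithinAt (Set.IccExtend zero_le_one γ.pos) 0 (Set.Icc 0 1)
        ((0 : unitInterval) : ℝ) := by
      have : Set.IccExtend (zero_le_one (α := ℝ)) γ.pos = fun _ => γ.pos 0 := by
        funext x
        exact hcon _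
      rw [this]
      exact hasDerivWithinAt_const _ _ _
    have h3 := (uniqueDiffOn_Icc zero_lt_one _ (0 : unitInterval).2).eq_deriv _ h1 h2
    exact (smul_ne_zero γ.len_pos.ne' (ne_zero_of_norm (γ.norm_tan 0))) h3
  set J : ImmersedCurve → E3 := fun α => ∫ x in (0 : ℝ)..t, Set.IccExtend zero_le_one α.tan x
  have hJ : Continuous J := by
    refine intervalIntegral.continuous_parametric_intervalIntegral_of_continuous' ?_ _ _
    exact ht.comp (continuous_fst.prodMk ((continuous_projIcc
      (h := zero_le_one (α := ℝ))).comp continuous_snd))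
  have hJ0 : J γ ≠ 0 := fun h => ht0 (sub_eq_zero.1 (by rw [hI]; exact smul_eq_zero_of_right _ h))
  have hq : ContinuousAt (fun α : ImmersedCurve => ‖α.pos t - α.pos 0‖ / ‖J α‖) γ := by
    have h1 : Continuous fun α : ImmersedCurve => α.pos t - α.pos 0 :=
      (hp.comp (continuous_id.prodMk continuous_const)).sub
        (hp.comp (continuous_id.prodMk continuous_const))
    exact h1.norm.continuousAt.div hJ.norm.continuousAt (norm_ne_zero_iff.2 hJ0)
  refine hq.congr ?_
  filter_upwards [hJ.continuousAt.eventually_ne hJ0] with α hα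
  rw [hI, norm_smul, Real.norm_eq_abs, abs_of_pos α.len_pos, mul_div_assoc,
    div_self (norm_ne_zero_iff.2 hα), mul_one]

/-! ### Tangent circles and the height over tangent great circles -/

theorem cos_angle_of_norm {x y : E3} (hx : ‖x‖ = 1) (hy : ‖y‖ = 1) :
    Real.cos (InnerProductGeometry.angle x y) = inner ℝ x y := by
  rw [InnerProductGeometry.cos_angle, hx, hy, mul_one, div_one]

theorem isTangentCircle_iff (γ : ImmersedCurve) (t : unitInterval) (a : E3) (r : ℝ) :
    γ.IsTangentCircle t a r ↔ r ∈ Set.Ioo 0 Real.pi ∧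
      a = Real.cos r • γ.pos t + Real.sin r • γ.normal t := by
  have hpp : inner ℝ (γ.pos t) (γ.pos t) = 1 := by
    rw [real_inner_self_eq_norm_sq, γ.norm_pos, one_pow]
  have htt : inner ℝ (γ.tan t) (γ.tan t) = 1 := by
    rw [real_inner_self_eq_norm_sq, γ.norm_tan, one_pow]
  have hpt := γ.inner_pos_tan t
  obtain ⟨n0, n1, n2⟩ := E3.cross_apply (γ.pos t) (γ.tan t)
  change γ.normal t 0 = _ at n0
  change γ.normal t 1 = _ at n1
  change γ.normal t 2 = _ at n2
  rw [E3.inner_eq] at hpp htt hpt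
  constructor
  · rintro ⟨ha, hr, hang, hcr⟩
    refine ⟨hr, ?_⟩
    have hin : inner ℝ a (γ.pos t) = Real.cos r := by
      rw [← hang, cos_angle_of_norm ha (γ.norm_pos t)]
    rw [E3.inner_eq] at hin
    obtain ⟨c0, c1, c2⟩ := E3.cross_apply a (γ.pos t)
    rw [hcr] at c0 c1 c2
    simp only [PiLp.smul_apply, smul_eq_mul] at c0 c1 c2
    refine E3.ext fun i => ?_
    fin_cases i
    · simp [n0]
      linear_combination (-a 0) * hpp + γ.pos t 0 * hin + γ.pos t 2 * c1 - γ.pos t 1 * c2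
    · simp [n1]
      linear_combination (-a 1) * hpp + γ.pos t 1 * hin + γ.pos t 0 * c2 - γ.pos t 2 * c0
    · simp [n2]
      linear_combination (-a 2) * hpp + γ.pos t 2 * hin + γ.pos t 1 * c0 - γ.pos t 0 * c1
  · rintro ⟨hr, ha⟩
    have hnorm : ‖a‖ = 1 := by
      have hn : ‖γ.normal t‖ = 1 := by
        rw [← pow_eq_one_iff_of_nonneg (norm_nonneg _) two_ne_zero, ← real_inner_self_eq_norm_sq,
          E3.inner_eq, n0, n1, n2]
        linear_combination (γ.tan t 0 ^ 2 + γ.tan t 1 ^ 2 + γ.tan t 2 ^ 2) * hpp + htt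
          - (γ.pos t 0 * γ.tan t 0 + γ.pos t 1 * γ.tan t 1 + γ.pos t 2 * γ.tan t 2) * hpt
      rw [ha]
      refine norm_circle (γ.norm_pos t) hn ?_ _ _ (Real.cos_sq_add_sin_sq r)
      rw [E3.inner_eq, n0, n1, n2]
      ring
    refine ⟨hnorm, hr, ?_, ?_⟩
    · have hcos : Real.cos (InnerProductGeometry.angle a (γ.pos t)) = Real.cos r := by
        rw [cos_angle_of_norm hnorm (γ.norm_pos t), ha, E3.inner_eq]
        simp [n0, n1, n2]
        linear_combination Real.cos r * hpp
      exact Real.injOn_cos ⟨InnerProductGeometry.angle_nonneg _ _,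
        InnerProductGeometry.angle_le_pi _ _⟩ ⟨hr.1.le, hr.2.le⟩ hcos
    · obtain ⟨c0, c1, c2⟩ := E3.cross_apply a (γ.pos t)
      refine E3.ext fun i => ?_
      fin_cases i
      · rw [Fin.zero_eta, c0, ha]
        simp [n1, n2]
        linear_combination Real.sin r * (γ.tan t 0 * hpp - γ.pos t 0 * hpt)
      · rw [Fin.mk_one, c1, ha]
        simp [n0, n2]
        linear_combination Real.sin r * (γ.tan t 1 * hpp - γ.pos t 1 * hpt)
      · change E3.cross a (γ.pos t) 2 = _
        rw [c2, ha]
        simp [n0, n1]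
        linear_combination Real.sin r * (γ.tan t 2 * hpp - γ.pos t 2 * hpt)

theorem inner_circle_center (γ : ImmersedCurve) (s t : unitInterval) {r : ℝ}
    (hr : r ∈ Set.Ioo 0 Real.pi) :
    inner ℝ (γ.pos s) (Real.cos r • γ.pos t + Real.sin r • γ.normal t) - Real.cos r =
      Real.sin r * (inner ℝ (γ.pos s) (γ.normal t)
        - Real.cot r * (1 - inner ℝ (γ.pos s) (γ.pos t))) := by
  have := (Real.sin_pos_of_mem_Ioo hr).ne'
  rw [inner_add_right, inner_smul_right, inner_smul_right, Real.cot_eq_cos_div_sin]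
  field_simp
  ring

/-- The circle of curvature `cot r` is tangent from the left if and only if near `t` the curve does
not rise above it, the height over the tangent great circle being compared with the deviation
`1 - ⟪γ s, γ t⟫`. -/
theorem isLeftTangentCircle_iff (γ : ImmersedCurve) (t : unitInterval) (a : E3) (r : ℝ) :
    γ.IsLeftTangentCircle t a r ↔ (r ∈ Set.Ioo 0 Real.pi ∧
      a = Real.cos r • γ.pos t + Real.sin r • γ.normal t) ∧ ∀ᶠ s in nhds t,
        inner ℝ (γ.pos s) (γ.normal t) ≤ Real.cot r * (1 - inner ℝ (γ.pos s) (γ.pos t)) := by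
  rw [IsLeftTangentCircle, isTangentCircle_iff]
  refine and_congr_right fun h => ?_
  have ha : ‖a‖ = 1 := ((γ.isTangentCircle_iff t a r).2 h).1
  obtain ⟨hr, h⟩ := h
  refine Filter.eventually_congr (.of_forall fun s => ?_)
  have hs := Real.sin_pos_of_mem_Ioo hr
  have h1 := γ.inner_circle_center s t hr
  rw [← h, ← cos_angle_of_norm (γ.norm_pos s) ha] at h1
  rw [← Real.strictAntiOn_cos.le_iff_ge ⟨InnerProductGeometry.angle_nonneg _ _,
        InnerProductGeometry.angle_le_pi _ _⟩ ⟨hr.1.le, hr.2.le⟩,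
    ← sub_nonpos, h1, mul_nonpos_iff_pos_imp_nonpos]
  constructor
  · intro h
    linarith [h.1 hs]
  · intro h
    exact ⟨fun _ => by linarith, fun h' => hs.le⟩

theorem isRightTangentCircle_iff (γ : ImmersedCurve) (t : unitInterval) (a : E3) (r : ℝ) :
    γ.IsRightTangentCircle t a r ↔ (r ∈ Set.Ioo 0 Real.pi ∧
      a = Real.cos r • γ.pos t + Real.sin r • γ.normal t) ∧ ∀ᶠ s in nhds t,
        Real.cot r * (1 - inner ℝ (γ.pos s) (γ.pos t)) ≤ inner ℝ (γ.pos s) (γ.normal t) := by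
  rw [IsRightTangentCircle, isTangentCircle_iff]
  refine and_congr_right fun h => ?_
  have ha : ‖a‖ = 1 := ((γ.isTangentCircle_iff t a r).2 h).1
  obtain ⟨hr, h⟩ := h
  refine Filter.eventually_congr (.of_forall fun s => ?_)
  have hs := Real.sin_pos_of_mem_Ioo hr
  have h1 := γ.inner_circle_center s t hr
  rw [← h, ← cos_angle_of_norm (γ.norm_pos s) ha] at h1
  rw [← Real.strictAntiOn_cos.le_iff_ge ⟨hr.1.le, hr.2.le⟩
      ⟨InnerProductGeometry.angle_nonneg _ _, InnerProductGeometry.angle_le_pi _ _⟩,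
    ← sub_nonneg, h1, mul_nonneg_iff_of_pos_left hs, sub_nonneg]

theorem exists_cot_eq (c : ℝ) : ∃ r ∈ Set.Ioo 0 Real.pi, Real.cot r = c := by
  refine ⟨Real.pi / 2 - Real.arctan c, ⟨?_, ?_⟩, ?_⟩
  · linarith [Real.arctan_lt_pi_div_two c]
  · linarith [Real.neg_pi_div_two_lt_arctan c]
  · rw [← Real.tan_inv_eq_cot, Real.tan_pi_div_two_sub, inv_inv, Real.tan_arctan]

theorem inner_pos_lt_one (γ : ImmersedCurve) (t : unitInterval) :
    ∃ᶠ s in nhds t, inner ℝ (γ.pos s) (γ.pos t) < 1 := by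
  have h1 := (γ.hasDeriv t).eventually_ne (c := γ.pos t)
    (smul_ne_zero γ.len_pos.ne' (ne_zero_of_norm (γ.norm_tan t)))
  rw [Filter.Frequently]
  intro hcon
  have h2 : ∀ᶠ x : ℝ in nhdsWithin (t : ℝ) (Set.Icc 0 1 \ {(t : ℝ)}), False := by
    have h3 : ∀ᶠ x : ℝ in nhds (t : ℝ),
        ¬ inner ℝ (Set.IccExtend zero_le_one γ.pos x) (γ.pos t) < 1 := by
      have hc : Filter.Tendsto (Set.projIcc (0 : ℝ) 1 zero_le_one) (nhds (t : ℝ)) (nhds t) := by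
        have := (continuous_projIcc (h := zero_le_one (α := ℝ))).tendsto (t : ℝ)
        rwa [Set.projIcc_val] at this
      exact hc.eventually hcon
    filter_upwards [h1, nhdsWithin_le_nhds h3] with x hx hx'
    refine hx' (lt_of_le_of_ne ?_ fun he => hx ?_)
    · have := real_inner_le_norm (Set.IccExtend zero_le_one γ.pos x) (γ.pos t)
      rwa [γ.norm_pos, Set.IccExtend, Function.comp, γ.norm_pos, one_mul] at this
    · exact (inner_eq_one_iff_of_norm_eq_one (𝕜 := ℝ) (γ.norm_pos _) (γ.norm_pos t)).1 he
  have h4 : AccPt (t : ℝ) (Filter.principal (Set.Icc 0 1)) :=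
    uniqueDiffWithinAt_iff_accPt.1 (uniqueDiffOn_Icc zero_lt_one (t : ℝ) t.2)
  rw [accPt_iff_frequently_nhdsNE] at h4
  rw [Set.sdiff_eq, Set.inter_comm, nhdsWithin_inter', Filter.eventually_inf_principal] at h2
  exact h4 (h2.mono fun x hx => hx)

theorem rightCurvature_le_leftCurvature (γ : ImmersedCurve) (t : unitInterval) :
    γ.rightCurvature t ≤ γ.leftCurvature t := by
  refine sSup_le ?_
  rintro _ ⟨a, r, h, rfl⟩
  refine le_sInf ?_
  rintro _ ⟨a', r', h', rfl⟩
  rw [isRightTangentCircle_iff] at h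
  rw [isLeftTangentCircle_iff] at h'
  obtain ⟨s, hs, h1, h2⟩ := ((γ.inner_pos_lt_one t).and_eventually (h.2.and h'.2)).exists
  exact EReal.coe_le_coe_iff.2 (le_of_mul_le_mul_right (h1.trans h2) (sub_pos.2 hs))

/-- Membership in `curvesL` in terms of a two-sided bound on the height of the curve over its
tangent great circles. -/
theorem curvature_bounds_iff (γ : ImmersedCurve) (t : unitInterval) (κ : ℝ) :
    (((-κ : ℝ) : EReal) < γ.rightCurvature t ∧ γ.rightCurvature t ≤ γ.leftCurvature t ∧
      γ.leftCurvature t < (κ : EReal)) ↔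
    ∃ c < κ, ∀ᶠ s in nhds t, |inner ℝ (γ.pos s) (γ.normal t)|
      ≤ c * (1 - inner ℝ (γ.pos s) (γ.pos t)) := by
  have hnn : ∀ s, 0 ≤ 1 - inner ℝ (γ.pos s) (γ.pos t) := fun s => by
    have := real_inner_le_norm (γ.pos s) (γ.pos t)
    rw [γ.norm_pos, γ.norm_pos, one_mul] at this
    linarith
  constructor
  · rintro ⟨h1, -, h2⟩
    obtain ⟨_, ⟨a, r, hr, rfl⟩, hr'⟩ := lt_sSup_iff.1 h1
    obtain ⟨_, ⟨b, q, hq, rfl⟩, hq'⟩ := sInf_lt_iff.1 h2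
    rw [EReal.coe_lt_coe_iff] at hr' hq'
    rw [isRightTangentCircle_iff] at hr
    rw [isLeftTangentCircle_iff] at hq
    refine ⟨max (-Real.cot r) (Real.cot q), max_lt (by linarith) hq', ?_⟩
    filter_upwards [hr.2, hq.2] with s hs hs'
    have m1 := mul_le_mul_of_nonneg_right (le_max_left (-Real.cot r) (Real.cot q)) (hnn s)
    have m2 := mul_le_mul_of_nonneg_right (le_max_right (-Real.cot r) (Real.cot q)) (hnn s)
    rw [abs_le]
    constructor <;> linarith
  · rintro ⟨c, hc, h⟩
    refine ⟨?_, γ.rightCurvature_le_leftCurvature t, ?_⟩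
    · obtain ⟨r, hr, hrc⟩ := exists_cot_eq (-c)
      refine lt_of_lt_of_le (EReal.coe_lt_coe_iff.2 (neg_lt_neg hc)) (le_sSup
        ⟨_, r, (γ.isRightTangentCircle_iff t _ r).2 ⟨⟨hr, rfl⟩, ?_⟩, by rw [hrc]⟩)
      filter_upwards [h] with s hs
      rw [hrc]
      linarith [(abs_le.1 hs).1]
    · obtain ⟨r, hr, hrc⟩ := exists_cot_eq c
      refine lt_of_le_of_lt (sInf_le
        ⟨_, r, (γ.isLeftTangentCircle_iff t _ r).2 ⟨⟨hr, rfl⟩, ?_⟩, by rw [hrc]⟩)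
        (EReal.coe_lt_coe_iff.2 hc)
      filter_upwards [h] with s hs
      rw [hrc]
      exact (abs_le.1 hs).2

theorem inner_eq_rotFrame (γ : ImmersedCurve) (s t : unitInterval) :
    inner ℝ (γ.pos s) (γ.normal t) = ((γ.rotFrame t)⁻¹ * γ.rotFrame s).1 2 0 ∧
    inner ℝ (γ.pos s) (γ.pos t) = ((γ.rotFrame t)⁻¹ * γ.rotFrame s).1 0 0 := by
  rw [E3.inner_eq, E3.inner_eq, inv_mul_apply, inv_mul_apply]
  simp only [rotFrame_zero, rotFrame_two]
  exact ⟨by ring, by ring⟩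

end ImmersedCurve

/-! ### Passing between arcs and immersed curves -/

open SO3

theorem E3.hasDerivWithinAt_iff {f : ℝ → E3} {f' : E3} {s : Set ℝ} {x : ℝ} :
    HasDerivWithinAt f f' s x ↔ ∀ i, HasDerivWithinAt (fun y => f y i) (f' i) s x := by
  simp only [hasDerivWithinAt_iff_hasFDerivWithinAt]
  rw [hasFDerivWithinAt_euclidean]
  refine forall_congr' fun i => ?_
  rw [show (EuclideanSpace.proj i).comp (ContinuousLinearMap.toSpanSingleton ℝ f') =
    ContinuousLinearMap.toSpanSingleton ℝ (f' i) by ext; simp]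

namespace Arc

/-- The immersed curve described by an arc of positive length. -/
def toCurve (A : Arc) (hA : 0 < A.len) : ImmersedCurve where
  pos := ⟨fun t => WithLp.toLp 2 fun i => (A.frame (A.len * t)).1 i 0, by
    refine (PiLp.continuous_toLp 2 _).comp (continuous_pi fun i => ?_)
    exact (continuous_apply i 0).comp (by fun_prop)⟩
  tan := ⟨fun t => WithLp.toLp 2 fun i => (A.frame (A.len * t)).1 i 1, by
    refine (PiLp.continuous_toLp 2 _).comp (continuous_pi fun i => ?_)
    exact (continuous_apply i 1).comp (by fun_prop)⟩
  len := A.len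
  len_pos := hA
  norm_pos t := by
    rw [← pow_eq_one_iff_of_nonneg (norm_nonneg _) two_ne_zero, ← real_inner_self_eq_norm_sq,
      E3.inner_eq]
    exact col_dot (A.frame (A.len * t)) 0 0
  norm_tan t := by
    rw [← pow_eq_one_iff_of_nonneg (norm_nonneg _) two_ne_zero, ← real_inner_self_eq_norm_sq,
      E3.inner_eq]
    exact col_dot (A.frame (A.len * t)) 1 1
  hasDeriv t := by
    have h1 : HasDerivAt (fun x : ℝ => A.len * x) A.len (t : ℝ) := by
      simpa using (hasDerivAt_id (t : ℝ)).const_mul A.len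
    have h2 : HasDerivWithinAt
        (fun x : ℝ => (WithLp.toLp 2 fun i => (A.frame (A.len * x)).1 i 0 : E3))
        (A.len • (WithLp.toLp 2 fun i => (A.frame (A.len * t)).1 i 1 : E3)) (Set.Icc 0 1) t := by
      rw [E3.hasDerivWithinAt_iff]
      intro i
      have := (A.unitSpeed (A.len * t) i).comp (t : ℝ) h1
      rw [mul_comm] at this
      exact this.hasDerivWithinAt
    refine h2.congr (fun x hx => ?_) ?_
    · rw [Set.IccExtend_of_mem _ _ hx]
      rfl
    · rw [Set.IccExtend_val]
      rfl

theorem toCurve_pos (A : Arc) (hA : 0 < A.len) (t : unitInterval) (i : Fin 3) :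
    (A.toCurve hA).pos t i = (A.frame (A.len * t)).1 i 0 := rfl

theorem toCurve_tan (A : Arc) (hA : 0 < A.len) (t : unitInterval) (i : Fin 3) :
    (A.toCurve hA).tan t i = (A.frame (A.len * t)).1 i 1 := rfl

theorem rotFrame_toCurve (A : Arc) (hA : 0 < A.len) (t : unitInterval) :
    (A.toCurve hA).rotFrame t = A.frame (A.len * t) := by
  refine SO3.ext' fun i j => ?_
  fin_cases j
  · rfl
  · rfl
  · obtain ⟨c0, c1, c2⟩ := E3.cross_apply ((A.toCurve hA).pos t) ((A.toCurve hA).tan t)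
    obtain ⟨d0, d1, d2⟩ := third_col (A.frame (A.len * t))
    fin_cases i
    · exact c0.trans d0.symm
    · exact c1.trans d1.symm
    · exact c2.trans d2.symm

theorem continuous_toCurve {X : Type*} [TopologicalSpace X] {F : X → Arc} (hF : Continuous F)
    (h : ∀ x, 0 < (F x).len) : Continuous fun x => (F x).toCurve (h x) := by
  have key : ∀ j, Continuous fun p : X × unitInterval =>
      (WithLp.toLp 2 fun i => ((F p.1).frame ((F p.1).len * p.2)).1 i j : E3) := fun j => by
    refine (PiLp.continuous_toLp 2 _).comp (continuous_pi fun i => ?_)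
    exact (continuous_apply i j).comp (by fun_prop)
  exact ImmersedCurve.continuous_of_pos_tan (key 0) (key 1)

theorem toCurve_mem_immersed {A : Arc} (hA : 0 < A.len)
    {Q : Matrix.specialOrthogonalGroup (Fin 3) ℝ} (h : A.last = Q) :
    A.toCurve hA ∈ ImmersedCurve.immersed 1 Q := by
  constructor
  · refine (congrArg Subtype.val (rotFrame_toCurve A hA 0)).trans ?_
    rw [Set.Icc.coe_zero, mul_zero, frame_zero]
  · refine (congrArg Subtype.val (rotFrame_toCurve A hA 1)).trans ?_
    rw [Set.Icc.coe_one, mul_one, ← h, last]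

theorem toCurve_mem_curvesL {A : Arc} (hA : 0 < A.len)
    {Q : Matrix.specialOrthogonalGroup (Fin 3) ℝ} (h : A.last = Q) {ρ₀ : ℝ}
    (hb : A.Bounded (Real.cot ρ₀)) :
    A.toCurve hA ∈ ImmersedCurve.curvesL ρ₀ Q := by
  refine ⟨toCurve_mem_immersed hA h, fun t => (ImmersedCurve.curvature_bounds_iff _ t _).2 ?_⟩
  obtain ⟨c, hc, hs⟩ := hb (A.len * t)
  refine ⟨c, hc, ?_⟩
  have ht : Filter.Tendsto (fun s : unitInterval => A.len * s) (nhds t) (nhds (A.len * t)) :=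
    (by fun_prop : Continuous fun s : unitInterval => A.len * s).tendsto t
  filter_upwards [ht.eventually hs] with s hs
  obtain ⟨h1, h2⟩ := (A.toCurve hA).inner_eq_rotFrame s t
  rw [h1, h2, rotFrame_toCurve, rotFrame_toCurve]
  exact hs

end Arc

namespace ImmersedCurve

/-- The frame of an immersed curve as a function of arc length, moved so that it starts at `1` and
prolonged by great circles. -/
def arcFrame (γ : ImmersedCurve) (σ : ℝ) : SO3 :=
  (γ.rotFrame 0)⁻¹ * γ.rotFrame (Set.projIcc 0 1 zero_le_one (σ / γ.len)) *
    rot 0 (σ - max 0 (min σ γ.len))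

theorem continuous_arcFrame : Continuous fun p : ImmersedCurve × ℝ => p.1.arcFrame p.2 := by
  have hl := continuous_len
  have h : ∀ g : ImmersedCurve × ℝ → unitInterval, Continuous g →
      Continuous fun p : ImmersedCurve × ℝ => p.1.rotFrame (g p) := fun g hg =>
    continuous_rotFrame.comp (continuous_fst.prodMk hg)
  refine ((h _ continuous_const).inv.mul (h _ ?_)).mul (by fun_prop)
  refine continuous_projIcc.comp ?_
  exact continuous_snd.div (by fun_prop) fun p => p.1.len_pos.ne'

theorem arcFrame_of_nonpos (γ : ImmersedCurve) {σ : ℝ} (h : σ ≤ 0) : γ.arcFrame σ = rot 0 σ := by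
  have hL := γ.len_pos
  rw [arcFrame, Set.projIcc_of_le_left _ (div_nonpos_of_nonpos_of_nonneg h hL.le),
    min_eq_left (h.trans hL.le), max_eq_left h, sub_zero]
  exact (congrArg (· * _) (inv_mul_cancel _)).trans (one_mul _)

theorem arcFrame_of_mem (γ : ImmersedCurve) {σ : ℝ} (h : σ ∈ Set.Icc 0 γ.len) :
    γ.arcFrame σ = (γ.rotFrame 0)⁻¹ *
      γ.rotFrame (Set.projIcc 0 1 zero_le_one (σ / γ.len)) := by
  rw [arcFrame, min_eq_left h.2, max_eq_right h.1, _root_.sub_self, rot_angle_zero, mul_one]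

theorem arcFrame_of_len_le (γ : ImmersedCurve) {σ : ℝ} (h : γ.len ≤ σ) :
    γ.arcFrame σ = γ.arcFrame γ.len * rot 0 (σ - γ.len) := by
  have hL := γ.len_pos
  rw [arcFrame_of_mem γ ⟨hL.le, le_rfl⟩, arcFrame, min_eq_right h, max_eq_right hL.le,
    Set.projIcc_of_right_le _ ((one_le_div hL).2 h), Set.projIcc_of_right_le _ (div_self hL.ne').ge]

theorem hasDerivWithinAt_of_eqOn {f g f' g' : ℝ → ℝ} {s : Set ℝ} (hs : IsClosed s)
    (hfg : Set.EqOn f g s) (hfg' : Set.EqOn f' g' s)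
    (hg : ∀ x ∈ s, HasDerivWithinAt g (g' x) s x) (x : ℝ) :
    HasDerivWithinAt f (f' x) s x := by
  by_cases hx : x ∈ s
  · rw [hfg' hx]
    exact (hg x hx).congr hfg (hfg hx)
  · refine HasFDerivWithinAt.of_notMem_closure ?_
    rwa [hs.closure_eq]

theorem unitSpeed_arcFrame (γ : ImmersedCurve) : UnitSpeed γ.arcFrame := by
  intro σ i
  have hL := γ.len_pos
  have d1 : HasDerivWithinAt (fun s => (γ.arcFrame s).1 i 0) ((γ.arcFrame σ).1 i 1)
      (Set.Iic 0) σ := by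
    refine hasDerivWithinAt_of_eqOn (f' := fun s => (γ.arcFrame s).1 i 1)
      (g := fun s => (rot 0 s).1 i 0) (g' := fun s => (rot 0 s).1 i 1)
      isClosed_Iic (fun s hs => ?_) (fun s hs => ?_)
      (fun s hs => (unitSpeed_rot_zero s i).hasDerivWithinAt) σ
    · simp only [γ.arcFrame_of_nonpos hs]
    · simp only [γ.arcFrame_of_nonpos hs]
  have d3 : HasDerivWithinAt (fun s => (γ.arcFrame s).1 i 0) ((γ.arcFrame σ).1 i 1)
      (Set.Ici γ.len) σ := by
    refine hasDerivWithinAt_of_eqOn (f' := fun s => (γ.arcFrame s).1 i 1)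
      (g := fun s => (γ.arcFrame γ.len * rot 0 (s - γ.len)).1 i 0)
      (g' := fun s => (γ.arcFrame γ.len * rot 0 (s - γ.len)).1 i 1)
      isClosed_Ici (fun s hs => ?_) (fun s hs => ?_)
      (fun s hs => (((unitSpeed_rot_zero.comp_sub γ.len).mul_left _) s i).hasDerivWithinAt) σ
    · simp only [γ.arcFrame_of_len_le hs]
    · simp only [γ.arcFrame_of_len_le hs]
  have hcol : ∀ j, ∀ G : C(unitInterval, E3), (∀ t i, (γ.rotFrame t).1 i j = G t i) →
      ∀ s ∈ Set.Icc 0 γ.len, (γ.arcFrame s).1 i j =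
        (γ.rotFrame 0).1 0 i * Set.IccExtend zero_le_one G ((s - 0) / γ.len) 0
        + (γ.rotFrame 0).1 1 i * Set.IccExtend zero_le_one G ((s - 0) / γ.len) 1
        + (γ.rotFrame 0).1 2 i * Set.IccExtend zero_le_one G ((s - 0) / γ.len) 2 := by
    intro j G hG s hs
    rw [γ.arcFrame_of_mem hs, inv_mul_apply, hG, hG, hG, sub_zero]
    rfl
  have d2 : HasDerivWithinAt (fun s => (γ.arcFrame s).1 i 0) ((γ.arcFrame σ).1 i 1)
      (Set.Icc 0 γ.len) σ := by
    refine hasDerivWithinAt_of_eqOn (f' := fun s => (γ.arcFrame s).1 i 1) isClosed_Icc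
      (hcol 0 γ.pos fun t i => rfl) (hcol 1 γ.tan fun t i => rfl) (fun s hs => ?_) σ
    have h := γ.hasDerivWithinAt_rescale 0 (a := 0) (b := γ.len) (x := s) (fun y hy => by
      rw [sub_zero]
      exact ⟨div_nonneg hy.1 hL.le, (div_le_one hL).2 hy.2⟩) hs
    rw [E3.hasDerivWithinAt_iff] at h
    exact (((h 0).const_mul _).add ((h 1).const_mul _)).add ((h 2).const_mul _)
  have h := (d1.union d2).union d3
  rwa [Set.Iic_union_Icc_eq_Iic hL.le, Set.Iic_union_Ici, hasDerivWithinAt_univ] at h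

/-- An immersed curve as an arc, moved so that its initial frame is `1`. -/
def toArc (γ : ImmersedCurve) : Arc where
  len := γ.len
  len_nonneg := γ.len_pos.le
  frame := ⟨γ.arcFrame, by
    have h := continuous_arcFrame.comp (Continuous.prodMk_right γ)
    exact h⟩
  unitSpeed := γ.unitSpeed_arcFrame
  frame_of_nonpos _ h := γ.arcFrame_of_nonpos h
  frame_of_len_le _ h := γ.arcFrame_of_len_le h

theorem toArc_len (γ : ImmersedCurve) : γ.toArc.len = γ.len := rfl

theorem toArc_frame (γ : ImmersedCurve) (t : unitInterval) :
    γ.toArc.frame (γ.len * t) = (γ.rotFrame 0)⁻¹ * γ.rotFrame t := by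
  have hL := γ.len_pos
  refine (γ.arcFrame_of_mem ⟨mul_nonneg hL.le t.2.1, mul_le_of_le_one_right hL.le t.2.2⟩).trans ?_
  rw [mul_div_cancel_left₀ _ hL.ne', Set.projIcc_val]

@[fun_prop] theorem continuous_toArc : Continuous toArc :=
  Arc.continuous_iff.2 ⟨continuous_len, continuous_arcFrame⟩

theorem rotFrame_zero_of_mem {γ : ImmersedCurve} {Q : Matrix.specialOrthogonalGroup (Fin 3) ℝ}
    (h : γ ∈ immersed 1 Q) : γ.rotFrame 0 = 1 := Subtype.ext h.1

theorem toArc_last {γ : ImmersedCurve} {Q : Matrix.specialOrthogonalGroup (Fin 3) ℝ}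
    (h : γ ∈ immersed 1 Q) : γ.toArc.last = Q := by
  have h1 := γ.toArc_frame 1
  rw [Set.Icc.coe_one, mul_one, rotFrame_zero_of_mem h, inv_one, one_mul] at h1
  exact h1.trans (Subtype.ext h.2)

theorem toCurve_toArc {γ : ImmersedCurve} {Q : Matrix.specialOrthogonalGroup (Fin 3) ℝ}
    (h : γ ∈ immersed 1 Q) (hA : 0 < γ.toArc.len) : γ.toArc.toCurve hA = γ := by
  have hf : ∀ t : unitInterval, γ.toArc.frame (γ.len * t) = γ.rotFrame t := fun t => by
    rw [toArc_frame, rotFrame_zero_of_mem h, inv_one, one_mul]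
  refine ext_of_pos_tan (fun t => E3.ext fun i => ?_) (fun t => E3.ext fun i => ?_)
  · rw [Arc.toCurve_pos, toArc_len, hf]
    rfl
  · rw [Arc.toCurve_tan, toArc_len, hf]
    rfl

theorem bounded_toArc {γ : ImmersedCurve} {Q : Matrix.specialOrthogonalGroup (Fin 3) ℝ} {ρ₀ : ℝ}
    (h : γ ∈ curvesL ρ₀ Q) (hρ : 0 < Real.cot ρ₀) : γ.toArc.Bounded (Real.cot ρ₀) := by
  have hL := γ.len_pos
  intro σ
  -- Beyond the ends the curve is a great circle, of height `0` over its tangent great circle.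
  have hflat : ∀ (B : SO3) (a b : ℝ), ((B * rot 0 a)⁻¹ * (B * rot 0 b)).1 2 0 = 0 := by
    intro B a b
    have : (B * rot 0 a)⁻¹ * (B * rot 0 b) = rot 0 (b - a) := by
      rw [mul_inv_rev, mul_assoc, inv_mul_cancel_left, inv_mul_eq_iff_eq_mul, ← rot_add,
        add_sub_cancel]
    rw [this, rot_apply]
    simp
  have hl : ∀ s ≤ 0, γ.arcFrame s = 1 * rot 0 s := fun s hs => by
    rw [γ.arcFrame_of_nonpos hs, one_mul]
  have hnn : ∀ A : SO3, 0 ≤ 1 - A.1 0 0 := fun A => sub_nonneg.2 (apply_le_one _ _ _)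
  change ∃ c < Real.cot ρ₀, ∀ᶠ s in nhds σ, |((γ.arcFrame σ)⁻¹ * γ.arcFrame s).1 2 0|
    ≤ c * (1 - ((γ.arcFrame σ)⁻¹ * γ.arcFrame s).1 0 0)
  have hzero : ∀ s, ((γ.arcFrame σ)⁻¹ * γ.arcFrame s).1 2 0 = 0 → ∀ c, 0 ≤ c →
      |((γ.arcFrame σ)⁻¹ * γ.arcFrame s).1 2 0|
        ≤ c * (1 - ((γ.arcFrame σ)⁻¹ * γ.arcFrame s).1 0 0) := fun s hs c hc => by
    rw [hs, abs_zero]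
    exact mul_nonneg hc (hnn _)
  by_cases hσ : σ ∈ Set.Icc 0 γ.len
  · set t : unitInterval := Set.projIcc 0 1 zero_le_one (σ / γ.len) with ht
    obtain ⟨c, hc, hs⟩ := (γ.curvature_bounds_iff t _).1 (h.2 t)
    refine ⟨max c 0, max_lt hc hρ, ?_⟩
    have hcont : Filter.Tendsto (fun s : ℝ => Set.projIcc (0 : ℝ) 1 zero_le_one (s / γ.len))
        (nhds σ) (nhds t) :=
      (continuous_projIcc.comp (continuous_id.div_const _)).tendsto σ
    have hleft : ∀ᶠ s in nhds σ, s < 0 → σ = 0 := by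
      rcases hσ.1.eq_or_lt with h0 | h0
      · exact .of_forall fun s _ => h0.symm
      · filter_upwards [Ioi_mem_nhds h0] with s hs hs'
        exact absurd hs (not_lt.2 hs'.le)
    have hright : ∀ᶠ s in nhds σ, γ.len < s → σ = γ.len := by
      rcases hσ.2.eq_or_lt with h0 | h0
      · exact .of_forall fun s _ => h0
      · filter_upwards [Iio_mem_nhds h0] with s hs hs'
        exact absurd hs (not_lt.2 hs'.le)
    filter_upwards [hcont.eventually hs, hleft, hright] with s hs hsl hsr
    rcases lt_or_ge s 0 with h0 | h0
    · refine hzero s ?_ _ (le_max_right _ _)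
      rw [hl s h0.le, hl σ (hsl h0).le, hflat]
    rcases lt_or_ge γ.len s with h1 | h1
    · refine hzero s ?_ _ (le_max_right _ _)
      rw [γ.arcFrame_of_len_le h1.le, γ.arcFrame_of_len_le (hsr h1).ge, hflat]
    · obtain ⟨e1, e2⟩ := γ.inner_eq_rotFrame
        (Set.projIcc 0 1 zero_le_one (s / γ.len)) t
      rw [e1, e2] at hs
      rw [γ.arcFrame_of_mem hσ, γ.arcFrame_of_mem ⟨h0, h1⟩, ← ht, rotFrame_zero_of_mem h.1,
        inv_one, one_mul, one_mul]
      exact hs.trans (mul_le_mul_of_nonneg_right (le_max_left _ _) (hnn _))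
  · refine ⟨0, hρ, ?_⟩
    rw [Set.mem_Icc, not_and_or, not_le, not_le] at hσ
    rcases hσ with h0 | h0
    · filter_upwards [Iio_mem_nhds h0] with s hs
      refine hzero s ?_ _ le_rfl
      rw [hl s (le_of_lt hs), hl σ h0.le, hflat]
    · filter_upwards [Ioi_mem_nhds h0] with s hs
      refine hzero s ?_ _ le_rfl
      rw [γ.arcFrame_of_len_le (le_of_lt hs), γ.arcFrame_of_len_le h0.le, hflat]

/-- Grafting loops is a concatenation of arcs. -/
theorem graft_eq_toCurve {γ : ImmersedCurve} {Q : Matrix.specialOrthogonalGroup (Fin 3) ℝ}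
    (h : γ ∈ immersed 1 Q) (t₀ : unitInterval) (k : ℕ)
    (hA : 0 < (γ.toArc.sub 0 (γ.len * t₀) * Arc.loop ^ k
      * γ.toArc.sub (γ.len * t₀) γ.len).len) :
    (γ.toArc.sub 0 (γ.len * t₀) * Arc.loop ^ k * γ.toArc.sub (γ.len * t₀) γ.len).toCurve hA =
      γ.graft t₀ k := by
  have hL := γ.len_pos
  have ha0 : 0 ≤ γ.len * t₀ := mul_nonneg hL.le t₀.2.1
  have ha1 : γ.len * t₀ ≤ γ.len := mul_le_of_le_one_right hL.le t₀.2.2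
  have hfr : ∀ s ∈ Set.Icc 0 γ.len, γ.toArc.frame s =
      γ.rotFrame (Set.projIcc 0 1 zero_le_one (s / γ.len)) := fun s hs => by
    refine (γ.arcFrame_of_mem hs).trans ?_
    rw [rotFrame_zero_of_mem h, inv_one, one_mul]
  set a := γ.len * t₀ with ha
  set m : ℝ := 2 * Real.pi * k with hm
  have hm0 : 0 ≤ m := loops_nonneg k
  have hat : Set.projIcc (0 : ℝ) 1 zero_le_one (a / γ.len) = t₀ := by
    rw [ha, mul_div_cancel_left₀ _ hL.ne', Set.projIcc_val]
  have hl1 : (γ.toArc.sub 0 a).len = a := by rw [Arc.sub_len _ ha0, sub_zero]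
  have hl2 : (γ.toArc.sub 0 a * Arc.loop ^ k).len = a + m := by
    rw [Arc.mul_len, hl1, Arc.loop_pow_len]
  have hl3 : (γ.toArc.sub 0 a * Arc.loop ^ k * γ.toArc.sub a γ.len).len = γ.len + m := by
    rw [Arc.mul_len, hl2, Arc.sub_len _ ha1]; ring
  -- The powers of the loop turn the frame uniformly.
  have hloop : ∀ (k : ℕ) (s : ℝ), 0 ≤ s → s ≤ 2 * Real.pi * k →
      (Arc.loop ^ k).frame s = rot 0 s := by
    intro k
    have hpow : Arc.loop ^ k = Arc.circ 0 (2 * Real.pi * k) := by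
      induction k with
      | zero => simp [Arc.circ_zero_angle]
      | succ k ih =>
        rw [pow_succ, ih, Arc.loop, ← Arc.circ_add (loops_nonneg k) (by positivity)]
        congr 1
        push_cast
        ring
    intro s h0 h1
    rw [hpow, Arc.circ_frame h0 (by simpa using h1), slope_zero, mul_one]
  have hmain : ∀ s, 0 ≤ s → s ≤ γ.len + m → ∀ j, ∀ G : C(unitInterval, E3),
      (∀ t i, (γ.rotFrame t).1 i j = G t i) → ∀ i,
      ((γ.toArc.sub 0 a * Arc.loop ^ k * γ.toArc.sub a γ.len).frame s).1 i j =
        if s ≤ t₀ * γ.len then Set.IccExtend zero_le_one G (s / γ.len) i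
        else if s ≤ t₀ * γ.len + 2 * Real.pi * k then
          (γ.rotFrame t₀ * rot 0 (s - t₀ * γ.len)).1 i j
        else Set.IccExtend zero_le_one G ((s - 2 * Real.pi * k) / γ.len) i := by
    intro s h0 h1 j G hG i
    rw [mul_comm (t₀ : ℝ), ← ha, ← hm]
    split_ifs with c1 c2
    · rw [Arc.mul_frame_of_le _ _ (by rw [hl2]; linarith), Arc.mul_frame_of_le _ _ (by rwa [hl1]),
        Arc.sub_frame _ h0 (by linarith), Arc.frame_zero, inv_one, one_mul, add_zero,
        hfr s ⟨h0, c1.trans ha1⟩, hG]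
      rfl
    · rw [not_le] at c1
      rw [Arc.mul_frame_of_le _ _ (by rwa [hl2]), Arc.mul_frame_of_ge _ _ (by rw [hl1]; exact c1.le),
        hl1, Arc.sub_last _ ha0, Arc.frame_zero, inv_one, one_mul, hfr a ⟨ha0, ha1⟩, hat,
        hloop k _ (by linarith) (by linarith)]
    · rw [not_le] at c1 c2
      rw [Arc.mul_frame_of_ge _ _ (by rw [hl2]; exact c2.le), hl2, Arc.mul_last, Arc.loop_pow_last,
        Arc.sub_last _ ha0, Arc.frame_zero, inv_one, one_mul, mul_one,
        Arc.sub_frame _ (by linarith) (by linarith), mul_inv_cancel_left,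
        show s - (a + m) + a = s - m by ring, hfr _ ⟨by linarith, by linarith⟩, hG]
      rfl
  have hM : 0 ≤ γ.len + m := by linarith
  have hs0 : ∀ t : unitInterval, 0 ≤ (γ.len + m) * t := fun t => mul_nonneg hM t.2.1
  have hs1 : ∀ t : unitInterval, (γ.len + m) * t ≤ γ.len + m := fun t =>
    mul_le_of_le_one_right hM t.2.2
  refine ext_of_pos_tan (fun t => E3.ext fun i => ?_) (fun t => E3.ext fun i => ?_)
  · rw [Arc.toCurve_pos, hl3, hmain _ (hs0 t) (hs1 t) 0 γ.pos (fun _ _ => rfl)]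
    change _ = γ.graftPos t₀ k ((γ.len + m) * t) i
    rw [graftPos]
    split_ifs
    · rfl
    · rw [mul_apply, rot_apply]
      simp [rotFrame_zero, rotFrame_one]
      ring
    · rfl
  · rw [Arc.toCurve_tan, hl3, hmain _ (hs0 t) (hs1 t) 1 γ.tan (fun _ _ => rfl)]
    change _ = γ.graftTan t₀ k ((γ.len + m) * t) i
    rw [graftTan]
    split_ifs
    · rfl
    · rw [mul_apply, rot_apply]
      simp [rotFrame_zero, rotFrame_one]
      ring
    · rfl

end ImmersedCurve

/-! ### Closed arcs and arcs with a given final frame -/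

namespace SO3

theorem quatMat_neg (w x y z : ℝ) : quatMat (-w) (-x) (-y) (-z) = quatMat w x y z := by
  simp [quatMat]

theorem rot_coe (k θ : ℝ) : (rot k θ).1 = quatMat (Real.cos (θ / 2))
    (Real.sin (θ / 2) * (k / slope k)) 0 (Real.sin (θ / 2) * (1 / slope k)) := rfl

/-- For `k ^ 2 = -cos a` the quaternion of `rot k a * rot (-k) a` is purely imaginary, so that this
product is a half-turn. -/
theorem rot_mul_rot_neg_sq {k a : ℝ} (h : k ^ 2 = -Real.cos a) :
    (rot k a * rot (-k) a) ^ 2 = 1 := by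
  have hs := slope_sq k
  have hs0 := (slope_pos k).ne'
  have h2 := Real.sin_sq_add_cos_sq (a / 2)
  have hc : Real.cos a = Real.cos (a / 2) ^ 2 - Real.sin (a / 2) ^ 2 := by
    rw [← Real.cos_two_mul']; ring_nf
  rw [hc] at h
  refine Subtype.ext ?_
  rw [pow_two]
  change (quatMat _ _ _ _ * quatMat _ _ _ _) * (quatMat _ _ _ _ * quatMat _ _ _ _) = 1
  rw [slope_neg, quatMat_mul, quatMat_mul, ← quatMat_one, ← quatMat_neg 1 0 0 0]
  generalize Real.sin (a / 2) = s at *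
  generalize Real.cos (a / 2) = c at *
  set x := s * (k / slope k) with hx
  set z := s * (1 / slope k) with hz
  have e1 : x ^ 2 + z ^ 2 = s ^ 2 := by
    rw [hx, hz]
    field_simp
    rw [hs]
    ring
  have e2 : c ^ 2 + x ^ 2 - z ^ 2 = 0 := by
    rw [hx, hz]
    field_simp
    rw [hs, h]
    linear_combination (s ^ 2 - c ^ 2) * h2
  have e3 : s * (-k / slope k) = -x := by rw [hx]; ring
  rw [e3]
  have e4 : c * c - x * -x - 0 * 0 - z * z = 0 := by linear_combination e2
  rw [e4]
  congr 1
  · linear_combination (-(c ^ 2 + x ^ 2 + z ^ 2) - 1) * (h2 + e1) + (c ^ 2 + x ^ 2 - z ^ 2) * e2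
  all_goals ring

end SO3

namespace Arc

/-- Four circle arcs of curvatures `k, -k, k, -k` with `k = √(-cos a)` along each of which the frame
turns by `a`. For `π / 2 ≤ a ≤ 3 * π / 2` the curve closes up; it is one great circle for
`a = π / 2` and three great circles for `a = 3 * π / 2`. -/
def fourArcs (a : ℝ) : Arc :=
  (circ √(-Real.cos a) a * circ (-√(-Real.cos a)) a) ^ 2

theorem pow_last (A : Arc) (n : ℕ) : (A ^ n).last = A.last ^ n := by
  induction n with
  | zero => simp
  | succ n ih => rw [pow_succ, mul_last, ih, pow_succ]

theorem fourArcs_last {a : ℝ} (h : a ∈ Set.Icc (Real.pi / 2) (Real.pi / 2 + Real.pi)) :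
    (fourArcs a).last = 1 := by
  have h0 : 0 ≤ a := by linarith [h.1, Real.pi_pos]
  have hc : Real.cos a ≤ 0 := Real.cos_nonpos_of_pi_div_two_le_of_le h.1 (by linarith [h.2])
  rw [fourArcs, pow_last, mul_last, circ_last h0, circ_last h0]
  exact rot_mul_rot_neg_sq (Real.sq_sqrt (by linarith))

theorem bounded_fourArcs {κ : ℝ} (hκ : 1 < κ) (a : ℝ) : (fourArcs a).Bounded κ := by
  have h1 : √(-Real.cos a) ≤ 1 :=
    Real.sqrt_le_one.2 (by linarith [Real.neg_one_le_cos a])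
  have h2 : |√(-Real.cos a)| < κ := by
    rw [abs_of_nonneg (Real.sqrt_nonneg _)]
    linarith
  exact ((bounded_circ h2).mul (bounded_circ (by rwa [abs_neg]))).pow (by linarith) 2

@[fun_prop] theorem continuous_fourArcs {X : Type*} [TopologicalSpace X] {a : X → ℝ}
    (ha : Continuous a) : Continuous fun x => fourArcs (a x) := by
  unfold fourArcs; fun_prop

theorem fourArcs_left : fourArcs (Real.pi / 2) = loop := by
  have := Real.pi_pos
  rw [fourArcs, Real.cos_pi_div_two, neg_zero, Real.sqrt_zero, neg_zero,
    ← circ_add (by positivity) (by positivity), pow_two, ← circ_add (by positivity) (by positivity),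
    loop]
  congr 1
  ring

theorem fourArcs_right : fourArcs (Real.pi / 2 + Real.pi) = loop ^ 3 := by
  have := Real.pi_pos
  have hc : Real.cos (Real.pi / 2 + Real.pi) = 0 := by
    rw [Real.cos_add_pi, Real.cos_pi_div_two, neg_zero]
  rw [fourArcs, hc, neg_zero, Real.sqrt_zero, neg_zero,
    ← circ_add (by positivity) (by positivity), pow_two, ← circ_add (by positivity) (by positivity),
    loop, pow_succ, pow_two, ← circ_add (by positivity) (by positivity),
    ← circ_add (by positivity) (by positivity)]
  congr 1
  ring

/-- The frames which `detour` reaches. -/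
def near : Set SO3 := {B | 0 < B.1 1 1 ∧ 0 < B.1 2 2}

theorem isOpen_near : IsOpen near :=
  (isOpen_lt continuous_const (continuous_apply 1 1)).inter
    (isOpen_lt continuous_const (continuous_apply 2 2))

theorem one_mem_near : (1 : SO3) ∈ near := by
  constructor <;> simp

/-- An arc with final frame `B`, which depends continuously on `B` for `B` near `1` and consists of
two great circles for `B = 1`. A half turn of slope `k` followed by a half turn along a great circle
is a rotation about the direction of the curve; two such rotations about orthogonal axes and a
rotation about the normal make up the Tait-Bryan decomposition of `B`. -/
def detour (B : SO3) : Arc :=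
  circ (B.1 0 2 / (√(1 - B.1 1 2 ^ 2) + B.1 2 2)) Real.pi * circ 0 (3 * Real.pi / 2) *
    circ (B.1 1 2 / (1 + √(1 - B.1 1 2 ^ 2))) Real.pi *
    circ 0 (Real.pi / 2 + Real.arctan (B.1 1 0 / B.1 1 1))

theorem continuous_detour {X : Type*} [TopologicalSpace X] {F : X → SO3} (hF : Continuous F)
    (h : ∀ x, F x ∈ near) : Continuous fun x => detour (F x) := by
  have hc : ∀ i j, Continuous fun x => (F x).1 i j := fun i j => by
    have := (continuous_apply i j).comp hF
    exact this
  have h1 : ∀ x, √(1 - (F x).1 1 2 ^ 2) + (F x).1 2 2 ≠ 0 := fun x =>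
    (add_pos_of_nonneg_of_pos (Real.sqrt_nonneg _) (h x).2).ne'
  have h2 : ∀ x, 1 + √(1 - (F x).1 1 2 ^ 2) ≠ 0 := fun x => by positivity
  have h3 : ∀ x, (F x).1 1 1 ≠ 0 := fun x => (h x).1.ne'
  unfold detour
  have a1 := hc 0 2
  have a2 := hc 1 2
  have a3 := hc 2 2
  have a4 := hc 1 0
  have a5 := hc 1 1
  fun_prop (disch := assumption)

theorem detour_one : detour 1 = loop ^ 2 := by
  have := Real.pi_pos
  simp only [detour, one_apply]
  simp only [Fin.reduceEq, if_false, zero_div, Real.arctan_zero, add_zero]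
  rw [← circ_add (by positivity) (by positivity), ← circ_add (by positivity) (by positivity),
    ← circ_add (by positivity) (by positivity), loop, pow_two,
    ← circ_add (by positivity) (by positivity)]
  congr 1
  ring

theorem bounded_detour {κ : ℝ} (hκ : 1 < κ) {B : SO3} (hB : B ∈ near) : (detour B).Bounded κ := by
  have hκ0 : |(0 : ℝ)| < κ := by rw [abs_zero]; linarith
  have h22 := hB.2
  have hcol := col_dot B 2 2
  rw [if_pos rfl] at hcol
  have hsq : 0 ≤ √(1 - B.1 1 2 ^ 2) := Real.sqrt_nonneg _
  have h1 : |B.1 0 2 / (√(1 - B.1 1 2 ^ 2) + B.1 2 2)| < κ := by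
    have hp : 0 < √(1 - B.1 1 2 ^ 2) + B.1 2 2 := by linarith
    refine lt_of_le_of_lt ?_ hκ
    rw [abs_div, abs_of_pos hp, div_le_one hp]
    have : |B.1 0 2| ≤ √(1 - B.1 1 2 ^ 2) := Real.abs_le_sqrt (by nlinarith)
    linarith
  have h2 : |B.1 1 2 / (1 + √(1 - B.1 1 2 ^ 2))| < κ := by
    have hp : 0 < 1 + √(1 - B.1 1 2 ^ 2) := by linarith
    refine lt_of_le_of_lt ?_ hκ
    rw [abs_div, abs_of_pos hp, div_le_one hp]
    have : |B.1 1 2| ≤ 1 := abs_le_one_iff_mul_self_le_one.2 (by nlinarith)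
    linarith
  exact (((bounded_circ h1).mul (bounded_circ hκ0)).mul (bounded_circ h2)).mul (bounded_circ hκ0)

theorem rot_pi (k : ℝ) : (rot k Real.pi).1 =
    !![(k ^ 2 - 1) / (1 + k ^ 2), 0, 2 * k / (1 + k ^ 2); 0, -1, 0;
      2 * k / (1 + k ^ 2), 0, (1 - k ^ 2) / (1 + k ^ 2)] := by
  rw [rot_apply]
  simp
  refine ⟨⟨?_, ?_⟩, ?_, ?_⟩ <;> ring

theorem rot_zero_apply (θ : ℝ) : (rot 0 θ).1 =
    !![Real.cos θ, -Real.sin θ, 0; Real.sin θ, Real.cos θ, 0; 0, 0, 1] := by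
  rw [rot_apply]
  simp

theorem detour_last {B : SO3} (hB : B ∈ near) : (detour B).last = B := by
  obtain ⟨h11, h22⟩ := hB
  have hpi := Real.pi_pos
  have hcol := col_dot B 2 2
  have hrow := row_dot B 1 1
  rw [if_pos rfl] at hcol hrow
  set α := Real.arctan (B.1 1 0 / B.1 1 1) with hα
  set d := √(1 - B.1 1 2 ^ 2) with hd
  have hpos : 0 < 1 - B.1 1 2 ^ 2 := by nlinarith
  have hd0 : 0 < d := Real.sqrt_pos.2 hpos
  have hd2 : d ^ 2 = 1 - B.1 1 2 ^ 2 := Real.sq_sqrt hpos.le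
  have hs : √(1 + (B.1 1 0 / B.1 1 1) ^ 2) = d / B.1 1 1 := by
    rw [← Real.sqrt_sq (div_pos hd0 h11).le, div_pow, div_pow, hd2]
    congr 1
    field_simp
    linarith
  have hca : Real.cos α = B.1 1 1 / d := by
    rw [hα, Real.cos_arctan, hs]
    field_simp
  have hsa : Real.sin α = B.1 1 0 / d := by
    rw [hα, Real.sin_arctan, hs]
    field_simp
  have hα0 : 0 ≤ Real.pi / 2 + α := by linarith [Real.neg_pi_div_two_lt_arctan (B.1 1 0 / B.1 1 1)]
  have c32 : Real.cos (3 * Real.pi / 2) = 0 := by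
    rw [show 3 * Real.pi / 2 = Real.pi / 2 + Real.pi by ring, Real.cos_add_pi,
      Real.cos_pi_div_two, neg_zero]
  have s32 : Real.sin (3 * Real.pi / 2) = -1 := by
    rw [show 3 * Real.pi / 2 = Real.pi / 2 + Real.pi by ring, Real.sin_add_pi,
      Real.sin_pi_div_two]
  have ca : Real.cos (Real.pi / 2 + α) = -(B.1 1 0 / d) := by
    rw [add_comm, Real.cos_add_pi_div_two, hsa]
  have sa : Real.sin (Real.pi / 2 + α) = B.1 1 1 / d := by
    rw [add_comm, Real.sin_add_pi_div_two, hca]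
  set k := B.1 0 2 / (d + B.1 2 2) with hk
  set l := B.1 1 2 / (1 + d) with hl
  have hdB : 0 < d + B.1 2 2 := by linarith
  have hd1 : 0 < 1 + d := by linarith
  -- The half-angle formulas for the two Tait-Bryan angles.
  have hk2 : 1 + k ^ 2 = 2 * d / (d + B.1 2 2) := by
    rw [hk]; field_simp; linear_combination hcol - hd2
  have k1 : (1 - k ^ 2) / (1 + k ^ 2) = B.1 2 2 / d := by
    rw [show 1 - k ^ 2 = 2 - (1 + k ^ 2) by ring, hk2]; field_simp; ring
  have k2 : (k ^ 2 - 1) / (1 + k ^ 2) = -(B.1 2 2 / d) := by rw [← k1]; ring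
  have k3 : 2 * k / (1 + k ^ 2) = B.1 0 2 / d := by rw [hk2, hk]; field_simp
  have hl2 : 1 + l ^ 2 = 2 / (1 + d) := by
    rw [hl]; field_simp; linear_combination hd2
  have l1 : (1 - l ^ 2) / (1 + l ^ 2) = d := by
    rw [show 1 - l ^ 2 = 2 - (1 + l ^ 2) by ring, hl2]; field_simp; ring
  have l2 : (l ^ 2 - 1) / (1 + l ^ 2) = -d := by rw [← l1]; ring
  have l3 : 2 * l / (1 + l ^ 2) = B.1 1 2 := by rw [hl2, hl]; field_simp
  have hdet : (detour B).last = rot k Real.pi * rot 0 (3 * Real.pi / 2) * rot l Real.pi *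
      rot 0 (Real.pi / 2 + α) := by
    simp only [detour, mul_last]
    rw [circ_last hpi.le, circ_last hpi.le, circ_last (by positivity), circ_last hα0]
  have f00 := cofactor B 0 0
  have f01 := cofactor B 0 1
  have f20 := cofactor B 2 0
  have f21 := cofactor B 2 1
  rw [Matrix.adjugate_fin_three] at f00 f01 f20 f21
  simp at f00 f01 f20 f21
  have hprod : ∀ i j, (detour B).last.1 i j =
      !![(B.1 1 1 * B.1 2 2 - B.1 0 2 * B.1 1 2 * B.1 1 0) / d ^ 2,
          (-(B.1 1 0 * B.1 2 2) - B.1 0 2 * B.1 1 2 * B.1 1 1) / d ^ 2, B.1 0 2;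
        B.1 1 0, B.1 1 1, B.1 1 2;
        (-(B.1 0 2 * B.1 1 1) - B.1 2 2 * B.1 1 2 * B.1 1 0) / d ^ 2,
          (B.1 0 2 * B.1 1 0 - B.1 2 2 * B.1 1 2 * B.1 1 1) / d ^ 2, B.1 2 2] i j := by
    intro i j
    rw [hdet]
    simp only [SO3.mul_apply, rot_pi, rot_zero_apply, c32, s32, ca, sa, k1, k2, k3, l1, l2, l3]
    fin_cases i <;> fin_cases j <;> simp <;> field_simp <;> ring
  refine SO3.ext' fun i j => ?_
  rw [hprod]
  fin_cases i <;> fin_cases j <;> simp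
  · rw [div_eq_iff (by positivity), hd2]
    linear_combination -f00 + B.1 1 2 * f21
  · rw [div_eq_iff (by positivity), hd2]
    linear_combination -f01 - B.1 1 2 * f20
  · rw [div_eq_iff (by positivity), hd2]
    linear_combination -f20 - B.1 1 2 * f01
  · rw [div_eq_iff (by positivity), hd2]
    linear_combination -f21 + B.1 1 2 * f00

end Arc

/-! ### Kinks of great circle arcs -/

namespace Arc

/-- The slope of the two outer arcs of a kink. It is so large that the axis of the middle arc never
becomes perpendicular to the normal vector. -/
def kinkSlope (ε : ℝ) : ℝ := 3 / Real.sin (ε / 2)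

/-- The quaternion `1 * w + i * x + k * z` of the middle arc of a kink has
`w = kinkRe`, `z = kinkZ` and `x = -kinkX`. -/
def kinkRe (ε a : ℝ) : ℝ :=
  Real.cos (ε / 2) * Real.cos a + Real.sin (ε / 2) * Real.sin a / slope (kinkSlope ε)

/-- The vector part of the quaternion of the middle arc is `sin (ε / 2)` times the vertical unit
vector minus `kinkM` times the unit vector on the axis of the outer arcs. -/
def kinkM (ε a : ℝ) : ℝ :=
  Real.cos (ε / 2) * Real.sin a
    + Real.sin (ε / 2) * (1 - Real.cos a) / slope (kinkSlope ε)

def kinkX (ε a : ℝ) : ℝ := kinkSlope ε / slope (kinkSlope ε) * kinkM ε a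

def kinkZ (ε a : ℝ) : ℝ := Real.sin (ε / 2) - kinkM ε a / slope (kinkSlope ε)

theorem kinkZ_pos {ε : ℝ} (h : 0 < Real.sin (ε / 2)) (a : ℝ) : 0 < kinkZ ε a := by
  set S := Real.sin (ε / 2) with hS
  set w := slope (kinkSlope ε) with hw
  have hw0 : 0 < w := slope_pos _
  have hS1 : S ≤ 1 := Real.sin_le_one _
  have hk : 3 / S ≤ w := Real.le_sqrt_of_sq_le (by rw [kinkSlope]; linarith)
  have hw3 : 3 ≤ w := le_trans (by rw [le_div_iff₀ h]; linarith) hk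
  have h1 : Real.cos (ε / 2) * Real.sin a ≤ 1 := by
    have := abs_mul (Real.cos (ε / 2)) (Real.sin a)
    have h2 := mul_le_mul (Real.abs_cos_le_one (ε / 2)) (Real.abs_sin_le_one a) (abs_nonneg _)
      zero_le_one
    linarith [le_abs_self (Real.cos (ε / 2) * Real.sin a)]
  have h2 : S * (1 - Real.cos a) / w ≤ 2 / 3 := by
    rw [div_le_div_iff₀ hw0 (by norm_num)]
    nlinarith [Real.neg_one_le_cos a, Real.cos_le_one a]
  have h3 : kinkM ε a ≤ 5 / 3 := by
    rw [kinkM]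
    linarith
  rw [kinkZ, sub_pos, div_lt_iff₀ hw0]
  have := (div_le_iff₀ h).1 hk
  linarith

theorem kink_norm {ε : ℝ} (a : ℝ) : kinkRe ε a ^ 2 + kinkX ε a ^ 2 + kinkZ ε a ^ 2 = 1 := by
  have hw0 := (slope_pos (kinkSlope ε)).ne'
  have h1 := Real.sin_sq_add_cos_sq (ε / 2)
  have h2 := Real.sin_sq_add_cos_sq a
  have h3 : (kinkSlope ε / slope (kinkSlope ε)) ^ 2 + (1 / slope (kinkSlope ε)) ^ 2 = 1 := by
    field_simp
    rw [slope_sq]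
    ring
  have e1 : kinkRe ε a = Real.cos (ε / 2) * Real.cos a
      + Real.sin (ε / 2) * Real.sin a * (1 / slope (kinkSlope ε)) := by rw [kinkRe]; ring
  have e2 : kinkM ε a = Real.cos (ε / 2) * Real.sin a
      + Real.sin (ε / 2) * (1 - Real.cos a) * (1 / slope (kinkSlope ε)) := by rw [kinkM]; ring
  rw [kinkX, kinkZ, div_eq_mul_one_div (kinkM ε a), e1, e2]
  generalize kinkSlope ε / slope (kinkSlope ε) = x at *
  generalize 1 / slope (kinkSlope ε) = z at *
  generalize Real.sin (ε / 2) = S at *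
  generalize Real.cos (ε / 2) = C at *
  generalize Real.sin a = s at *
  generalize Real.cos a = c at *
  linear_combination (C * s + S * (1 - c) * z) ^ 2 * h3 + h1 + (C ^ 2 + S ^ 2 * z ^ 2) * h2

/-- A family of arcs with the final frame of a great circle arc of length `ε`. For `a = 0` it is
this great circle arc, for `a = 2π` it has one small circle at each end. -/
def kink (ε a : ℝ) : Arc :=
  circ (kinkSlope ε) a * circ (-kinkX ε a / kinkZ ε a) (2 * Real.arccos (kinkRe ε a)) *
    circ (kinkSlope ε) a

theorem kink_last {ε a : ℝ} (hε : 0 < Real.sin (ε / 2)) (ha : 0 ≤ a) :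
    (kink ε a).last = rot 0 ε := by
  have hz := kinkZ_pos hε a
  have hn := kink_norm (ε := ε) a
  have hb : 0 ≤ 2 * Real.arccos (kinkRe ε a) := by
    have := Real.arccos_nonneg (kinkRe ε a)
    linarith
  rw [kink, mul_last, mul_last, circ_last ha, circ_last hb]
  have hw1 : -1 ≤ kinkRe ε a := by nlinarith [sq_nonneg (kinkX ε a), sq_nonneg (kinkZ ε a)]
  have hw2 : kinkRe ε a ≤ 1 := by nlinarith [sq_nonneg (kinkX ε a), sq_nonneg (kinkZ ε a)]
  set r := √(1 - kinkRe ε a ^ 2) with hr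
  have hr2 : r ^ 2 = kinkX ε a ^ 2 + kinkZ ε a ^ 2 := by
    rw [hr, Real.sq_sqrt (by nlinarith)]; linarith
  have hr0 : 0 < r := Real.sqrt_pos.2 (by nlinarith [sq_nonneg (kinkX ε a), sq_pos_of_pos hz])
  have hs : slope (-kinkX ε a / kinkZ ε a) = r / kinkZ ε a := by
    rw [SO3.slope, ← Real.sqrt_sq (div_pos hr0 hz).le, div_pow, div_pow, hr2]
    congr 1
    field_simp
    ring
  have hmid : (rot (-kinkX ε a / kinkZ ε a) (2 * Real.arccos (kinkRe ε a))).1 =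
      quatMat (kinkRe ε a) (-kinkX ε a) 0 (kinkZ ε a) := by
    rw [rot_coe, mul_div_cancel_left₀ _ two_ne_zero, Real.cos_arccos hw1 hw2, Real.sin_arccos, hs,
      ← hr]
    congr 1 <;> field_simp
  refine Subtype.ext ?_
  change (rot _ _).1 * (rot _ _).1 * (rot _ _).1 = (rot _ _).1
  rw [hmid, rot_coe, rot_coe, quatMat_mul, quatMat_mul]
  have h1 := Real.sin_sq_add_cos_sq (a / 2)
  have h3 : (kinkSlope ε / slope (kinkSlope ε)) ^ 2 + (1 / slope (kinkSlope ε)) ^ 2 = 1 := by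
    have hw0 := (slope_pos (kinkSlope ε)).ne'
    field_simp
    rw [slope_sq]
    ring
  have hca : Real.cos a = Real.cos (a / 2) ^ 2 - Real.sin (a / 2) ^ 2 := by
    rw [← Real.cos_two_mul']; ring_nf
  have hsa : Real.sin a = 2 * Real.sin (a / 2) * Real.cos (a / 2) := by
    rw [← Real.sin_two_mul]; ring_nf
  have e1 : kinkRe ε a = Real.cos (ε / 2) * Real.cos a
      + Real.sin (ε / 2) * Real.sin a * (1 / slope (kinkSlope ε)) := by rw [kinkRe]; ring
  have e2 : kinkM ε a = Real.cos (ε / 2) * Real.sin a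
      + Real.sin (ε / 2) * (1 - Real.cos a) * (1 / slope (kinkSlope ε)) := by rw [kinkM]; ring
  rw [kinkX, kinkZ, div_eq_mul_one_div (kinkM ε a), e1, e2, hca, hsa]
  rw [slope_zero, zero_div, mul_zero, div_one, mul_one]
  generalize kinkSlope ε / slope (kinkSlope ε) = x at *
  generalize 1 / slope (kinkSlope ε) = z at *
  generalize Real.sin (ε / 2) = S at *
  generalize Real.cos (ε / 2) = C at *
  generalize Real.sin (a / 2) = s at *
  generalize Real.cos (a / 2) = c at *
  congr 1 <;> grind

theorem continuous_kink {X : Type*} [TopologicalSpace X] {ε a : X → ℝ} (hε : Continuous ε)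
    (ha : Continuous a) (h : ∀ x, 0 < Real.sin (ε x / 2)) :
    Continuous fun x => kink (ε x) (a x) := by
  have h1 : ∀ x, Real.sin (ε x / 2) ≠ 0 := fun x => (h x).ne'
  have h2 : ∀ k, slope k ≠ 0 := fun k => (slope_pos k).ne'
  have h3 : ∀ x, kinkZ (ε x) (a x) ≠ 0 := fun x => (kinkZ_pos (h x) _).ne'
  have c1 : Continuous fun x => kinkSlope (ε x) := by
    unfold kinkSlope
    fun_prop (disch := assumption)
  have c2 : Continuous fun x => kinkM (ε x) (a x) := by
    unfold kinkM
    fun_prop (disch := simp [h2])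
  have c3 : Continuous fun x => kinkZ (ε x) (a x) := by
    unfold kinkZ
    fun_prop (disch := simp [h2])
  have c4 : Continuous fun x => kinkX (ε x) (a x) := by
    unfold kinkX
    fun_prop (disch := simp [h2])
  have c5 : Continuous fun x => kinkRe (ε x) (a x) := by
    unfold kinkRe
    fun_prop (disch := simp [h2])
  unfold kink
  fun_prop (disch := assumption)

theorem kink_zero {ε : ℝ} (h0 : 0 ≤ ε) (h1 : ε ≤ 2 * Real.pi) : kink ε 0 = circ 0 ε := by
  have hb : Real.arccos (Real.cos (ε / 2)) = ε / 2 :=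
    Real.arccos_cos (by linarith) (by linarith)
  rw [kink, circ_zero_angle, one_mul, mul_one]
  simp [kinkX, kinkM, kinkRe, hb, mul_div_cancel₀]

theorem kink_two_pi {ε : ℝ} (h0 : 0 ≤ ε) (h1 : ε ≤ 2 * Real.pi) :
    kink ε (2 * Real.pi) =
      circ (kinkSlope ε) (2 * Real.pi) * circ 0 ε * circ (kinkSlope ε) (2 * Real.pi) := by
  have hb : Real.arccos (Real.cos (ε / 2)) = ε / 2 :=
    Real.arccos_cos (by linarith) (by linarith)
  rw [kink]
  simp [kinkX, kinkM, kinkRe, hb, mul_div_cancel₀]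

end Arc

/-! ### Deformations of families of arcs -/

namespace Arc

/-- The arcs of positive length with final frame `Q`. -/
def arcsTo (Q : SO3) : Set Arc := {A | 0 < A.len ∧ A.last = Q}

/-- The arcs of positive length with final frame `Q` and curvature strictly between `-κ` and
`κ`. -/
def boundedArcsTo (κ : ℝ) (Q : SO3) : Set Arc := {A | A ∈ arcsTo Q ∧ A.Bounded κ}

/-- Two continuous families of arcs in `P` are joined by a homotopy within `P`. -/
def Deform {K : Type*} [TopologicalSpace K] (P : Set Arc) (F G : K → Arc) : Prop :=
  ∃ H : K × unitInterval → Arc, Continuous H ∧ (∀ p, H p ∈ P) ∧ (∀ x, H (x, 0) = F x) ∧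
    ∀ x, H (x, 1) = G x

section Deform

variable {K : Type*} [TopologicalSpace K] {P : Set Arc} {F G E : K → Arc}

theorem deform_iff : Deform P F G ↔ ∃ f g : C(K, P), f.Homotopic g ∧ (∀ x, (f x : Arc) = F x) ∧
    ∀ x, (g x : Arc) = G x := by
  constructor
  · rintro ⟨H, hc, hP, h0, h1⟩
    refine ⟨⟨fun x => ⟨H (x, 0), hP _⟩, by fun_prop⟩, ⟨fun x => ⟨H (x, 1), hP _⟩, by fun_prop⟩,
      ⟨⟨⟨fun p => ⟨H (p.2, p.1), hP _⟩, by fun_prop⟩, fun x => rfl, fun x => rfl⟩⟩, h0, h1⟩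
  · rintro ⟨f, g, ⟨h⟩, hf, hg⟩
    refine ⟨fun p => h (p.2, p.1), by fun_prop, fun p => Subtype.prop _, fun x => ?_, fun x => ?_⟩
    · rw [← hf]; simp
    · rw [← hg]; simp

theorem Deform.symm (h : Deform P F G) : Deform P G F := by
  obtain ⟨f, g, hfg, hf, hg⟩ := deform_iff.1 h
  exact deform_iff.2 ⟨g, f, hfg.symm, hg, hf⟩

theorem Deform.trans (h : Deform P F G) (h' : Deform P G E) : Deform P F E := by
  obtain ⟨f, g, hfg, hf, hg⟩ := deform_iff.1 h
  obtain ⟨g', e, hge, hg', he⟩ := deform_iff.1 h'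
  have : g = g' := ContinuousMap.ext fun x => Subtype.ext ((hg x).trans (hg' x).symm)
  subst this
  exact deform_iff.2 ⟨f, e, hfg.trans hge, hf, he⟩

theorem Deform.mono {P' : Set Arc} (hP : P ⊆ P') (h : Deform P F G) : Deform P' F G := by
  obtain ⟨H, hc, hH, h0, h1⟩ := h
  exact ⟨H, hc, fun p => hP (hH p), h0, h1⟩

theorem deform_refl (hF : Continuous F) (h : ∀ x, F x ∈ P) : Deform P F F :=
  ⟨fun p => F p.1, by fun_prop, fun p => h _, fun _ => rfl, fun _ => rfl⟩

end Deform

theorem boundedArcsTo_subset (κ : ℝ) (Q : SO3) : boundedArcsTo κ Q ⊆ arcsTo Q := fun _ h => h.1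

/-- The arc `A` with `k` great circles inserted at the arc length `t`. -/
def ins (A : Arc) (t : ℝ) (k : ℕ) : Arc := A.sub 0 t * loop ^ k * A.sub t A.len

section ins

variable {A : Arc} {t : ℝ}

theorem ins_last (h0 : 0 ≤ t) (h1 : t ≤ A.len) (k : ℕ) : (A.ins t k).last = A.last := by
  rw [ins, mul_last, mul_last, loop_pow_last, mul_one, sub_last _ h0, sub_last _ h1, frame_zero,
    inv_one, one_mul, mul_inv_cancel_left]
  rfl

theorem ins_len (h0 : 0 ≤ t) (h1 : t ≤ A.len) (k : ℕ) :
    (A.ins t k).len = A.len + 2 * Real.pi * k := by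
  rw [ins, mul_len, mul_len, loop_pow_len, sub_len _ h0, sub_len _ h1]
  ring

theorem Bounded.ins {κ : ℝ} (hκ : 0 < κ) (hA : A.Bounded κ) (t : ℝ) (k : ℕ) :
    (A.ins t k).Bounded κ :=
  ((hA.sub hκ _ _).mul ((bounded_loop hκ).pow hκ k)).mul (hA.sub hκ _ _)

theorem ins_mem_arcsTo {Q : SO3} (hA : A ∈ arcsTo Q) (h0 : 0 ≤ t) (h1 : t ≤ A.len) (k : ℕ) :
    A.ins t k ∈ arcsTo Q := by
  refine ⟨?_, (ins_last h0 h1 k).trans hA.2⟩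
  rw [ins_len h0 h1]
  have := hA.1
  positivity

theorem ins_mem_boundedArcsTo {κ : ℝ} {Q : SO3} (hκ : 0 < κ) (hA : A ∈ boundedArcsTo κ Q)
    (h0 : 0 ≤ t) (h1 : t ≤ A.len) (k : ℕ) : A.ins t k ∈ boundedArcsTo κ Q :=
  ⟨ins_mem_arcsTo hA.1 h0 h1 k, hA.2.ins hκ t k⟩

@[fun_prop] theorem continuous_ins {X : Type*} [TopologicalSpace X] {F : X → Arc} {t : X → ℝ}
    (hF : Continuous F) (ht : Continuous t) (k : ℕ) : Continuous fun x => (F x).ins (t x) k := by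
  unfold ins; fun_prop

end ins

/-- One great circle can be deformed into three within curvature less than `κ`, if `κ > 1`. -/
theorem deform_ins_add_two {K : Type*} [TopologicalSpace K] {κ : ℝ} (hκ : 1 < κ) {Q : SO3}
    {F : K → Arc} {t : K → ℝ} (hF : Continuous F) (ht : Continuous t)
    (hFQ : ∀ x, F x ∈ boundedArcsTo κ Q) (h0 : ∀ x, 0 ≤ t x) (h1 : ∀ x, t x ≤ (F x).len)
    {k : ℕ} (hk : 1 ≤ k) :
    Deform (boundedArcsTo κ Q) (fun x => (F x).ins (t x) k)
      (fun x => (F x).ins (t x) (k + 2)) := by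
  have hκ0 : 0 < κ := by linarith
  obtain ⟨k, rfl⟩ := Nat.exists_eq_add_of_le' hk
  refine ⟨fun p => (F p.1).sub 0 (t p.1) * (fourArcs (Real.pi / 2 + p.2 * Real.pi) * loop ^ k) *
    (F p.1).sub (t p.1) (F p.1).len, by fun_prop, fun p => ⟨⟨?_, ?_⟩, ?_⟩, fun x => ?_, fun x => ?_⟩
  · have h2 := (fourArcs (Real.pi / 2 + p.2 * Real.pi)).len_nonneg
    have h3 := (loop ^ k).len_nonneg
    have h4 := (hFQ p.1).1.1
    rw [mul_len, mul_len, mul_len, sub_len _ (h0 _), sub_len _ (h1 _)]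
    linarith
  · have hmem : Real.pi / 2 + p.2 * Real.pi ∈ Set.Icc (Real.pi / 2) (Real.pi / 2 + Real.pi) :=
      ⟨by nlinarith [p.2.2.1, Real.pi_pos], by nlinarith [p.2.2.2, Real.pi_pos]⟩
    have := ins_last (h0 p.1) (h1 p.1) 0
    rw [ins, pow_zero, mul_one, (hFQ p.1).1.2] at this
    rw [mul_last, mul_last, mul_last, fourArcs_last hmem, loop_pow_last, mul_one, mul_one,
      ← mul_last, this]
  · exact (((hFQ p.1).2.sub hκ0 _ _).mul ((bounded_fourArcs hκ _).mul
      ((bounded_loop hκ0).pow hκ0 k))).mul ((hFQ p.1).2.sub hκ0 _ _)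
  · simp only [Set.Icc.coe_zero, zero_mul, add_zero, fourArcs_left, ← pow_succ', ins]
  · simp only [Set.Icc.coe_one, one_mul, fourArcs_right, ← pow_add, ins]
    rw [show 3 + k = k + 1 + 2 by ring]

theorem deform_ins_add_even {K : Type*} [TopologicalSpace K] {κ : ℝ} (hκ : 1 < κ) {Q : SO3}
    {F : K → Arc} {t : K → ℝ} (hF : Continuous F) (ht : Continuous t)
    (hFQ : ∀ x, F x ∈ boundedArcsTo κ Q) (h0 : ∀ x, 0 ≤ t x) (h1 : ∀ x, t x ≤ (F x).len)
    {k : ℕ} (hk : 1 ≤ k) (m : ℕ) :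
    Deform (boundedArcsTo κ Q) (fun x => (F x).ins (t x) k)
      (fun x => (F x).ins (t x) (k + 2 * m)) := by
  induction m with
  | zero =>
    refine deform_refl (by fun_prop) fun x => ?_
    exact ins_mem_boundedArcsTo (by linarith) (hFQ x) (h0 x) (h1 x) k
  | succ m ih => exact ih.trans (deform_ins_add_two hκ hF ht hFQ h0 h1 (by omega))

/-! ### Replacing a curve by a chain of detours -/

/-- The concatenation of the arcs `f 0, …, f (N - 1)`. -/
def chain (N : ℕ) (f : ℕ → Arc) : Arc := ((List.range N).map f).prod

theorem chain_succ (N : ℕ) (f : ℕ → Arc) : chain (N + 1) f = chain N f * f N :=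
  List.prod_range_succ f N

theorem chain_congr {N : ℕ} {f g : ℕ → Arc} (h : ∀ j < N, f j = g j) : chain N f = chain N g := by
  unfold chain
  congr 1
  exact List.map_congr_left fun j hj => h j (List.mem_range.1 hj)

theorem continuous_chain {X : Type*} [TopologicalSpace X] {N : ℕ} {f : X → ℕ → Arc}
    (h : ∀ j < N, Continuous fun x => f x j) : Continuous fun x => chain N (f x) :=
  continuous_list_prod _ fun j hj => h j (List.mem_range.1 hj)

theorem bounded_chain {κ : ℝ} (hκ : 0 < κ) {N : ℕ} {f : ℕ → Arc} (h : ∀ j < N, (f j).Bounded κ) :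
    (chain N f).Bounded κ := by
  refine bounded_list_prod hκ fun A hA => ?_
  obtain ⟨j, hj, rfl⟩ := List.mem_map.1 hA
  exact h j (List.mem_range.1 hj)

theorem chain_last {N : ℕ} {f : ℕ → Arc} {Γ : ℕ → SO3}
    (h : ∀ j < N, (f j).last = (Γ j)⁻¹ * Γ (j + 1)) : (chain N f).last = (Γ 0)⁻¹ * Γ N := by
  induction N with
  | zero => simp [chain]
  | succ N ih =>
    rw [chain_succ, mul_last, ih fun j hj => h j (by omega), h N (by omega)]
    group

theorem chain_len_pos {N : ℕ} (hN : 1 ≤ N) {f : ℕ → Arc} (h : ∀ j < N, 0 < (f j).len) :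
    0 < (chain N f).len := by
  obtain ⟨N, rfl⟩ := Nat.exists_eq_add_of_le' hN
  rw [chain_succ, mul_len]
  linarith [(chain N f).len_nonneg, h N (by omega)]

theorem chain_const (N : ℕ) (A : Arc) : (chain N fun _ => A) = A ^ N := by
  simp [chain]

theorem detour_len_pos (B : SO3) : 0 < (detour B).len := by
  rw [detour, mul_len, mul_len, mul_len, circ_len Real.pi_pos.le]
  have h1 := div_pos Real.pi_pos (slope_pos (B.1 0 2 / (√(1 - B.1 1 2 ^ 2) + B.1 2 2)))
  have h2 := (circ 0 (3 * Real.pi / 2)).len_nonneg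
  have h3 := (circ (B.1 1 2 / (1 + √(1 - B.1 1 2 ^ 2))) Real.pi).len_nonneg
  have h4 := (circ 0 (Real.pi / 2 + Real.arctan (B.1 1 0 / B.1 1 1))).len_nonneg
  linarith

/-- The frame of an arc, parametrized by `[0, 1]`. -/
def unitFrame (A : Arc) (s : ℝ) : SO3 := A.frame (A.len * s)

/-- `N` detours that interpolate the frame of an arc at the times `j / N`. -/
def detours (N : ℕ) (A : Arc) : Arc :=
  chain N fun j => detour ((A.unitFrame (j / N))⁻¹ * A.unitFrame ((j + 1 : ℕ) / N))

/-- The frame of `A` turns so little in time `1 / N` that detours can be used. -/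
def Fine (N : ℕ) (A : Arc) : Prop :=
  ∀ s ∈ Set.Icc (0 : ℝ) 1, ∀ s' ∈ Set.Icc (0 : ℝ) 1, |s - s'| ≤ 1 / N →
    (A.unitFrame s)⁻¹ * A.unitFrame s' ∈ near

theorem div_mem_unit {N j : ℕ} (hN : 1 ≤ N) (hj : j ≤ N) : (j / N : ℝ) ∈ Set.Icc (0 : ℝ) 1 := by
  have : (0 : ℝ) < N := by exact_mod_cast hN
  exact ⟨by positivity, (div_le_one this).2 (by exact_mod_cast hj)⟩

theorem Fine.near {N : ℕ} {A : Arc} (h : Fine N A) (hN : 1 ≤ N) {j : ℕ} (hj : j < N) {s : ℝ}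
    (hs : s ∈ Set.Icc (0 : ℝ) 1) :
    (A.unitFrame ((j + s) / N))⁻¹ * A.unitFrame ((j + 1 : ℕ) / N) ∈ near := by
  have hN0 : (0 : ℝ) < N := by exact_mod_cast hN
  have hj' : (j : ℝ) + 1 ≤ N := by exact_mod_cast hj
  have hj0 : (0 : ℝ) ≤ j := Nat.cast_nonneg j
  refine h _ ⟨div_nonneg (by linarith [hs.1]) hN0.le, (div_le_one hN0).2 (by linarith [hs.2])⟩ _
    (div_mem_unit hN hj) ?_
  rw [← sub_div, abs_div, abs_of_pos hN0]
  refine div_le_div_of_nonneg_right ?_ hN0.le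
  push_cast
  rw [abs_le]
  constructor <;> linarith [hs.1, hs.2]

theorem Fine.near_zero {N : ℕ} {A : Arc} (h : Fine N A) (hN : 1 ≤ N) {j : ℕ} (hj : j < N) :
    (A.unitFrame (j / N))⁻¹ * A.unitFrame ((j + 1 : ℕ) / N) ∈ Arc.near := by
  have := h.near hN hj (s := 0) ⟨le_rfl, zero_le_one⟩
  rwa [add_zero] at this

theorem unitFrame_zero (A : Arc) : A.unitFrame 0 = 1 := by
  rw [unitFrame, mul_zero, frame_zero]

theorem unitFrame_one (A : Arc) : A.unitFrame 1 = A.last := by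
  rw [unitFrame, mul_one]; rfl

theorem detours_mem {κ : ℝ} (hκ : 1 < κ) {Q : SO3} {A : Arc} (hA : A.last = Q) {N : ℕ}
    (hN : 1 ≤ N) (hf : Fine N A) : detours N A ∈ boundedArcsTo κ Q := by
  have hN0 : (N : ℝ) ≠ 0 := by positivity
  refine ⟨⟨chain_len_pos hN fun j _ => detour_len_pos _, ?_⟩,
    bounded_chain (by linarith) fun j hj => bounded_detour hκ (hf.near_zero hN hj)⟩
  have := chain_last (N := N) (Γ := fun j => A.unitFrame (j / N))
    (f := fun j => detour ((A.unitFrame (j / N))⁻¹ * A.unitFrame ((j + 1 : ℕ) / N)))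
    fun j hj => detour_last (hf.near_zero hN hj)
  rw [detours, this, Nat.cast_zero, zero_div, div_self hN0, unitFrame_zero, unitFrame_one, inv_one,
    one_mul, hA]

theorem continuous_detours {X : Type*} [TopologicalSpace X] {F : X → Arc} (hF : Continuous F)
    {N : ℕ} (hN : 1 ≤ N) (h : ∀ x, Fine N (F x)) : Continuous fun x => detours N (F x) := by
  refine continuous_chain fun j hj => continuous_detour ?_ fun x => (h x).near_zero hN hj
  unfold unitFrame
  fun_prop

/-- For a compact family of arcs, all sufficiently large `N` are fine. -/
theorem exists_fine {X : Type*} [TopologicalSpace X] [CompactSpace X] {F : X → Arc}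
    (hF : Continuous F) : ∃ N₀ : ℕ, ∀ N ≥ N₀, 1 ≤ N → ∀ x, Fine N (F x) := by
  set g : X × unitInterval × unitInterval → SO3 := fun p =>
    ((F p.1).unitFrame p.2.1)⁻¹ * (F p.1).unitFrame p.2.2
  have hg : Continuous g := by
    unfold g unitFrame
    fun_prop
  have hclosed : IsClosed (g ⁻¹' nearᶜ) := isOpen_near.isClosed_compl.preimage hg
  set dd : X × unitInterval × unitInterval → ℝ := fun p => |(p.2.1 : ℝ) - p.2.2|
  have hdd : Continuous dd := by unfold dd; fun_prop
  obtain ⟨δ, hδ, hδ'⟩ : ∃ δ > 0, ∀ p, g p ∉ near → δ ≤ dd p := by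
    rcases (g ⁻¹' nearᶜ).eq_empty_or_nonempty with he | hne
    · refine ⟨1, one_pos, fun p hp => ?_⟩
      have : p ∈ g ⁻¹' nearᶜ := hp
      rw [he] at this
      exact this.elim
    · obtain ⟨p, hp, hmin⟩ := hclosed.isCompact.exists_isMinOn hne hdd.continuousOn
      refine ⟨dd p, ?_, fun q hq => hmin hq⟩
      refine lt_of_le_of_ne (abs_nonneg _) fun h0 => hp ?_
      have h1 : p.2.1 = p.2.2 := Subtype.ext (sub_eq_zero.1 (abs_eq_zero.1 h0.symm))
      have h2 : g p = 1 := by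
        simp only [g, h1, inv_mul_cancel]
      rw [h2]
      exact one_mem_near
  obtain ⟨N₀, hN₀⟩ := exists_nat_gt (1 / δ)
  refine ⟨N₀, fun N hN hN1 x s hs s' hs' hss => ?_⟩
  by_contra hcon
  have h1 := hδ' (x, ⟨s, hs⟩, ⟨s', hs'⟩) hcon
  have hN0 : (0 : ℝ) < N := by exact_mod_cast hN1
  have h2 : 1 / δ < N := hN₀.trans_le (by exact_mod_cast hN)
  rw [div_lt_iff₀ hδ] at h2
  have h3 : δ ≤ 1 / N := h1.trans hss
  rw [le_div_iff₀ hN0] at h3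
  linarith

section Spread

variable {K : Type*} [TopologicalSpace K] {κ : ℝ} {Q : SO3} {F : K → Arc} {t : K → ℝ} {N : ℕ}

/-- The `2N` great circles inserted at one point are distributed along the curve. -/
theorem deform_spread (hκ : 1 < κ) (hF : Continuous F) (ht : Continuous t)
    (hFQ : ∀ x, F x ∈ boundedArcsTo κ Q) (h0 : ∀ x, 0 ≤ t x) (h1 : ∀ x, t x ≤ (F x).len)
    (hN : 1 ≤ N) :
    Deform (boundedArcsTo κ Q) (fun x => (F x).ins (t x) (2 * N))
      (fun x => chain N fun j =>
        (F x).sub ((F x).len * (j / N)) ((F x).len * ((j + 1 : ℕ) / N)) * loop ^ 2) := by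
  have hκ0 : 0 < κ := by linarith
  have hN0 : (0 : ℝ) < N := by exact_mod_cast hN
  -- The position of the `j`-th division point at time `τ`.
  set b : K × unitInterval → ℕ → ℝ := fun p j =>
    (1 - p.2) * t p.1 + p.2 * ((F p.1).len * (j / N)) with hb
  have hb0 : ∀ p j, 0 ≤ b p j := fun p j => by
    have := p.2.2.1
    have := p.2.2.2
    have := h0 p.1
    have := (F p.1).len_nonneg
    have h2 : 0 ≤ (1 - (p.2 : ℝ)) := by linarith
    simp only [hb]
    positivity
  have hb1 : ∀ p, b p N ≤ (F p.1).len := fun p => by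
    have := p.2.2.1
    have := p.2.2.2
    have := h1 p.1
    simp only [hb, div_self hN0.ne']
    nlinarith
  have hmono : ∀ p j, b p j ≤ b p (j + 1) := fun p j => by
    have := p.2.2.1
    have := (F p.1).len_nonneg
    have h2 : (j / N : ℝ) ≤ ((j + 1 : ℕ) : ℝ) / N :=
      div_le_div_of_nonneg_right (by push_cast; linarith) hN0.le
    simp only [hb]
    gcongr
  have hbc : ∀ j, Continuous fun p => b p j := fun j => by
    simp only [hb]
    fun_prop
  refine ⟨fun p => (F p.1).sub 0 (b p 0) *
      (chain N fun j => (F p.1).sub (b p j) (b p (j + 1)) * loop ^ 2) *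
      (F p.1).sub (b p N) (F p.1).len, ?_, fun p => ⟨⟨?_, ?_⟩, ?_⟩, fun x => ?_, fun x => ?_⟩
  · have hch : Continuous fun p : K × unitInterval =>
        chain N fun j => (F p.1).sub (b p j) (b p (j + 1)) * loop ^ 2 :=
      continuous_chain fun j _ => by
        have := hbc j
        have := hbc (j + 1)
        fun_prop
    have := hbc 0
    have := hbc N
    fun_prop
  · have hch : 0 < (chain N fun j => (F p.1).sub (b p j) (b p (j + 1)) * loop ^ 2).len :=
      chain_len_pos hN fun j _ => by
        rw [mul_len, loop_pow_len]
        have := ((F p.1).sub (b p j) (b p (j + 1))).len_nonneg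
        have := Real.pi_pos
        positivity
    rw [mul_len, mul_len]
    linarith [((F p.1).sub 0 (b p 0)).len_nonneg, ((F p.1).sub (b p N) (F p.1).len).len_nonneg]
  · have := chain_last (N := N) (Γ := fun j => (F p.1).frame (b p j))
      (f := fun j => (F p.1).sub (b p j) (b p (j + 1)) * loop ^ 2) fun j _ => by
        rw [mul_last, loop_pow_last, mul_one, sub_last _ (hmono p j)]
    rw [mul_last, mul_last, this, sub_last _ (hb0 p 0), sub_last _ (hb1 p), frame_zero, inv_one,
      one_mul, mul_inv_cancel_left, mul_inv_cancel_left]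
    exact (hFQ p.1).1.2
  · exact (((hFQ p.1).2.sub hκ0 _ _).mul (bounded_chain hκ0 fun j _ =>
      ((hFQ p.1).2.sub hκ0 _ _).mul ((bounded_loop hκ0).pow hκ0 2))).mul ((hFQ p.1).2.sub hκ0 _ _)
  · simp only [hb, Set.Icc.coe_zero, sub_zero, one_mul, zero_mul, add_zero, sub_self, chain_const,
      ← pow_mul, ins]
  · simp only [hb, Set.Icc.coe_one, sub_self, one_mul, zero_mul, zero_add, Nat.cast_zero, zero_div,
      mul_zero, div_self hN0.ne', mul_one, _root_.sub_self]

/-- A piece of the curve followed by two great circles is replaced by a detour: the piece is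
shortened to a point, and the detour makes up for the difference. -/
theorem deform_detours (hκ : 1 < κ) (hF : Continuous F) (hFQ : ∀ x, F x ∈ boundedArcsTo κ Q)
    (hN : 1 ≤ N) (hf : ∀ x, Fine N (F x)) :
    Deform (boundedArcsTo κ Q) (fun x => detours N (F x))
      (fun x => chain N fun j =>
        (F x).sub ((F x).len * (j / N)) ((F x).len * ((j + 1 : ℕ) / N)) * loop ^ 2) := by
  have hκ0 : 0 < κ := by linarith
  have hN0 : (0 : ℝ) < N := by exact_mod_cast hN
  have hle : ∀ (p : K × unitInterval) (j : ℕ),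
      (F p.1).len * (j / N) ≤ (F p.1).len * ((j + p.2) / N) := fun p j => by
    have := (F p.1).len_nonneg
    have := p.2.2.1
    gcongr
    linarith
  refine ⟨fun p => chain N fun j =>
      (F p.1).sub ((F p.1).len * (j / N)) ((F p.1).len * ((j + p.2) / N)) *
        detour (((F p.1).unitFrame ((j + p.2) / N))⁻¹ * (F p.1).unitFrame ((j + 1 : ℕ) / N)),
      ?_, fun p => ⟨⟨?_, ?_⟩, ?_⟩, fun x => ?_, fun x => ?_⟩
  · refine continuous_chain fun j hj => ?_
    have : Continuous fun p : K × unitInterval => detour (((F p.1).unitFrame ((j + p.2) / N))⁻¹ *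
        (F p.1).unitFrame ((j + 1 : ℕ) / N)) :=
      continuous_detour (by unfold unitFrame; fun_prop) fun p => (hf p.1).near hN hj p.2.2
    fun_prop
  · refine chain_len_pos hN fun j _ => ?_
    rw [mul_len]
    have := ((F p.1).sub ((F p.1).len * (j / N)) ((F p.1).len * ((j + p.2) / N))).len_nonneg
    linarith [detour_len_pos (((F p.1).unitFrame ((j + p.2) / N))⁻¹ *
        (F p.1).unitFrame ((j + 1 : ℕ) / N))]
  · refine (chain_last (Γ := fun j => (F p.1).unitFrame (j / N)) fun j hj => ?_).trans ?_
    · rw [mul_last, sub_last _ (hle p j), detour_last ((hf p.1).near hN hj p.2.2)]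
      simp only [unitFrame]
      group
    · simp only [Nat.cast_zero, zero_div, div_self hN0.ne', unitFrame_zero, unitFrame_one, inv_one,
        one_mul]
      exact (hFQ p.1).1.2
  · exact bounded_chain hκ0 fun j hj => ((hFQ p.1).2.sub hκ0 _ _).mul
      (bounded_detour hκ ((hf p.1).near hN hj p.2.2))
  · simp [detours]
  · refine chain_congr fun j _ => ?_
    simp only [Set.Icc.coe_one, Nat.cast_add, Nat.cast_one, inv_mul_cancel, detour_one]

end Spread

end Arc

/-! ### Frames and arc length of regular curves -/

/-- The squared norm of a vector. -/
def normSq3 (P : Fin 3 → ℝ) : ℝ := P 0 ^ 2 + P 1 ^ 2 + P 2 ^ 2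

/-- The scalar product of two vectors. -/
def dot3 (P D : Fin 3 → ℝ) : ℝ := P 0 * D 0 + P 1 * D 1 + P 2 * D 2

/-- The squared norm of the vector product of two vectors. -/
def gram (P D : Fin 3 → ℝ) : ℝ := normSq3 P * normSq3 D - dot3 P D ^ 2

theorem gram_eq (P D : Fin 3 → ℝ) : gram P D = (P 1 * D 2 - P 2 * D 1) ^ 2 +
    (P 2 * D 0 - P 0 * D 2) ^ 2 + (P 0 * D 1 - P 1 * D 0) ^ 2 := by
  unfold gram normSq3 dot3; ring

theorem normSq3_pos_of_gram {P D : Fin 3 → ℝ} (h : 0 < gram P D) : 0 < normSq3 P := by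
  have h0 : 0 ≤ normSq3 P := by unfold normSq3; positivity
  rcases h0.eq_or_lt with h1 | h1
  · rw [gram, ← h1, zero_mul] at h
    nlinarith [sq_nonneg (dot3 P D)]
  · exact h1

/-- The unit tangent vector at `P / ‖P‖` of the central projection to the sphere of a curve which
passes through `P` with velocity `D`. -/
def dirVec (P D : Fin 3 → ℝ) (i : Fin 3) : ℝ :=
  (normSq3 P * D i - dot3 P D * P i) / (√(gram P D) * √(normSq3 P))

theorem dirVec_spec {P D : Fin 3 → ℝ} (h : 0 < gram P D) :
    normSq3 (fun i => P i / √(normSq3 P)) = 1 ∧ normSq3 (dirVec P D) = 1 ∧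
      dot3 (fun i => P i / √(normSq3 P)) (dirVec P D) = 0 := by
  have hs := normSq3_pos_of_gram h
  have a1 : √(normSq3 P) ≠ 0 := (Real.sqrt_pos.2 hs).ne'
  have a2 : √(gram P D) ≠ 0 := (Real.sqrt_pos.2 h).ne'
  have b1 := Real.sq_sqrt hs.le
  have b2 := Real.sq_sqrt h.le
  refine ⟨?_, ?_, ?_⟩
  · simp only [normSq3, div_pow] at *
    rw [b1]
    field_simp
  · have e : normSq3 (dirVec P D) =
        ((normSq3 P * D 0 - dot3 P D * P 0) ^ 2 + (normSq3 P * D 1 - dot3 P D * P 1) ^ 2 +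
          (normSq3 P * D 2 - dot3 P D * P 2) ^ 2) / (√(gram P D) ^ 2 * √(normSq3 P) ^ 2) := by
      rw [normSq3]
      simp only [dirVec]
      ring
    rw [e, b1, b2, div_eq_one_iff_eq (mul_pos h hs).ne']
    unfold gram normSq3 dot3
    ring
  · have e : dot3 (fun i => P i / √(normSq3 P)) (dirVec P D) =
        (normSq3 P * dot3 P D - dot3 P D * normSq3 P) /
          (√(gram P D) * √(normSq3 P) * √(normSq3 P)) := by
      unfold dot3
      simp only [dirVec]
      rw [show normSq3 P * (P 0 * D 0 + P 1 * D 1 + P 2 * D 2) -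
        (P 0 * D 0 + P 1 * D 1 + P 2 * D 2) * normSq3 P =
        P 0 * (normSq3 P * D 0 - dot3 P D * P 0) + P 1 * (normSq3 P * D 1 - dot3 P D * P 1) +
        P 2 * (normSq3 P * D 2 - dot3 P D * P 2) by unfold normSq3 dot3; ring]
      unfold dot3
      field_simp
    rw [e, mul_comm, sub_self, zero_div]

open Classical in
/-- The frame at `P / ‖P‖` of the central projection to the sphere of a curve which passes through
`P` with velocity `D`, where `P` and `D` are linearly independent. -/
def spatialFrame (P D : Fin 3 → ℝ) : SO3 :=
  if h : 0 < gram P D then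
    ⟨_, ofPair_mem (p := fun i => P i / √(normSq3 P)) (t := dirVec P D) (dirVec_spec h).1
      (dirVec_spec h).2.1 (dirVec_spec h).2.2⟩
  else 1

theorem spatialFrame_zero {P D : Fin 3 → ℝ} (h : 0 < gram P D) (i : Fin 3) :
    (spatialFrame P D).1 i 0 = P i / √(normSq3 P) := by
  rw [spatialFrame, dif_pos h]; rfl

theorem spatialFrame_one {P D : Fin 3 → ℝ} (h : 0 < gram P D) (i : Fin 3) :
    (spatialFrame P D).1 i 1 = dirVec P D i := by
  rw [spatialFrame, dif_pos h]; rfl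

theorem SO3.eq_of_cols {A B : SO3} (h0 : ∀ i, A.1 i 0 = B.1 i 0) (h1 : ∀ i, A.1 i 1 = B.1 i 1) :
    A = B := by
  obtain ⟨a0, a1, a2⟩ := third_col A
  obtain ⟨b0, b1, b2⟩ := third_col B
  refine SO3.ext' fun i j => ?_
  fin_cases j
  · exact h0 i
  · exact h1 i
  · fin_cases i
    · exact a0.trans (by rw [h0, h0, h1, h1, ← b0]; rfl)
    · exact a1.trans (by rw [h0, h0, h1, h1, ← b1]; rfl)
    · exact a2.trans (by rw [h0, h0, h1, h1, ← b2]; rfl)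

theorem SO3.continuous_of_cols {X : Type*} [TopologicalSpace X] {F : X → SO3}
    (h0 : ∀ i, Continuous fun x => (F x).1 i 0) (h1 : ∀ i, Continuous fun x => (F x).1 i 1) :
    Continuous F := by
  refine continuous_of_apply fun i j => ?_
  have a0 := h0 0
  have a1 := h0 1
  have a2 := h0 2
  have b0 := h1 0
  have b1 := h1 1
  have b2 := h1 2
  fin_cases j
  · exact h0 i
  · exact h1 i
  · fin_cases i
    · exact Continuous.congr (by fun_prop) fun x => ((third_col (F x)).1).symm
    · exact Continuous.congr (by fun_prop) fun x => ((third_col (F x)).2.1).symm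
    · exact Continuous.congr (by fun_prop) fun x => ((third_col (F x)).2.2).symm

theorem continuous_gram {X : Type*} [TopologicalSpace X] {P D : X → Fin 3 → ℝ}
    (hP : Continuous P) (hD : Continuous D) : Continuous fun x => gram (P x) (D x) := by
  unfold gram normSq3 dot3; fun_prop

theorem continuous_spatialFrame {X : Type*} [TopologicalSpace X] {P D : X → Fin 3 → ℝ}
    (hP : Continuous P) (hD : Continuous D) (h : ∀ x, 0 < gram (P x) (D x)) :
    Continuous fun x => spatialFrame (P x) (D x) := by
  have hg := continuous_gram hP hD
  have hn : Continuous fun x => normSq3 (P x) := by unfold normSq3; fun_prop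
  have hd : Continuous fun x => dot3 (P x) (D x) := by unfold dot3; fun_prop
  have h1 : ∀ x, √(normSq3 (P x)) ≠ 0 := fun x =>
    (Real.sqrt_pos.2 (normSq3_pos_of_gram (h x))).ne'
  have h2 : ∀ x, √(gram (P x) (D x)) * √(normSq3 (P x)) ≠ 0 := fun x =>
    mul_ne_zero (Real.sqrt_pos.2 (h x)).ne' (h1 x)
  refine continuous_of_cols (fun i => ?_) (fun i => ?_)
  · simp only [fun x => spatialFrame_zero (h x) i]
    fun_prop (disch := assumption)
  · simp only [fun x => spatialFrame_one (h x) i, dirVec]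
    fun_prop (disch := assumption)

/-- The speed of the central projection to the sphere of a curve which passes through `P` with
velocity `D`. -/
def projSpeed (P D : Fin 3 → ℝ) : ℝ := √(gram P D) / normSq3 P

theorem projSpeed_pos {P D : Fin 3 → ℝ} (h : 0 < gram P D) : 0 < projSpeed P D :=
  div_pos (Real.sqrt_pos.2 h) (normSq3_pos_of_gram h)

theorem continuous_projSpeed {X : Type*} [TopologicalSpace X] {P D : X → Fin 3 → ℝ}
    (hP : Continuous P) (hD : Continuous D) (h : ∀ x, 0 < gram (P x) (D x)) :
    Continuous fun x => projSpeed (P x) (D x) := by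
  have hg := continuous_gram hP hD
  have hn : Continuous fun x => normSq3 (P x) := by unfold normSq3; fun_prop
  exact (hg.sqrt).div hn fun x => (normSq3_pos_of_gram (h x)).ne'

theorem hasDerivAt_spatialFrame {P D : ℝ → Fin 3 → ℝ} (hd : ∀ σ i, HasDerivAt (P · i) (D σ i) σ)
    (h : ∀ σ, 0 < gram (P σ) (D σ)) (σ : ℝ) (i : Fin 3) :
    HasDerivAt (fun s => (spatialFrame (P s) (D s)).1 i 0)
      (projSpeed (P σ) (D σ) * (spatialFrame (P σ) (D σ)).1 i 1) σ := by
  have hs := normSq3_pos_of_gram (h σ)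
  have a1 : √(normSq3 (P σ)) ≠ 0 := (Real.sqrt_pos.2 hs).ne'
  have a2 : √(gram (P σ) (D σ)) ≠ 0 := (Real.sqrt_pos.2 (h σ)).ne'
  have b1 := Real.sq_sqrt hs.le
  have d1 : HasDerivAt (fun s => normSq3 (P s)) (2 * dot3 (P σ) (D σ)) σ := by
    have := (((hd σ 0).pow 2).add ((hd σ 1).pow 2)).add ((hd σ 2).pow 2)
    refine this.congr_deriv ?_
    unfold dot3
    simp
    ring
  have d2 := d1.sqrt hs.ne'
  have d3 := (hd σ i).div d2 a1
  simp only [fun s => spatialFrame_zero (h s) i, spatialFrame_one (h σ) i]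
  refine d3.congr_deriv ?_
  rw [projSpeed, dirVec]
  have b3 : normSq3 (P σ) = √(normSq3 (P σ)) ^ 2 := b1.symm
  generalize √(normSq3 (P σ)) = w at *
  rw [b3]
  field_simp

/-- A continuous family of positive speeds, each of them bounded below, has a continuous family of
arc length functions `V` with continuous inverse functions `Θ`. -/
theorem exists_arclength {X : Type*} [TopologicalSpace X] {v : X → ℝ → ℝ}
    (hv : Continuous fun p : X × ℝ => v p.1 p.2) (hpos : ∀ x, ∃ c > 0, ∀ σ, c ≤ v x σ) :
    ∃ V Θ : X → ℝ → ℝ, Continuous (fun p : X × ℝ => V p.1 p.2) ∧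
      Continuous (fun p : X × ℝ => Θ p.1 p.2) ∧ (∀ x, V x 0 = 0) ∧ (∀ x, StrictMono (V x)) ∧
      (∀ x s, V x (Θ x s) = s) ∧ (∀ x σ, Θ x (V x σ) = σ) ∧
      (∀ x s, HasDerivAt (Θ x) (v x (Θ x s))⁻¹ s) ∧
      ∀ x, (∀ σ, v x σ = 1) → ∀ σ, V x σ = σ := by
  set V : X → ℝ → ℝ := fun x σ => ∫ r in (0 : ℝ)..σ, v x r with hV
  have hvx : ∀ x, Continuous (v x) := fun x => by
    have := hv.comp (Continuous.prodMk_right x)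
    exact this
  have hV0 : ∀ x, V x 0 = 0 := fun x => intervalIntegral.integral_same
  have hVd : ∀ x σ, HasDerivAt (V x) (v x σ) σ := fun x σ =>
    intervalIntegral.integral_hasDerivAt_right ((hvx x).intervalIntegrable _ _)
      ((hvx x).stronglyMeasurableAtFilter _ _) (hvx x).continuousAt
  have hVc : Continuous fun p : X × ℝ => V p.1 p.2 := by
    have h := intervalIntegral.continuous_parametric_intervalIntegral_of_continuous
      (μ := MeasureTheory.volume) (a₀ := (0 : ℝ)) (f := fun (p : X × ℝ) r => v p.1 r)
      (hv.comp ((continuous_fst.comp continuous_fst).prodMk continuous_snd))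
      (s := fun p : X × ℝ => p.2) continuous_snd
    exact h
  have hmono : ∀ x, StrictMono (V x) := fun x => strictMono_of_deriv_pos fun σ => by
    obtain ⟨c, hc, hcv⟩ := hpos x
    rw [(hVd x σ).deriv]
    exact hc.trans_le (hcv σ)
  have hVxc : ∀ x, Continuous (V x) := fun x =>
    continuous_iff_continuousAt.2 fun σ => (hVd x σ).continuousAt
  have hsurj : ∀ x, Function.Surjective (V x) := fun x => by
    obtain ⟨c, hc, hcv⟩ := hpos x
    have hle : ∀ a b, a ≤ b → c * (b - a) ≤ V x b - V x a := fun a b hab =>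
      mul_sub_le_image_sub_of_le_deriv (fun σ => (hVd x σ).differentiableAt)
        (fun σ => by rw [(hVd x σ).deriv]; exact hcv σ) hab
    refine (hVxc x).surjective ?_ ?_
    · refine Filter.tendsto_atTop_mono' _ ?_ (Filter.tendsto_id.const_mul_atTop hc)
      filter_upwards [Filter.eventually_ge_atTop 0] with σ hσ
      have := hle 0 σ hσ
      rw [hV0] at this
      simpa using this
    · refine Filter.tendsto_atBot_mono' _ ?_ (Filter.tendsto_id.const_mul_atBot hc)
      filter_upwards [Filter.eventually_le_atBot 0] with σ hσ
      have := hle σ 0 hσ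
      rw [hV0] at this
      simp only [id]
      linarith
  choose Θ hΘ using hsurj
  have hΘV : ∀ x σ, Θ x (V x σ) = σ := fun x σ => (hmono x).injective (hΘ x _)
  have hΘc : Continuous fun p : X × ℝ => Θ p.1 p.2 := by
    rw [continuous_iff_continuousAt]
    rintro ⟨x, s⟩
    rw [ContinuousAt, tendsto_order]
    have hVσ : ∀ σ, Continuous fun p : X × ℝ => V p.1 σ := fun σ => by
      have h : Continuous fun p : X × ℝ => (p.1, σ) := by fun_prop
      have := hVc.comp h
      exact this
    constructor
    · intro a ha
      have h1 : V x a < s := by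
        have := hmono x ha
        rwa [hΘ] at this
      filter_upwards [(isOpen_lt (hVσ a) continuous_snd).mem_nhds h1] with p hp
      refine (hmono p.1).lt_iff_lt.1 ?_
      rw [hΘ]
      exact hp
    · intro a ha
      have h1 : s < V x a := by
        have := hmono x ha
        rwa [hΘ] at this
      filter_upwards [(isOpen_lt continuous_snd (hVσ a)).mem_nhds h1] with p hp
      refine (hmono p.1).lt_iff_lt.1 ?_
      rw [hΘ]
      exact hp
  refine ⟨V, Θ, hVc, hΘc, hV0, hmono, hΘ, hΘV, fun x s => ?_, fun x h1 σ => ?_⟩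
  · have hc : Continuous (Θ x) := by
      have := hΘc.comp (Continuous.prodMk_right x)
      exact this
    obtain ⟨c, hc0, hcv⟩ := hpos x
    exact HasDerivAt.of_local_left_inverse hc.continuousAt (hVd x _)
      (hc0.trans_le (hcv _)).ne' (.of_forall fun s => hΘ x s)
  · simp [hV, h1]

/-! ### Making a curve geodesic near a point -/

/-- A `C¹` function with values in `[0, 1]` that is `1` on `[-1, 1]` and `0` off `(-2, 2)`. -/
theorem exists_cutoff : ∃ ψ ψ' : ℝ → ℝ, (∀ r, HasDerivAt ψ (ψ' r) r) ∧ Continuous ψ ∧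
    Continuous ψ' ∧ (∀ r, |r| ≤ 1 → ψ r = 1 ∧ ψ' r = 0) ∧ ∀ r, 2 ≤ |r| → ψ r = 0 ∧ ψ' r = 0 := by
  let b : ContDiffBump (0 : ℝ) := ⟨1, 2, one_pos, by norm_num⟩
  have hb : ContDiff ℝ 1 b := b.contDiff
  have hd : ∀ r, HasDerivAt b (deriv b r) r := fun r =>
    (hb.differentiable one_ne_zero r).hasDerivAt
  refine ⟨b, deriv b, hd, hb.continuous, hb.continuous_deriv le_rfl, fun r hr => ?_,
    fun r hr => ?_⟩
  · have h1 : b r = 1 := b.one_of_mem_closedBall (by simpa [b] using hr)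
    refine ⟨h1, IsLocalMax.deriv_eq_zero (.of_forall fun s => ?_)⟩
    rw [h1]
    exact b.le_one
  · have h1 : b r = 0 := b.zero_of_le_dist (by simpa [b] using hr)
    refine ⟨h1, IsLocalMin.deriv_eq_zero (.of_forall fun s => ?_)⟩
    rw [h1]
    exact b.nonneg

/-- A curve of unit speed which runs along the equator in the positive direction is an arc of a
great circle. -/
theorem planar_eq_rot {Φ : ℝ → SO3} (hΦ : UnitSpeed Φ) {a b : ℝ}
    (h : ∀ s ∈ Set.Icc a b, (Φ s).1 2 0 = 0 ∧ (Φ s).1 2 1 = 0 ∧ 0 < (Φ s).1 2 2) :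
    ∀ s ∈ Set.Icc a b, (Φ a)⁻¹ * Φ s = rot 0 (s - a) := by
  have hdir : ∀ s ∈ Set.Icc a b, (Φ s).1 0 1 = -(Φ s).1 1 0 ∧ (Φ s).1 1 1 = (Φ s).1 0 0 := by
    intro s hs
    obtain ⟨e0, e1, e2⟩ := h s hs
    have c00 := col_dot (Φ s) 0 0
    have c01 := col_dot (Φ s) 0 1
    have r22 := row_dot (Φ s) 2 2
    have t := (third_col (Φ s)).2.2
    simp only [e0, e1, if_true, Fin.reduceEq, if_false] at c00 c01 r22
    have e3 : (Φ s).1 2 2 = 1 := by nlinarith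
    rw [e3] at t
    constructor
    · linear_combination (-(Φ s).1 0 1) * c00 + (Φ s).1 0 0 * c01 + (Φ s).1 1 0 * t
    · linear_combination (-(Φ s).1 1 1) * c00 + (Φ s).1 1 0 * c01 - (Φ s).1 0 0 * t
  have hcs : ∀ s, HasDerivAt (fun s => Real.cos (s - a)) (-Real.sin (s - a)) s ∧
      HasDerivAt (fun s => Real.sin (s - a)) (Real.cos (s - a)) s := fun s => by
    have hs : HasDerivAt (fun s : ℝ => s - a) 1 s := (hasDerivAt_id s).sub_const a
    have h1 := hs.cos
    have h2 := hs.sin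
    rw [mul_one] at h1 h2
    exact ⟨h1, h2⟩
  have key : ∀ f : ℝ → ℝ, (∀ s ∈ Set.Icc a b, HasDerivAt f 0 s) →
      ∀ s ∈ Set.Icc a b, f s = f a := fun f hf =>
    constant_of_has_deriv_right_zero (fun s hs => (hf s hs).continuousAt.continuousWithinAt)
      fun s hs => (hf s ⟨hs.1, hs.2.le⟩).hasDerivWithinAt
  have h1 := key (fun s => (Φ s).1 0 0 * Real.cos (s - a) + (Φ s).1 1 0 * Real.sin (s - a))
    fun s hs => by
      obtain ⟨d0, d1⟩ := hdir s hs
      refine (((hΦ s 0).mul (hcs s).1).add ((hΦ s 1).mul (hcs s).2)).congr_deriv ?_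
      rw [d0, d1]
      ring
  have h2 := key (fun s => (Φ s).1 1 0 * Real.cos (s - a) - (Φ s).1 0 0 * Real.sin (s - a))
    fun s hs => by
      obtain ⟨d0, d1⟩ := hdir s hs
      refine (((hΦ s 1).mul (hcs s).1).sub ((hΦ s 0).mul (hcs s).2)).congr_deriv ?_
      rw [d0, d1]
      ring
  intro s hs
  have ha : a ∈ Set.Icc a b := ⟨le_rfl, hs.1.trans hs.2⟩
  have h1s := h1 s hs
  have h2s := h2 s hs
  simp only [sub_self, Real.cos_zero, Real.sin_zero, mul_one, mul_zero, add_zero, sub_zero]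
    at h1s h2s
  have hcs2 := Real.sin_sq_add_cos_sq (s - a)
  have p0 : (Φ s).1 0 0 =
      (Φ a).1 0 0 * Real.cos (s - a) - (Φ a).1 1 0 * Real.sin (s - a) := by
    linear_combination (-(Φ s).1 0 0) * hcs2 + Real.cos (s - a) * h1s - Real.sin (s - a) * h2s
  have p1 : (Φ s).1 1 0 =
      (Φ a).1 1 0 * Real.cos (s - a) + (Φ a).1 0 0 * Real.sin (s - a) := by
    linear_combination (-(Φ s).1 1 0) * hcs2 + Real.sin (s - a) * h1s + Real.cos (s - a) * h2s
  obtain ⟨da0, da1⟩ := hdir a ha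
  obtain ⟨ds0, ds1⟩ := hdir s hs
  rw [inv_mul_eq_iff_eq_mul]
  refine SO3.eq_of_cols (fun i => ?_) (fun i => ?_)
  · rw [SO3.mul_apply, rot_apply]
    fin_cases i
    · simp [da0]; linear_combination p0
    · simp [da1]; linear_combination p1
    · simp [(h a ha).1, (h a ha).2.1, (h s hs).1]
  · rw [SO3.mul_apply, rot_apply]
    fin_cases i
    · simp [da0, ds0]; linear_combination -p1
    · simp [da1, ds1]; linear_combination p0
    · simp [(h a ha).1, (h a ha).2.1, (h s hs).2.1]

/-- The central projections to the sphere of a continuous family of curves in space, parametrized by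
arc length; `V` is the arc length of the projections. -/
theorem exists_projection {X : Type*} [TopologicalSpace X] {P D : X → ℝ → Fin 3 → ℝ}
    (hP : Continuous fun q : X × ℝ => P q.1 q.2) (hD : Continuous fun q : X × ℝ => D q.1 q.2)
    (hd : ∀ x σ i, HasDerivAt (P x · i) (D x σ i) σ) (hg : ∀ x σ, 0 < gram (P x σ) (D x σ))
    (hpos : ∀ x, ∃ c > 0, ∀ σ, c ≤ projSpeed (P x σ) (D x σ)) :
    ∃ (V : X → ℝ → ℝ) (Ψ : X → ℝ → SO3), Continuous (fun q : X × ℝ => V q.1 q.2) ∧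
      Continuous (fun q : X × ℝ => Ψ q.1 q.2) ∧ (∀ x, UnitSpeed (Ψ x)) ∧ (∀ x, V x 0 = 0) ∧
      (∀ x, StrictMono (V x)) ∧ (∀ x, Function.Surjective (V x)) ∧
      (∀ x σ, Ψ x (V x σ) = spatialFrame (P x σ) (D x σ)) ∧
      ∀ x, (∀ σ, projSpeed (P x σ) (D x σ) = 1) → ∀ σ, V x σ = σ := by
  have hvc : Continuous fun q : X × ℝ => projSpeed (P q.1 q.2) (D q.1 q.2) :=
    continuous_projSpeed hP hD fun q => hg _ _
  obtain ⟨V, Θ, hVc, hΘc, hV0, hmono, hVΘ, hΘV, hΘd, hV1⟩ :=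
    exists_arclength (v := fun x σ => projSpeed (P x σ) (D x σ)) hvc hpos
  refine ⟨V, fun x s => spatialFrame (P x (Θ x s)) (D x (Θ x s)), hVc, ?_, fun x s i => ?_, hV0,
    hmono, fun x s => ⟨_, hVΘ x s⟩, fun x σ => ?_, hV1⟩
  · have hq : Continuous fun q : X × ℝ => (q.1, Θ q.1 q.2) := continuous_fst.prodMk hΘc
    have c1 := hP.comp hq
    have c2 := hD.comp hq
    have := continuous_spatialFrame c1 c2 fun q => hg _ _
    exact this
  · have h2 := hasDerivAt_spatialFrame (hd x) (hg x) (Θ x s) i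
    have h3 := h2.comp s (hΘd x s)
    refine h3.congr_deriv ?_
    have h4 : projSpeed (P x (Θ x s)) (D x (Θ x s)) ≠ 0 := (projSpeed_pos (hg _ _)).ne'
    rw [mul_comm, ← mul_assoc, inv_mul_cancel₀ h4, one_mul]
  · simp only [hΘV]

/-- The position of a frame, with its height over the equatorial plane multiplied by `c`. -/
def flatPos (m : SO3) (c : ℝ) : Fin 3 → ℝ := ![m.1 0 0, m.1 1 0, c * m.1 2 0]

/-- The velocity of `flatPos` along a curve with frame `m`, if the factor `c` has derivative
`c'`. -/
def flatVel (m : SO3) (c c' : ℝ) : Fin 3 → ℝ :=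
  ![m.1 0 1, m.1 1 1, c' * m.1 2 0 + c * m.1 2 1]

theorem gram_flat_pos {m : SO3} (h : 0 < m.1 2 2) (c c' : ℝ) :
    0 < gram (flatPos m c) (flatVel m c c') := by
  have e : flatPos m c 0 * flatVel m c c' 1 - flatPos m c 1 * flatVel m c c' 0 = m.1 2 2 :=
    ((third_col m).2.2).symm
  rw [gram_eq, e]
  positivity

/-- A constant factor `1` changes nothing. -/
theorem flat_one_zero (m : SO3) : gram (flatPos m 1) (flatVel m 1 0) = 1 ∧
    projSpeed (flatPos m 1) (flatVel m 1 0) = 1 ∧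
      spatialFrame (flatPos m 1) (flatVel m 1 0) = m := by
  have e1 : ∀ i, flatPos m 1 i = m.1 i 0 := fun i => by fin_cases i <;> simp [flatPos]
  have e2 : ∀ i, flatVel m 1 0 i = m.1 i 1 := fun i => by fin_cases i <;> simp [flatVel]
  have c00 := col_dot m 0 0
  have c11 := col_dot m 1 1
  have c01 := col_dot m 0 1
  rw [if_pos rfl] at c00 c11
  rw [if_neg (by decide)] at c01
  have n1 : normSq3 (flatPos m 1) = 1 := by simp only [normSq3, e1]; linarith
  have n2 : normSq3 (flatVel m 1 0) = 1 := by simp only [normSq3, e2]; linarith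
  have n3 : dot3 (flatPos m 1) (flatVel m 1 0) = 0 := by simp only [dot3, e1, e2]; linarith
  have g1 : gram (flatPos m 1) (flatVel m 1 0) = 1 := by rw [gram, n1, n2, n3]; norm_num
  refine ⟨g1, by rw [projSpeed, g1, n1]; simp, SO3.eq_of_cols (fun i => ?_) fun i => ?_⟩
  · rw [spatialFrame_zero (by rw [g1]; exact one_pos), n1, e1]; simp
  · rw [spatialFrame_one (by rw [g1]; exact one_pos), dirVec, g1, n1, n3, e2]; simp

/-- A constant factor `0` gives a curve along the equator. -/
theorem flat_zero_zero {m : SO3} (h : 0 < m.1 2 2) :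
    (spatialFrame (flatPos m 0) (flatVel m 0 0)).1 2 0 = 0 ∧
      (spatialFrame (flatPos m 0) (flatVel m 0 0)).1 2 1 = 0 ∧
      0 < (spatialFrame (flatPos m 0) (flatVel m 0 0)).1 2 2 := by
  have hg := gram_flat_pos h 0 0
  have hn := normSq3_pos_of_gram hg
  have e : flatPos m 0 0 * flatVel m 0 0 1 - flatPos m 0 1 * flatVel m 0 0 0 = m.1 2 2 :=
    ((third_col m).2.2).symm
  have z0 : flatPos m 0 2 = 0 := by simp [flatPos]
  have z1 : flatVel m 0 0 2 = 0 := by simp [flatVel]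
  refine ⟨?_, ?_, ?_⟩
  · rw [spatialFrame_zero hg, z0, zero_div]
  · rw [spatialFrame_one hg, dirVec, z0, z1, mul_zero, mul_zero, sub_zero, zero_div]
  · rw [← e] at h
    rw [(third_col _).2.2, spatialFrame_zero hg, spatialFrame_zero hg, spatialFrame_one hg,
      spatialFrame_one hg]
    simp only [dirVec]
    have a1 := Real.sqrt_pos.2 hg
    have a2 := Real.sqrt_pos.2 hn
    generalize flatPos m 0 = p at *
    generalize flatVel m 0 0 = d at *
    have : p 0 / √(normSq3 p) * ((normSq3 p * d 1 - dot3 p d * p 1) /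
        (√(gram p d) * √(normSq3 p))) - p 1 / √(normSq3 p) *
        ((normSq3 p * d 0 - dot3 p d * p 0) / (√(gram p d) * √(normSq3 p))) =
        normSq3 p * (p 0 * d 1 - p 1 * d 0) / (√(normSq3 p) ^ 2 * √(gram p d)) := by
      field_simp
      ring
    rw [this]
    positivity

/-- A continuous family of curves `M x` of unit speed which are graphs over the equator at distance
at most `2 * δ` from the parameters `t x` can be deformed such that the curves become arcs of the
equator near `t x`: the height over the equatorial plane is multiplied by a factor that depends on
the parameter. The projection to the equatorial plane is not changed, so that the curves remain
immersed. -/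
theorem exists_flattening {K : Type*} [TopologicalSpace K] {M : K → ℝ → SO3} {t : K → ℝ} {δ : ℝ}
    (hM : Continuous fun p : K × ℝ => M p.1 p.2) (hu : ∀ x, UnitSpeed (M x)) (ht : Continuous t)
    (hδ : 0 < δ) (h22 : ∀ x σ, |σ - t x| ≤ 2 * δ → 0 < (M x σ).1 2 2) :
    ∃ (V : K × unitInterval → ℝ → ℝ) (Ψ : K × unitInterval → ℝ → SO3),
      Continuous (fun q : (K × unitInterval) × ℝ => V q.1 q.2) ∧
      Continuous (fun q : (K × unitInterval) × ℝ => Ψ q.1 q.2) ∧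
      (∀ p, UnitSpeed (Ψ p)) ∧ (∀ p, V p 0 = 0) ∧
      (∀ p, StrictMono (V p)) ∧ (∀ p, Function.Surjective (V p)) ∧
      (∀ p σ, 2 * δ ≤ |σ - t p.1| → Ψ p (V p σ) = M p.1 σ) ∧
      (∀ x σ, V (x, 0) σ = σ ∧ Ψ (x, 0) σ = M x σ) ∧
      ∀ x σ, |σ - t x| ≤ δ → (Ψ (x, 1) (V (x, 1) σ)).1 2 0 = 0 ∧
        (Ψ (x, 1) (V (x, 1) σ)).1 2 1 = 0 ∧ 0 < (Ψ (x, 1) (V (x, 1) σ)).1 2 2 := by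
  obtain ⟨ψ, ψ', hψd, hψc, hψ'c, hψ1, hψ0⟩ := exists_cutoff
  -- The factor of the height and its derivative.
  obtain ⟨c, hc⟩ : ∃ c : K × unitInterval → ℝ → ℝ,
      c = fun p σ => 1 - p.2 * ψ ((σ - t p.1) / δ) := ⟨_, rfl⟩
  obtain ⟨c', hc'⟩ : ∃ c' : K × unitInterval → ℝ → ℝ,
      c' = fun p σ => -(p.2 * (ψ' ((σ - t p.1) / δ) / δ)) := ⟨_, rfl⟩
  have hcd : ∀ p σ, HasDerivAt (c p) (c' p σ) σ := fun p σ => by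
    have h : HasDerivAt (fun s : ℝ => (s - t p.1) / δ) (1 / δ) σ :=
      ((hasDerivAt_id σ).sub_const _).div_const _
    have h2 := (((hψd ((σ - t p.1) / δ)).comp σ h).const_mul (p.2 : ℝ)).const_sub 1
    rw [hc, hc']
    refine h2.congr_deriv ?_
    ring
  have hcc : Continuous fun q : (K × unitInterval) × ℝ => c q.1 q.2 := by rw [hc]; fun_prop
  have hc'c : Continuous fun q : (K × unitInterval) × ℝ => c' q.1 q.2 := by rw [hc']; fun_prop
  have hfar : ∀ p σ, 2 * δ ≤ |σ - t p.1| → c p σ = 1 ∧ c' p σ = 0 := fun p σ h => by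
    have := hψ0 ((σ - t p.1) / δ) (by rw [abs_div, abs_of_pos hδ, le_div_iff₀ hδ]; exact h)
    simp [hc, hc', this]
  have hnear : ∀ x σ, |σ - t x| ≤ δ → c (x, 1) σ = 0 ∧ c' (x, 1) σ = 0 := fun x σ h => by
    have := hψ1 ((σ - t x) / δ) (by rw [abs_div, abs_of_pos hδ, div_le_one hδ]; exact h)
    simp [hc, hc', this]
  have hinit : ∀ x σ, c (x, 0) σ = 1 ∧ c' (x, 0) σ = 0 := fun x σ => by simp [hc, hc']
  clear hc hc'
  have hcoord : ∀ i j, Continuous fun q : (K × unitInterval) × ℝ => (M q.1.1 q.2).1 i j := by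
    intro i j
    have h : Continuous fun q : (K × unitInterval) × ℝ => (q.1.1, q.2) := by fun_prop
    have h2 := hM.comp h
    have h3 := (continuous_apply i j).comp h2
    exact h3
  have a00 := hcoord 0 0
  have a10 := hcoord 1 0
  have a20 := hcoord 2 0
  have a01 := hcoord 0 1
  have a11 := hcoord 1 1
  have a21 := hcoord 2 1
  have hP : Continuous fun q : (K × unitInterval) × ℝ => flatPos (M q.1.1 q.2) (c q.1 q.2) := by
    refine continuous_pi fun i => ?_
    fin_cases i
    · exact a00
    · exact a10
    · exact hcc.mul a20
  have hD : Continuous fun q : (K × unitInterval) × ℝ =>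
      flatVel (M q.1.1 q.2) (c q.1 q.2) (c' q.1 q.2) := by
    refine continuous_pi fun i => ?_
    fin_cases i
    · exact a01
    · exact a11
    · exact (hc'c.mul a20).add (hcc.mul a21)
  have hd : ∀ (p : K × unitInterval) σ i, HasDerivAt (fun s => flatPos (M p.1 s) (c p s) i)
      (flatVel (M p.1 σ) (c p σ) (c' p σ) i) σ := by
    intro p σ i
    fin_cases i
    · exact hu p.1 σ 0
    · exact hu p.1 σ 1
    · exact (hcd p σ).mul (hu p.1 σ 2)
  have hg : ∀ (p : K × unitInterval) σ,
      0 < gram (flatPos (M p.1 σ) (c p σ)) (flatVel (M p.1 σ) (c p σ) (c' p σ)) := by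
    intro p σ
    rcases le_total (2 * δ) |σ - t p.1| with h | h
    · rw [(hfar p σ h).1, (hfar p σ h).2, (flat_one_zero _).1]
      exact one_pos
    · exact gram_flat_pos (h22 _ _ h) _ _
  have hpos : ∀ p : K × unitInterval, ∃ b > 0, ∀ σ,
      b ≤ projSpeed (flatPos (M p.1 σ) (c p σ)) (flatVel (M p.1 σ) (c p σ) (c' p σ)) := by
    intro p
    have hv := (continuous_projSpeed hP hD fun q => hg _ _).comp (Continuous.prodMk_right p)
    obtain ⟨σ₀, -, hmin⟩ := (isCompact_Icc (a := t p.1 - 2 * δ) (b := t p.1 + 2 * δ)).exists_isMinOn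
      ⟨t p.1, by constructor <;> linarith⟩ hv.continuousOn
    refine ⟨min _ 1, lt_min (projSpeed_pos (hg p σ₀)) one_pos, fun σ => ?_⟩
    rcases le_total (2 * δ) |σ - t p.1| with h | h
    · rw [(hfar p σ h).1, (hfar p σ h).2, (flat_one_zero _).2.1]
      exact min_le_right _ _
    · rw [abs_le] at h
      exact (min_le_left _ _).trans (hmin ⟨by linarith, by linarith⟩)
  obtain ⟨V, Ψ, hVc, hΨc, hΨu, hV0, hmono, hsurj, hΨ, hV1⟩ := exists_projection
    (P := fun (p : K × unitInterval) σ => flatPos (M p.1 σ) (c p σ))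
    (D := fun (p : K × unitInterval) σ => flatVel (M p.1 σ) (c p σ) (c' p σ)) hP hD hd hg hpos
  refine ⟨V, Ψ, hVc, hΨc, hΨu, hV0, hmono, hsurj, fun p σ h => ?_, fun x σ => ?_, fun x σ h => ?_⟩
  · rw [hΨ, (hfar p σ h).1, (hfar p σ h).2, (flat_one_zero _).2.2]
  · have h1 : V (x, 0) σ = σ := hV1 (x, 0) (fun σ => by
      rw [(hinit x σ).1, (hinit x σ).2, (flat_one_zero _).2.1]) σ
    have h2 := hΨ (x, 0) σ
    rw [h1, (hinit x σ).1, (hinit x σ).2, (flat_one_zero _).2.2] at h2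
    exact ⟨h1, h2⟩
  · rw [hΨ, (hnear x σ h).1, (hnear x σ h).2]
    exact flat_zero_zero (h22 _ _ (by linarith))

namespace Arc

/-- If `K` is compact, then the frames near the points `t x` turn uniformly little. -/
theorem exists_radius {K : Type*} [TopologicalSpace K] [CompactSpace K] {F : K → Arc} {t : K → ℝ}
    (hF : Continuous F) (ht : Continuous t) (h0 : ∀ x, 0 < t x) (h1 : ∀ x, t x < (F x).len) :
    ∃ δ > 0, ∀ x, 2 * δ < t x ∧ t x + 2 * δ < (F x).len ∧
      ∀ r, |r| ≤ 2 * δ → 0 < (((F x).frame (t x))⁻¹ * (F x).frame (t x + r)).1 2 2 := by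
  have key : ∀ᶠ r in nhds (0 : ℝ), ∀ x ∈ (Set.univ : Set K), r < t x ∧ t x + r < (F x).len ∧
      0 < (((F x).frame (t x))⁻¹ * (F x).frame (t x + r)).1 2 2 := by
    refine isCompact_univ.eventually_forall_of_forall_eventually fun x _ => ?_
    have c1 : Continuous fun p : ℝ × K =>
        ((F p.2).frame (t p.2))⁻¹ * (F p.2).frame (t p.2 + p.1) := by fun_prop
    have c2 : Continuous fun p : ℝ × K =>
        (((F p.2).frame (t p.2))⁻¹ * (F p.2).frame (t p.2 + p.1)).1 2 2 :=
      (continuous_apply 2 2).comp c1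
    have e1 : ∀ᶠ p : ℝ × K in nhds (0, x), p.1 < t p.2 :=
      (isOpen_lt (by fun_prop) (by fun_prop)).mem_nhds (by simpa using h0 x)
    have e2 : ∀ᶠ p : ℝ × K in nhds (0, x), t p.2 + p.1 < (F p.2).len :=
      (isOpen_lt (by fun_prop) (by fun_prop)).mem_nhds (by simpa using h1 x)
    have e3 : ∀ᶠ p : ℝ × K in nhds (0, x),
        0 < (((F p.2).frame (t p.2))⁻¹ * (F p.2).frame (t p.2 + p.1)).1 2 2 :=
      (isOpen_lt continuous_const c2).mem_nhds (by
        have h : ((F x).frame (t x))⁻¹ * (F x).frame (t x + 0) = 1 := by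
          rw [add_zero, inv_mul_cancel]
        change (0 : ℝ) < (((F x).frame (t x))⁻¹ * (F x).frame (t x + 0)).1 2 2
        rw [h, one_apply]
        simp)
    filter_upwards [e1, e2, e3] with p h1 h2 h3 using ⟨h1, h2, h3⟩
  obtain ⟨η, hη, hball⟩ := Metric.eventually_nhds_iff.1 key
  refine ⟨η / 4, by positivity, fun x => ?_⟩
  have hin : ∀ r, |r| ≤ 2 * (η / 4) → _ := fun r hr =>
    hball (y := r) (by rw [Real.dist_eq, sub_zero]; linarith) x trivial
  have h2 := hin (2 * (η / 4)) (by rw [abs_of_pos (by positivity)])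
  exact ⟨h2.1, h2.2.1, fun r hr => (hin r hr).2.2⟩

/-- Near the points of arc length `t x`, a compact family of curves can be deformed to geodesics.
The number `u` keeps track of the point `t`; the deformed curve is a geodesic between the arc
lengths `a` and `b`. -/
theorem exists_straightening {K : Type*} [TopologicalSpace K] [CompactSpace K] {F : K → Arc}
    {t : K → ℝ} (hF : Continuous F) (ht : Continuous t) (h0 : ∀ x, 0 < t x)
    (h1 : ∀ x, t x < (F x).len) :
    ∃ (S : K × unitInterval → Arc) (u : K × unitInterval → ℝ) (a b : K → ℝ),
      Continuous S ∧ Continuous u ∧ Continuous a ∧ Continuous b ∧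
      (∀ x, S (x, 0) = F x) ∧ (∀ x, u (x, 0) = t x) ∧ (∀ p, (S p).last = (F p.1).last) ∧
      (∀ p, 0 < u p ∧ u p < (S p).len) ∧
      ∀ x, 0 < a x ∧ a x < b x ∧ b x < (S (x, 1)).len ∧
        (S (x, 1)).sub (a x) (b x) = circ 0 (b x - a x) := by
  obtain ⟨δ, hδ, hrad⟩ := exists_radius hF ht h0 h1
  -- The frames are taken relative to the frame at `t x`.
  obtain ⟨V, Ψ, hVc, hΨc, hΨu, hV0, hmono, hsurj, hfar, hinit, hnear⟩ :=
    exists_flattening (M := fun x σ => ((F x).frame (t x))⁻¹ * (F x).frame σ) (t := t) (δ := δ)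
      (by fun_prop) (fun x => (F x).unitSpeed.mul_left _) ht hδ (fun x σ h => by
        have := (hrad x).2.2 (σ - t x) h
        rwa [add_sub_cancel] at this)
  have hΨx : ∀ p, Continuous (Ψ p) := fun p => by
    have := hΨc.comp (Continuous.prodMk_right p)
    exact this
  have hend0 : ∀ p : K × unitInterval, Ψ p 0 = ((F p.1).frame (t p.1))⁻¹ := fun p => by
    have := hfar p 0 (by
      rw [zero_sub, abs_neg, abs_of_pos (h0 _)]
      exact (hrad p.1).1.le)
    rwa [hV0, frame_zero, mul_one] at this
  have hend1 : ∀ p : K × unitInterval,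
      Ψ p (V p (F p.1).len) = ((F p.1).frame (t p.1))⁻¹ * (F p.1).last := fun p =>
    hfar p _ (by
      rw [abs_of_pos (sub_pos.2 (h1 _))]
      linarith [(hrad p.1).2.1])
  have hVpos : ∀ p r, 0 < r → 0 < V p r := fun p r hr => by
    have := hmono p hr
    rwa [hV0] at this
  have hVat : ∀ g : K × unitInterval → ℝ, Continuous g → Continuous fun p => V p (g p) :=
    fun g hg => by
      have := hVc.comp (continuous_id.prodMk hg)
      exact this
  have hVlen : ∀ p : K × unitInterval, 0 < V p (F p.1).len := fun p =>
    hVpos p _ ((h0 p.1).trans (h1 p.1))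
  have hlen : ∀ p : K × unitInterval,
      (ofPath (Ψ p) (hΨx p) (hΨu p) (V p (F p.1).len)).len = V p (F p.1).len := fun p =>
    ofPath_len (hVlen p).le
  refine ⟨fun p => ofPath (Ψ p) (hΨx p) (hΨu p) (V p (F p.1).len), fun p => V p (t p.1),
    fun x => V (x, 1) (t x - δ), fun x => V (x, 1) (t x + δ),
    continuous_ofPath _ _ hΨc (hVat _ (by fun_prop)), hVat _ (by fun_prop), ?_, ?_, fun x => ?_,
    fun x => (hinit x _).1, fun p => ?_, fun p => ⟨hVpos p _ (h0 p.1), ?_⟩,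
    fun x => ⟨?_, ?_, ?_, ?_⟩⟩
  · have := (hVat (fun p => t p.1 - δ) (by fun_prop)).comp (Continuous.prodMk_left (X := K) 1)
    exact this
  · have := (hVat (fun p => t p.1 + δ) (by fun_prop)).comp (Continuous.prodMk_left (X := K) 1)
    exact this
  · refine ext' ?_ fun s hs0 hs1 => ?_
    · rw [hlen]
      exact (hinit x _).1
    · rw [hlen] at hs1
      rw [ofPath_frame hs0 hs1, hend0, (hinit x s).2, inv_inv, mul_inv_cancel_left]
  · rw [ofPath_last (hVlen p).le, hend0, hend1, inv_inv, mul_inv_cancel_left]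
  · rw [hlen]
    exact hmono p (h1 p.1)
  · exact hVpos _ _ (by linarith [(hrad x).1])
  · exact hmono (x, 1) (by linarith)
  · rw [hlen]
    exact hmono (x, 1) (by linarith [(hrad x).2.1])
  · have hab : V (x, 1) (t x - δ) ≤ V (x, 1) (t x + δ) := (hmono (x, 1)).monotone (by linarith)
    have ha0 : 0 ≤ V (x, 1) (t x - δ) := (hVpos _ _ (by linarith [(hrad x).1])).le
    have hbl : V (x, 1) (t x + δ) ≤ V (x, 1) (F x).len :=
      (hmono (x, 1)).monotone (by linarith [(hrad x).2.1])
    have hplane := planar_eq_rot (hΨu (x, 1)) (a := V (x, 1) (t x - δ)) (b := V (x, 1) (t x + δ))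
      fun s hs => by
        obtain ⟨σ, rfl⟩ := hsurj (x, 1) s
        have l1 := (hmono (x, 1)).le_iff_le.1 hs.1
        have l2 := (hmono (x, 1)).le_iff_le.1 hs.2
        exact hnear x σ (by rw [abs_le]; constructor <;> linarith)
    refine ext' ?_ fun s hs0 hs1 => ?_
    · rw [sub_len _ hab, circ_len (sub_nonneg.2 hab), slope_zero, div_one]
    · rw [sub_len _ hab] at hs1
      rw [sub_frame _ hs0 hs1, circ_frame hs0 (by simpa using hs1), slope_zero, mul_one,
        ofPath_frame ha0 (hab.trans hbl), ofPath_frame (by linarith) (by linarith)]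
      have := hplane (s + V (x, 1) (t x - δ)) ⟨by linarith, by linarith⟩
      rw [add_sub_cancel_right] at this
      rw [← this]
      group

end Arc

/-! ### Creating two great circles by a regular homotopy -/

namespace Arc

theorem replace_mem_arcsTo {Q : SO3} {A B : Arc} (hA : A ∈ arcsTo Q) {s c : ℝ} (hs : 0 < s)
    (hsc : s ≤ c) (hc : c ≤ A.len) (hB : B.last = (A.sub s c).last) :
    A.sub 0 s * B * A.sub c A.len ∈ arcsTo Q := by
  constructor
  · rw [mul_len, mul_len, sub_len _ hs.le, sub_len _ hc]
    linarith [B.len_nonneg]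
  · rw [mul_last, mul_last, hB, ← mul_last, ← mul_last, sub_mul_sub _ hs.le hsc,
      sub_mul_sub _ (hs.le.trans hsc) hc, sub_zero_len, hA.2]

theorem sub_eq_circ_of_le {A : Arc} {a b c : ℝ} (h : A.sub a b = circ 0 (b - a)) (hac : a ≤ c)
    (hcb : c ≤ b) : A.sub a c = circ 0 (c - a) := by
  have hl : (circ 0 (c - a)).len = c - a := by
    rw [circ_len (sub_nonneg.2 hac), slope_zero, div_one]
  refine ext' (by rw [sub_len _ hac, hl]) fun σ h0 h1 => ?_
  rw [sub_len _ hac] at h1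
  have h2 := congrArg (fun B : Arc => B.frame σ) h
  simp only [sub_frame A h0 (h1.trans (by linarith : c - a ≤ b - a))] at h2
  rw [sub_frame _ h0 h1, h2, circ_frame h0 (by rw [slope_zero]; linarith),
    circ_frame h0 (by rw [slope_zero]; linarith)]

section

variable {K : Type*} [TopologicalSpace K] {Q : SO3} {F : K → Arc} {s c : K → ℝ}

/-- A short geodesic piece of a curve is deformed to a kink, which ends with the geodesic between
two small circles; then these two circles are enlarged to great circles. -/
theorem deform_two_loops (hF : Continuous F) (hFQ : ∀ x, F x ∈ arcsTo Q) (hsc : Continuous s)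
    (hcc : Continuous c) (hs : ∀ x, 0 < s x) (hlt : ∀ x, s x < c x) (h1 : ∀ x, c x - s x ≤ 1)
    (hc : ∀ x, c x ≤ (F x).len) (hgeo : ∀ x, (F x).sub (s x) (c x) = circ 0 (c x - s x)) :
    Deform (arcsTo Q) F (fun x => (F x).sub 0 (s x) *
      (loop * (F x).sub (s x) (c x) * loop) * (F x).sub (c x) (F x).len) := by
  have hpi := Real.pi_gt_three
  have hsin : ∀ x, 0 < Real.sin ((c x - s x) / 2) := fun x =>
    Real.sin_pos_of_pos_of_lt_pi (by linarith [hlt x]) (by linarith [h1 x])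
  have hgl : ∀ x, ((F x).sub (s x) (c x)).last = rot 0 (c x - s x) := fun x => by
    rw [hgeo, circ_last (by linarith [hlt x])]
  have step1 : Deform (arcsTo Q) F (fun x => (F x).sub 0 (s x) *
      (circ (kinkSlope (c x - s x)) (2 * Real.pi) * circ 0 (c x - s x) *
        circ (kinkSlope (c x - s x)) (2 * Real.pi)) * (F x).sub (c x) (F x).len) := by
    refine ⟨fun p => (F p.1).sub 0 (s p.1) * kink (c p.1 - s p.1) (p.2 * (2 * Real.pi)) *
      (F p.1).sub (c p.1) (F p.1).len, ?_, fun p => ?_, fun x => ?_, fun x => ?_⟩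
    · have := continuous_kink (X := K × unitInterval) (ε := fun p => c p.1 - s p.1)
        (a := fun p => p.2 * (2 * Real.pi)) (by fun_prop) (by fun_prop) fun p => hsin p.1
      fun_prop
    · refine replace_mem_arcsTo (hFQ _) (hs _) (hlt _).le (hc _) ?_
      rw [kink_last (hsin _) (mul_nonneg p.2.2.1 (by positivity)), hgl]
    · simp only [Set.Icc.coe_zero, zero_mul]
      rw [kink_zero (by linarith [hlt x]) (by linarith [h1 x]), ← hgeo,
        sub_mul_sub _ (hs x).le (hlt x).le, sub_mul_sub _ ((hs x).le.trans (hlt x).le) (hc x),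
        sub_zero_len]
    · simp only [Set.Icc.coe_one, one_mul]
      rw [kink_two_pi (by linarith [hlt x]) (by linarith [h1 x])]
  refine step1.trans ⟨fun p => (F p.1).sub 0 (s p.1) *
      (circ ((1 - p.2) * kinkSlope (c p.1 - s p.1)) (2 * Real.pi) * circ 0 (c p.1 - s p.1) *
        circ ((1 - p.2) * kinkSlope (c p.1 - s p.1)) (2 * Real.pi)) *
      (F p.1).sub (c p.1) (F p.1).len, ?_, fun p => ?_, fun x => ?_, fun x => ?_⟩
  · have h : ∀ p : K × unitInterval, Real.sin ((c p.1 - s p.1) / 2) ≠ 0 := fun p => (hsin p.1).ne'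
    have : Continuous fun p : K × unitInterval => kinkSlope (c p.1 - s p.1) := by
      unfold kinkSlope
      fun_prop (disch := assumption)
    fun_prop
  · refine replace_mem_arcsTo (hFQ _) (hs _) (hlt _).le (hc _) ?_
    rw [mul_last, mul_last, circ_last (by positivity), rot_two_pi, one_mul, mul_one, hgl,
      circ_last (by linarith [hlt p.1])]
  · simp only [Set.Icc.coe_zero, sub_zero, one_mul]
  · simp only [Set.Icc.coe_one, _root_.sub_self, zero_mul, hgeo, loop]

/-- Two great circles inserted at different points are moved to the same point. -/
theorem deform_slide {u : K → ℝ} (hF : Continuous F) (hFQ : ∀ x, F x ∈ arcsTo Q)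
    (hsc : Continuous s) (hcc : Continuous c) (huc : Continuous u) (hs : ∀ x, 0 < s x)
    (hlt : ∀ x, s x < c x) (hc : ∀ x, c x ≤ (F x).len) (hu0 : ∀ x, 0 < u x)
    (hu1 : ∀ x, u x < (F x).len) :
    Deform (arcsTo Q) (fun x => (F x).sub 0 (s x) *
      (loop * (F x).sub (s x) (c x) * loop) * (F x).sub (c x) (F x).len)
      (fun x => (F x).ins (u x) 2) := by
  refine ⟨fun p => (F p.1).sub 0 ((1 - p.2) * s p.1 + p.2 * u p.1) *
      (loop * (F p.1).sub ((1 - p.2) * s p.1 + p.2 * u p.1) ((1 - p.2) * c p.1 + p.2 * u p.1) *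
        loop) * (F p.1).sub ((1 - p.2) * c p.1 + p.2 * u p.1) (F p.1).len, by fun_prop,
      fun p => ?_, fun x => ?_, fun x => ?_⟩
  · obtain ⟨p0, p1⟩ := p.2.2
    have a1 := hs p.1
    have a2 := hlt p.1
    have a3 := hc p.1
    have a4 := hu0 p.1
    have a5 := hu1 p.1
    refine replace_mem_arcsTo (hFQ _) ?_ ?_ ?_ ?_
    · rcases p0.eq_or_lt with h | h
      · rw [← h]; linarith
      · nlinarith
    · nlinarith
    · nlinarith
    · rw [mul_last, mul_last, loop_last, one_mul, mul_one]
  · simp only [Set.Icc.coe_zero, sub_zero, one_mul, zero_mul, add_zero]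
  · simp only [Set.Icc.coe_one, _root_.sub_self, zero_mul, one_mul, zero_add, sub_self, mul_one,
      ins, pow_two]

/-- Two great circles can be inserted by a regular homotopy. -/
theorem deform_ins_two [CompactSpace K] {t : K → ℝ} (hF : Continuous F) (ht : Continuous t)
    (hFQ : ∀ x, F x ∈ arcsTo Q) (h0 : ∀ x, 0 < t x) (h1 : ∀ x, t x < (F x).len) :
    Deform (arcsTo Q) F (fun x => (F x).ins (t x) 2) := by
  obtain ⟨S, u, a, b, hS, hu, ha, hb, hS0, hu0, hSl, hut, hab⟩ := exists_straightening hF ht h0 h1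
  have hSQ : ∀ p, S p ∈ arcsTo Q := fun p =>
    ⟨(hut p).1.trans (hut p).2, (hSl p).trans (hFQ p.1).2⟩
  have hS1 : Continuous fun x => S (x, 1) := by fun_prop
  have hle : ∀ x, a x + min (b x - a x) 1 ≤ b x := fun x => by
    linarith [min_le_left (b x - a x) 1]
  have hlt : ∀ x, a x < a x + min (b x - a x) 1 := fun x =>
    lt_add_of_pos_right _ (lt_min (sub_pos.2 (hab x).2.1) one_pos)
  have d0 : Deform (arcsTo Q) F (fun x => S (x, 1)) := ⟨S, hS, hSQ, hS0, fun _ => rfl⟩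
  have d1 := deform_two_loops (Q := Q) (s := a) (c := fun x => a x + min (b x - a x) 1) hS1
    (fun x => hSQ _) ha (by fun_prop) (fun x => (hab x).1) hlt
    (fun x => by linarith [min_le_right (b x - a x) 1])
    (fun x => (hle x).trans (hab x).2.2.1.le)
    fun x => sub_eq_circ_of_le (hab x).2.2.2 (hlt x).le (hle x)
  have d2 := deform_slide (Q := Q) (u := fun x => u (x, 1)) (s := a)
    (c := fun x => a x + min (b x - a x) 1) hS1 (fun x => hSQ _) ha (by fun_prop) (by fun_prop)
    (fun x => (hab x).1) hlt (fun x => (hle x).trans (hab x).2.2.1.le) (fun x => (hut _).1)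
    (fun x => (hut _).2)
  have d3 : Deform (arcsTo Q) (fun x => (F x).ins (t x) 2) (fun x => (S (x, 1)).ins (u (x, 1)) 2) :=
    ⟨fun p => (S p).ins (u p) 2, by fun_prop,
      fun p => ins_mem_arcsTo (hSQ p) (hut p).1.le (hut p).2.le 2,
      fun x => by simp only [hS0, hu0], fun _ => rfl⟩
  exact ((d0.trans d1).trans d2).trans d3.symm

end

end Arc

/-! ### Homotopies of families of immersed curves -/

theorem Real.one_lt_cot {ρ : ℝ} (h0 : 0 < ρ) (h1 : ρ < Real.pi / 4) : 1 < Real.cot ρ := by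
  have hs : 0 < Real.sin ρ := Real.sin_pos_of_pos_of_lt_pi h0 (by linarith [Real.pi_pos])
  have h2 : Real.sin ρ < Real.sin (Real.pi / 4) :=
    Real.sin_lt_sin_of_lt_of_le_pi_div_two (by linarith) (by linarith [Real.pi_pos]) h1
  have h3 : Real.cos (Real.pi / 4) < Real.cos ρ :=
    Real.cos_lt_cos_of_nonneg_of_le_pi h0.le (by linarith [Real.pi_pos]) h1
  rw [Real.cot_eq_cos_div_sin, lt_div_iff₀ hs, one_mul]
  rw [Real.sin_pi_div_four] at h2
  rw [Real.cos_pi_div_four] at h3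
  linarith

namespace Arc

variable {Q : SO3}

/-- The arcs of positive length with final frame `Q`, as immersed curves. -/
def toImmersed (Q : SO3) : C(arcsTo Q, ImmersedCurve.immersed 1 Q) where
  toFun A := ⟨A.1.toCurve A.2.1, toCurve_mem_immersed A.2.1 A.2.2⟩
  continuous_toFun := (continuous_toCurve continuous_subtype_val fun A => A.2.1).subtype_mk _

/-- The arcs of curvature less than `cot ρ₀` with final frame `Q`, as immersed curves. -/
def toCurvesL (ρ₀ : ℝ) (Q : SO3) :
    C(boundedArcsTo (Real.cot ρ₀) Q, ImmersedCurve.curvesL ρ₀ Q) where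
  toFun A := ⟨A.1.toCurve A.2.1.1, toCurve_mem_curvesL A.2.1.1 A.2.1.2 A.2.2⟩
  continuous_toFun := (continuous_toCurve continuous_subtype_val fun A => A.2.1.1).subtype_mk _

end Arc

theorem ImmersedCurve.toArc_mem {Q : SO3} {γ : ImmersedCurve} (h : γ ∈ immersed 1 Q) :
    γ.toArc ∈ Arc.arcsTo Q := ⟨γ.len_pos, toArc_last h⟩

section

open Arc ImmersedCurve

variable {K : Type*} [TopologicalSpace K] {Q : SO3} {ρ₀ : ℝ}

/-- Homotopic families of arcs give homotopic families of immersed curves. -/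
theorem Arc.Deform.homotopic {F G : K → Arc} (h : Deform (arcsTo Q) F G)
    {f g : C(K, immersed 1 Q)} (hf : ∀ x, ∀ hA, (F x).toCurve hA = f x)
    (hg : ∀ x, ∀ hA, (G x).toCurve hA = g x) : f.Homotopic g := by
  obtain ⟨f', g', hfg, hf', hg'⟩ := deform_iff.1 h
  have e1 : (toImmersed Q).comp f' = f := ContinuousMap.ext fun x => Subtype.ext <| by
    have : ∀ hA, (f' x).1.toCurve hA = f x := by rw [hf']; exact hf x
    exact this _
  have e2 : (toImmersed Q).comp g' = g := ContinuousMap.ext fun x => Subtype.ext <| by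
    have : ∀ hA, (g' x).1.toCurve hA = g x := by rw [hg']; exact hg x
    exact this _
  rw [← e1, ← e2]
  exact (ContinuousMap.Homotopic.refl _).comp hfg

/-- A family of arcs of bounded curvature which can be deformed to a constant family gives a
nullhomotopic family of immersed curves of bounded curvature. -/
theorem Arc.Deform.nullhomotopic {F : K → Arc} {B : Arc} (hB : B ∈ boundedArcsTo (Real.cot ρ₀) Q)
    (h : Deform (boundedArcsTo (Real.cot ρ₀) Q) F fun _ => B) {f : C(K, curvesL ρ₀ Q)}
    (hf : ∀ x, ∀ hA, (F x).toCurve hA = f x) : f.Nullhomotopic := by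
  obtain ⟨f', g', hfg, hf', hg'⟩ := deform_iff.1 h
  have e1 : (toCurvesL ρ₀ Q).comp f' = f := ContinuousMap.ext fun x => Subtype.ext <| by
    have : ∀ hA, (f' x).1.toCurve hA = f x := by rw [hf']; exact hf x
    exact this _
  have e2 : g' = ContinuousMap.const K ⟨B, hB⟩ :=
    ContinuousMap.ext fun x => Subtype.ext (hg' x)
  refine ⟨toCurvesL ρ₀ Q ⟨B, hB⟩, ?_⟩
  rw [← e1]
  subst e2
  exact (ContinuousMap.Homotopic.refl (toCurvesL ρ₀ Q)).comp hfg

/-- If `f` is nullhomotopic among all immersed curves, then it becomes so within bounded curvature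
when great circles are inserted: sufficiently many circles, distributed along the curves,
make room for the whole nullhomotopy. -/
theorem exists_deform_ins_const [CompactSpace K] {κ : ℝ} (hκ : 1 < κ) {F : K → Arc} {t : K → ℝ}
    (hF : Continuous F) (ht : Continuous t) (hFQ : ∀ x, F x ∈ boundedArcsTo κ Q)
    (h0 : ∀ x, 0 ≤ t x) (h1 : ∀ x, t x ≤ (F x).len) {B : Arc} (hB : B ∈ arcsTo Q)
    (h : Deform (arcsTo Q) F fun _ => B) {n : ℕ} (hn : 1 ≤ n) :
    ∃ C ∈ boundedArcsTo κ Q,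
      Deform (boundedArcsTo κ Q) (fun x => (F x).ins (t x) (2 * n)) fun _ => C := by
  obtain ⟨H, hH, hHQ, hH0, hH1⟩ := h
  obtain ⟨N₁, hN₁⟩ := exists_fine hH
  -- If `K` is empty, then `B` is not a member of the family `H`.
  obtain ⟨N₂, hN₂⟩ := exists_fine (X := Unit) (F := fun _ => B) continuous_const
  obtain ⟨N, hNn, hN1, hN2⟩ : ∃ N, n ≤ N ∧ N₁ ≤ N ∧ N₂ ≤ N :=
    ⟨max n (max N₁ N₂), le_max_left _ _, (le_max_left _ _).trans (le_max_right _ _),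
      (le_max_right _ _).trans (le_max_right _ _)⟩
  have hN : 1 ≤ N := hn.trans hNn
  have hf := hN₁ N hN1 hN
  refine ⟨detours N B, detours_mem hκ hB.2 hN (hN₂ N hN2 hN ()), ?_⟩
  have d1 := deform_ins_add_even hκ hF ht hFQ h0 h1 (k := 2 * n) (by omega) (N - n)
  have e : 2 * n + 2 * (N - n) = 2 * N := by omega
  rw [e] at d1
  have d2 := deform_spread hκ hF ht hFQ h0 h1 hN
  have d3 := deform_detours hκ hF hFQ hN fun x => by
    rw [← hH0]
    exact hf _
  have d4 : Deform (boundedArcsTo κ Q) (fun x => detours N (F x)) (fun _ => detours N B) :=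
    ⟨fun p => detours N (H p), continuous_detours hH hN hf,
      fun p => detours_mem hκ (hHQ p).2 hN (hf p), fun x => by simp only [hH0],
      fun x => by simp only [hH1]⟩
  exact ((d1.trans d2).trans d3.symm).trans d4

end

end

theorem proposition4p5 (ρ₀ : ℝ) (hρ₀ : 0 < ρ₀) (hρ₀' : ρ₀ < Real.pi / 4)
    (Q : Matrix.specialOrthogonalGroup (Fin 3) ℝ) (n : ℕ) (hn : 1 ≤ n)
    {K : Type*} [TopologicalSpace K] [CompactSpace K]
    (t₀ : C(K, unitInterval)) (ht₀ : ∀ p, 0 < t₀ p ∧ t₀ p < 1)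
    (f : C(K, ImmersedCurve.curvesL ρ₀ Q)) :
    ∃ g : C(K, ImmersedCurve.curvesL ρ₀ Q),
      (∀ p, (g p : ImmersedCurve) = (f p : ImmersedCurve).graft (t₀ p) (2 * n)) ∧
      (((ContinuousMap.inclusion (ImmersedCurve.curvesL_subset_immersed ρ₀ Q)).comp f).Nullhomotopic
        ↔ g.Nullhomotopic) := by
  have hκ : 1 < Real.cot ρ₀ := Real.one_lt_cot hρ₀ hρ₀'
  obtain ⟨F, hFdef⟩ : ∃ F : K → Arc, F = fun x => (f x : ImmersedCurve).toArc := ⟨_, rfl⟩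
  obtain ⟨t, htdef⟩ : ∃ t : K → ℝ, t = fun x => (f x : ImmersedCurve).len * (t₀ x : ℝ) := ⟨_, rfl⟩
  have hfI : ∀ x, (f x : ImmersedCurve) ∈ ImmersedCurve.immersed 1 Q := fun x => (f x).2.1
  have hF : Continuous F := by rw [hFdef]; fun_prop
  have ht : Continuous t := by
    have : Continuous fun x => (f x : ImmersedCurve).len :=
      ImmersedCurve.continuous_len.comp (by fun_prop)
    rw [htdef]
    fun_prop
  have hFQ : ∀ x, F x ∈ Arc.boundedArcsTo (Real.cot ρ₀) Q := fun x => by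
    rw [hFdef]
    exact ⟨ImmersedCurve.toArc_mem (hfI x), ImmersedCurve.bounded_toArc (f x).2 (by linarith)⟩
  have h0 : ∀ x, 0 < t x := fun x => by
    rw [htdef]
    exact mul_pos (f x : ImmersedCurve).len_pos (ht₀ x).1
  have h1 : ∀ x, t x < (F x).len := fun x => by
    rw [htdef, hFdef]
    exact mul_lt_of_lt_one_right (f x : ImmersedCurve).len_pos (ht₀ x).2
  have hGQ : ∀ x, (F x).ins (t x) (2 * n) ∈ Arc.boundedArcsTo (Real.cot ρ₀) Q := fun x =>
    Arc.ins_mem_boundedArcsTo (by linarith) (hFQ x) (h0 x).le (h1 x).le _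
  have hFf : ∀ x, ∀ hA, (F x).toCurve hA = f x := fun x hA => by
    subst hFdef
    exact ImmersedCurve.toCurve_toArc (hfI x) hA
  have hGg : ∀ x, ∀ hA, ((F x).ins (t x) (2 * n)).toCurve hA =
      (f x : ImmersedCurve).graft (t₀ x) (2 * n) := fun x hA => by
    subst hFdef htdef
    exact ImmersedCurve.graft_eq_toCurve (hfI x) (t₀ x) (2 * n) hA
  have hgc : Continuous fun x => (⟨(F x).ins (t x) (2 * n), hGQ x⟩ :
      Arc.boundedArcsTo (Real.cot ρ₀) Q) := by fun_prop
  refine ⟨(Arc.toCurvesL ρ₀ Q).comp ⟨_, hgc⟩, fun x => hGg x _, ?_, ?_⟩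
  · rintro ⟨y, ⟨h⟩⟩
    have hdef : Arc.Deform (Arc.arcsTo Q) F fun _ => (y : ImmersedCurve).toArc := by
      refine ⟨fun p => (h (p.2, p.1) : ImmersedCurve).toArc, by fun_prop,
        fun p => ImmersedCurve.toArc_mem (h (p.2, p.1)).2, fun x => ?_, fun x => ?_⟩
      · simp only [ContinuousMap.Homotopy.apply_zero, hFdef]
        rfl
      · simp
    obtain ⟨C, hC, hd⟩ := exists_deform_ins_const hκ hF ht hFQ (fun x => (h0 x).le)
      (fun x => (h1 x).le) (ImmersedCurve.toArc_mem y.2) hdef hn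
    exact hd.nullhomotopic hC fun x hA => rfl
  · intro hg
    have d1 := Arc.deform_ins_two hF ht (fun x => (hFQ x).1) h0 h1
    have d2 := (Arc.deform_ins_add_even hκ hF ht hFQ (fun x => (h0 x).le) (fun x => (h1 x).le)
      (k := 2) (by omega) (n - 1)).mono (Arc.boundedArcsTo_subset _ _)
    have e : 2 + 2 * (n - 1) = 2 * n := by omega
    rw [e] at d2
    obtain ⟨y, hy⟩ := hg.comp_right
      (ContinuousMap.inclusion (ImmersedCurve.curvesL_subset_immersed ρ₀ Q))
    exact ⟨y, ((d1.trans d2).homotopic (fun x hA => hFf x hA) fun x hA => rfl).trans hy⟩
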